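/- **Setting.** Let $(S,A,P_{\rm env},r)$ be a finite Markov decision process with a fixed policy $\pi$. Put $P(s'\mid s)=\sum_a P_{\rm env}(s'\mid s,a)\pi(a\mid s)$, $r_s=\sum_a\pi(a\mid s)r(s,a)$, $R=(r_s)_{s\in S}$, $r_{\max}=\max_{s,a}|r(s,a)|$. Let $d\ge 1$ and let $\Phi\in\mathbb R^{S\times d}$ be a feature matrix with linearly independent columns whose rows $\phi(s)^\top$ satisfy $\|\phi(s)\|\le 1$. Assume that the Markov chain with transition matrix $P$ is irreducible and aperiodic. Then it has a unique stationary distribution $\mu$, $\mu(s)>0$ for all $s$, and there are constants $C>1$, $\beta\in[0,1)$ with $$\|p_\tau(\cdot\mid s)-\mu\|_1\le C\beta^\tau\qquad(\tau\ge 0,\ s\in S),\tag{1}$$ where $p_\tau(\cdot\mid s)$ is the law of the chain after $\tau$ steps from $s$; moreover $$\eta=\min_{\|x\|=1}\Big(\tfrac12\sum_{s,s'}\mu(s)P(s'\mid s)\big((\Phi x)(s)-(\Phi x)(s')\big)^2+(\mu^\top\Phi x)^2\Big)>0,$$ and, with $D=\mathrm{diag}(\mu)$ and $\Pi=I-e\mu^\top$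 ($e$ the all-ones vector), the linear system $\Phi^\top D(I-\Pi P)\Phi\theta^*=\Phi^\top D\Pi R$ has a unique solution $\theta^*$. Fix any $C,\beta$ as in (1) and put $L_1=\max\{1,\frac{\log C+1}{\log(1/\beta)}\}$ (so $L_1=1$ if $\beta=0$) and $\tau_{\rm mix}(\alpha)=\min\{\tau\in\mathbb N: C\beta^\tau\le\alpha\}$. **Algorithm.** Let $(s_t)_{t\ge0}$ and $(\hat s_t)_{t\ge0}$ be two independent Markov chains with transition matrix $P$ (arbitrary initial distributions), and let $\theta_0$ be a square-integrable random vector independent of them (for instance deterministic). The double-chain method with stepsizes $\alpha_t=a/(t+c_0)^\xi$, $a>0$, $\xi\in(0,1]$, is $$\theta_{t+1}=\theta_t+\alpha_t\Big(-\big(r_{s_t}+\phi(s_t)^\top\theta_t\big)\phi(\hat s_t)+\big(r_{s_t}+\phi(s_{t+1})^\top\theta_t-\phi(s_t)^\top\theta_t\big)\phi(s_t)\Big).$$ Put $$\beta_1=2\,\mathbb E\big(\|\theta_0\|+r_{\max}+2\|\theta^*\|\big)^2+2\,\mathbb E\|\theta_0-\theta^*\|^2,\quad \beta_2=946\,(r_{\max}+3\|\theta^*\|)^2,\quad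 \tilde\beta(T)=2L_1\beta_2\big(\log(T+c_0)-\log a+1\big).$$ **Theorem.** There are an absolute constant $K_0>0$ and a function $c_{\min}(a,\xi,\eta,C,\beta)>0$ such that the following holds. *(Error bounds.)* If $c_0\ge c_{\min}(a,\xi,\eta,C,\beta)$, then for every $T$ with $T\ge\tau_{\rm mix}:=\tau_{\rm mix}(\alpha_T)$ the vector $\theta_T$ is square integrable and: 1. if $\xi=1$, $$\mathbb E\|\theta_T-\theta^*\|^2\le\beta_1\Big(\frac{\tau_{\rm mix}+c_0}{T+c_0}\Big)^{a\eta}+\frac{\Gamma(T)}{(T+c_0)^{\min\{1,a\eta\}}},\qquad \Gamma(T)=\begin{cases}\frac{4a^2}{1-a\eta}\tilde\beta(T),&a\eta<1,\\ 4a^2\log(T+c_0)\,\tilde\beta(T),&a\eta=1,\\ \frac{4\mathrm e\,a^2}{a\eta-1}\tilde\beta(T),&a\eta>1;\end{cases}$$ 2. if $\xi\in(0,1)$, with $\Delta_T=(T+c_0)^{1-\xi}-(\tau_{\rm mix}+c_0)^{1-\xi}$, $$\mathbb E\|\theta_T-\theta^*\|^2\le\beta_1\exp\Big(-\frac{\eta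 a}{1-\xi}\Delta_T\Big)+\frac{2a\tilde\beta(T)}{\eta(T+c_0)^\xi},$$ and also, without the logarithmic factor, $$\mathbb E\|\theta_T-\theta^*\|^2\le\beta_1\exp\Big(-\frac{\eta a}{1-\xi}\Delta_T\Big)+K_0L_1(r_{\max}+3\|\theta^*\|)^2\,\frac{a}{\eta(T+c_0)^\xi}.$$ *(Sample complexity for $a=\Theta(1/\eta)$.)* Let $\xi\in(0,1]$ and $0<\kappa_1\le\kappa_2$, with $\kappa_1\ge1$ if $\xi=1$. There are $K,p>0$ depending only on $\xi,\kappa_1,\kappa_2$ such that, whenever $\kappa_1/\eta\le a\le\kappa_2/\eta$, there is a choice of $c_0\ge c_{\min}(a,\xi,\eta,C,\beta)$, depending only on $\xi,\kappa_1,\kappa_2,a,\eta,C,\beta$, for which, for every $\varepsilon\in(0,1)$ and every $$T\ge K\Big(L_1(1+\rho)\big(1+\log\tfrac1\varepsilon+\log(1+\tfrac1\eta)\big)\Big)^p\,\varepsilon^{-1/\xi}\,\eta^{-2/\xi},\qquad \rho=\big(\mathbb E\|\theta_0-\theta^*\|^2\big)^{1/2}+r_{\max}+\|\theta^*\|,$$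 one has $T\ge\tau_{\rm mix}(\alpha_T)$ and $\mathbb E\|\theta_T-\theta^*\|^2\le\varepsilon$. That is, the sample complexity is $\tilde O(\varepsilon^{-1/\xi}\eta^{-2/\xi})$, which is $\tilde O(\varepsilon^{-1}\eta^{-2})$ for $\xi=1$. -/

import Mathlib

open MeasureTheory ProbabilityTheory

universe u v w

noncomputable section

namespace AvgRewardTD

/-- A finite Markov decision process `(S, A, P_env, r)`, a fixed policy, and a feature map with
values in `ℝ^d`. The features are normalized and the columns of the feature matrix are linearly
independent. -/
structure PolicyEvaluation (S : Type u) (A : Type v) [Fintype S] [Fintype A] (d : ℕ) where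
  /-- `Penv s a s'` is the probability of moving from `s` to `s'` under the action `a`. -/
  Penv : S → A → S → ℝ
  Penv_nonneg : ∀ s a s', 0 ≤ Penv s a s'
  Penv_sum : ∀ s a, ∑ s', Penv s a s' = 1
  /-- the reward function -/
  r : S → A → ℝ
  /-- `pol s a` is the probability of taking the action `a` in the state `s`. -/
  pol : S → A → ℝ
  pol_nonneg : ∀ s a, 0 ≤ pol s a
  pol_sum : ∀ s, ∑ a, pol s a = 1
  /-- the feature vector of a state -/
  φ : S → EuclideanSpace ℝ (Fin d)
  norm_φ_le : ∀ s, ‖φ s‖ ≤ 1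
  φ_columns : LinearIndependent ℝ (fun (j : Fin d) (s : S) => φ s j)

/-- Aperiodicity: for every state, `1` is the greatest common divisor of the possible return
times. -/
def IsAperiodic {S : Type u} [Fintype S] [DecidableEq S] (P : Matrix S S ℝ) : Prop :=
  ∀ s : S, ∀ k : ℕ, (∀ n : ℕ, 0 < n → 0 < (P ^ n) s s → k ∣ n) → k = 1

/-- The probability vector `μ` is a stationary distribution of `P`. -/
def IsStationaryDist {S : Type u} [Fintype S] (P : Matrix S S ℝ) (μ : S → ℝ) : Prop :=
  μ ∈ stdSimplex ℝ S ∧ Matrix.vecMul μ P = μ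

/-- `C > 1` and `β ∈ [0,1)` are geometric mixing constants:
`‖p_τ(· | s) - μ‖₁ ≤ C β^τ` for all `τ` and `s`. -/
def IsMixing {S : Type u} [Fintype S] [DecidableEq S] (P : Matrix S S ℝ) (μ : S → ℝ)
    (C β : ℝ) : Prop :=
  1 < C ∧ 0 ≤ β ∧ β < 1 ∧ ∀ (τ : ℕ) (s : S), ∑ s', |(P ^ τ) s s' - μ s'| ≤ C * β ^ τ

namespace PolicyEvaluation

variable {S : Type u} {A : Type v} [Fintype S] [Fintype A] {d : ℕ}

/-- The transition matrix induced by the policy; `M.P s s'` is `P(s' | s)`. -/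
def P (M : PolicyEvaluation S A d) : Matrix S S ℝ :=
  Matrix.of fun s s' => ∑ a, M.Penv s a s' * M.pol s a

/-- The expected reward `r_s` in the state `s` under the policy. -/
def R (M : PolicyEvaluation S A d) (s : S) : ℝ := ∑ a, M.pol s a * M.r s a

/-- `r_max = max_{s,a} |r(s,a)|`. -/
def rmax (M : PolicyEvaluation S A d) : ℝ := ⨆ p : S × A, |M.r p.1 p.2|

/-- The feature matrix, with rows `φ(s)ᵀ`. -/
def Φ (M : PolicyEvaluation S A d) : Matrix S (Fin d) ℝ := Matrix.of fun s j => M.φ s j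

/-- The squared Dirichlet seminorm. -/
def dirichletSq (M : PolicyEvaluation S A d) (μ : S → ℝ) (f : S → ℝ) : ℝ :=
  (1 / 2) * ∑ s, ∑ s', μ s * M.P s s' * (f s - f s') ^ 2

/-- The condition number `η = min_{‖x‖ = 1} ‖Φ x‖²_Dir + (μᵀ Φ x)²`. -/
def eta (M : PolicyEvaluation S A d) (μ : S → ℝ) : ℝ :=
  sInf ((fun x : EuclideanSpace ℝ (Fin d) =>
    M.dirichletSq μ (M.Φ.mulVec x) + (μ ⬝ᵥ M.Φ.mulVec x) ^ 2) '' Metric.sphere 0 1)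

/-- `Π = I - e μᵀ`. -/
def proj [DecidableEq S] (μ : S → ℝ) : Matrix S S ℝ := 1 - Matrix.vecMulVec 1 μ

/-- `θ` solves `Φᵀ D (I - Π P) Φ θ = Φᵀ D Π R`, where `D = diag(μ)`. -/
def IsFixedPoint [DecidableEq S] (M : PolicyEvaluation S A d) (μ : S → ℝ)
    (θ : EuclideanSpace ℝ (Fin d)) : Prop :=
  (M.Φ.transpose * Matrix.diagonal μ * (1 - proj μ * M.P) * M.Φ).mulVec θ =
    (M.Φ.transpose * Matrix.diagonal μ * proj μ).mulVec M.R

/-- `f(s, ŝ, θ) = -(r_s + φ(s)ᵀ θ) φ(ŝ)`. -/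
def f (M : PolicyEvaluation S A d) (s sHat : S) (θ : EuclideanSpace ℝ (Fin d)) :
    EuclideanSpace ℝ (Fin d) :=
  (-(M.R s + inner ℝ (M.φ s) θ)) • M.φ sHat

/-- `g(s, s', θ) = (r_s + φ(s')ᵀ θ - φ(s)ᵀ θ) φ(s)`. -/
def g (M : PolicyEvaluation S A d) (s s' : S) (θ : EuclideanSpace ℝ (Fin d)) :
    EuclideanSpace ℝ (Fin d) :=
  (M.R s + inner ℝ (M.φ s') θ - inner ℝ (M.φ s) θ) • M.φ s

/-- The iterates of the double-chain algorithm with stepsizes `α`, driven by the two state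
sequences `s` and `sHat`; under Markov sampling the successor of `s_t` is `s_{t+1}`. -/
def iterate (M : PolicyEvaluation S A d) {Ω : Type w} (α : ℕ → ℝ) (s sHat : ℕ → Ω → S)
    (θ₀ : Ω → EuclideanSpace ℝ (Fin d)) : ℕ → Ω → EuclideanSpace ℝ (Fin d)
  | 0, ω => θ₀ ω
  | t + 1, ω =>
    M.iterate α s sHat θ₀ t ω +
      α t • (M.f (s t ω) (sHat t ω) (M.iterate α s sHat θ₀ t ω) +
        M.g (s t ω) (s (t + 1) ω) (M.iterate α s sHat θ₀ t ω))

end PolicyEvaluation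

/-- `s` is a time-homogeneous Markov chain with transition matrix `P` under `Pr`, started from an
arbitrary initial distribution. -/
def IsMarkovChain {S : Type u} [MeasurableSpace S] {Ω : Type w} [MeasurableSpace Ω]
    (P : Matrix S S ℝ) (Pr : Measure Ω) (s : ℕ → Ω → S) : Prop :=
  (∀ t, Measurable (s t)) ∧
    ∀ (n : ℕ) (x : ℕ → S),
      Pr {ω | ∀ i ≤ n + 1, s i ω = x i} =
        Pr {ω | ∀ i ≤ n, s i ω = x i} * ENNReal.ofReal (P (x n) (x (n + 1)))

/-- Markov sampling for the double-chain algorithm: `s` and `sHat` are independent Markov chains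
with transition matrix `P`, and the square-integrable initial parameter `θ₀` (for instance a
constant) is independent of them. -/
structure IsDoubleChain {S : Type u} [MeasurableSpace S] {Ω : Type w} [MeasurableSpace Ω] {d : ℕ}
    (P : Matrix S S ℝ) (Pr : Measure Ω) (s sHat : ℕ → Ω → S)
    (θ₀ : Ω → EuclideanSpace ℝ (Fin d)) : Prop where
  chain : IsMarkovChain P Pr s
  chainHat : IsMarkovChain P Pr sHat
  indep : IndepFun (fun ω t => s t ω) (fun ω t => sHat t ω) Pr
  measurable_init : Measurable θ₀
  memLp_init : MemLp θ₀ 2 Pr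
  indep_init : IndepFun θ₀ (fun ω => ((fun t => s t ω), (fun t => sHat t ω))) Pr

/-- The random vector `X` is square integrable and `E ‖X‖² ≤ b`. -/
def MeanSquareLE {Ω : Type w} [MeasurableSpace Ω] {d : ℕ} (Pr : Measure Ω)
    (X : Ω → EuclideanSpace ℝ (Fin d)) (b : ℝ) : Prop :=
  MemLp X 2 Pr ∧ ∫ ω, ‖X ω‖ ^ 2 ∂Pr ≤ b

/-- The stepsize `α_t = a / (t + c₀)^ξ`. -/
def stepsize (a c₀ ξ : ℝ) (t : ℕ) : ℝ := a / ((t : ℝ) + c₀) ^ ξ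

/-- The mixing time `τ_mix(α) = min {τ | C β^τ ≤ α}`. -/
def tauMix (C β α : ℝ) : ℕ := sInf {τ : ℕ | C * β ^ τ ≤ α}

/-- `L₁ = max {1, (log C + 1) / log (1/β)}`. For `β = 0` this is `1`, in accordance with
`log (1/0) = ∞`. -/
def L1 (C β : ℝ) : ℝ := max 1 ((Real.log C + 1) / Real.log (1 / β))

/-- `β₁ = 2 E (‖θ₀‖ + r_max + 2 ‖θ*‖)² + 2 E ‖θ₀ - θ*‖²`. -/
def beta1 {Ω : Type w} [MeasurableSpace Ω] {d : ℕ} (Pr : Measure Ω)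
    (θ₀ : Ω → EuclideanSpace ℝ (Fin d)) (rmax : ℝ) (θs : EuclideanSpace ℝ (Fin d)) : ℝ :=
  2 * ∫ ω, (‖θ₀ ω‖ + rmax + 2 * ‖θs‖) ^ 2 ∂Pr + 2 * ∫ ω, ‖θ₀ ω - θs‖ ^ 2 ∂Pr

/-- `β₂ = 946 (r_max + 3 ‖θ*‖)²`. -/
def beta2 {d : ℕ} (rmax : ℝ) (θs : EuclideanSpace ℝ (Fin d)) : ℝ := 946 * (rmax + 3 * ‖θs‖) ^ 2

/-- `2 L₁ β₂ (log (T + c₀) - log a + 1)`, where `L = L₁` and `b₂ = β₂`. -/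
def betaTilde (a c₀ L b₂ : ℝ) (T : ℕ) : ℝ :=
  2 * L * b₂ * (Real.log ((T : ℝ) + c₀) - Real.log a + 1)

/-- The coefficient `Γ(T)` of the second term in the case `ξ = 1`. -/
def Gam (a c₀ η L b₂ : ℝ) (T : ℕ) : ℝ :=
  if a * η < 1 then 4 * a ^ 2 / (1 - a * η) * betaTilde a c₀ L b₂ T
  else if a * η = 1 then 4 * a ^ 2 * Real.log ((T : ℝ) + c₀) * betaTilde a c₀ L b₂ T
  else 4 * Real.exp 1 * a ^ 2 / (a * η - 1) * betaTilde a c₀ L b₂ T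

/-- The number of iterations
`K (L₁ (1 + ρ) (1 + log (1/ε) + log (1 + 1/η)))^p ε^{-1/ξ} η^{-2/ξ}`: it is
`Õ(ε^{-1/ξ} η^{-2/ξ})`, with a polynomial dependence on the size `ρ` of the problem. -/
def sampleBound (K p ξ η L ρ ε : ℝ) : ℝ :=
  K * (L * (1 + ρ) * (1 + Real.log (1 / ε) + Real.log (1 + 1 / η))) ^ p *
    ε ^ (-1 / ξ) * η ^ (-2 / ξ)

end AvgRewardTD

end

open AvgRewardTD

/-! Write F(Y_t, Y_{t+1}, θ) for the update direction, where Y_t = (s_t, ŝ_t) is a Markov chain with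
matrix Q = P ⊗ P and stationary law μ ⊗ μ. Because the two chains are independent, the stationary
mean of -(r_s + φ(s)ᵀθ) φ(ŝ) is a product of two means. This supplies exactly the rank-one term of Π
= I - e μᵀ, so the mean direction at θ is Φᵀ D Π R - Φᵀ D (I - Π P) Φ θ. By stationarity the
quadratic form of that matrix is the Dirichlet form plus (μᵀ Φ x)². Hence the mean direction has
inner product at most -η‖θ - θ*‖² with θ - θ*. Mixing makes the form positive definite, which gives
η > 0 and the unique θ*.

The noise is Markovian, so the conditional mean of F given the past is not its stationary mean. The
difference is removed by a Poisson equation. With Z = ∑_k (Q^k - e (μ ⊗ μ)ᵀ), the corrector V(i, θ)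
= ∑_k Z_{ik} h(k, θ), where h(k, θ) is the average of F(k, ·, θ) over the successors of k, satisfies
Q(F + V) = mean + V. The rows of Z have absolute sum O(L₁). Therefore W_t = E[‖θ_t - θ*‖² + 2 α_t
⟨θ_t - θ*, V(Y_t, θ_t)⟩] obeys the scalar recursion W_{t+1} ≤ (1 - η α_t) W_t + O(L₁ G²)(α_t² + α_t
- α_{t+1}) with G = r_max + 3‖θ*‖, and W_t is comparable to the mean square error once α_t L₁ is
small. The main lemmas are `exists_corrector`, `integral_markov_step` and `exists_lyapunov`.

The scalar recursion is compared with explicit supersolutions (`le_of_recursion`): a homogeneous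
one, which is a power or an exponential, and a particular one, which is α_t/η for ξ < 1 and the
solution of v' = -m v/x + k/x² with m = aη for ξ = 1. This works from time 0. The resulting bounds
contain c₀ where the theorem has τ_mix + c₀, and they carry no logarithm except at the resonance aη
= 1; the stated bounds follow by monotonicity.

For the sample complexity, c₀ is taken to be the smallest admissible offset, which is O(L₁^{1/ξ}
η^{-2/ξ}) when a = Θ(1/η). The prescribed T then exceeds c₀ and the mixing time and makes both terms
of the error bound small. -/

namespace AvgRewardTD

/-! ### Finite stochastic matrices: primitivity, stationary law, geometric mixing. -/

section Stochastic

open Matrix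

variable {S : Type*} [Fintype S] [DecidableEq S] {P : Matrix S S ℝ}

lemma pow_add_apply_pos (hP : ∀ i j, 0 ≤ P i j) {m n : ℕ} {i j k : S}
    (h₁ : 0 < (P ^ m) i j) (h₂ : 0 < (P ^ n) j k) : 0 < (P ^ (m + n)) i k := by
  rw [pow_add, mul_apply]
  exact (mul_pos h₁ h₂).trans_le (Finset.single_le_sum (f := fun j => (P ^ m) i j * (P ^ n) j k)
    (fun l _ => mul_nonneg (pow_apply_nonneg hP m i l) (pow_apply_nonneg hP n l k))
    (Finset.mem_univ j))

/-- In an aperiodic chain, every state can be its own successor after any large time. -/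
lemma exists_forall_ge_pow_apply_self_pos (hP : ∀ i j, 0 ≤ P i j) (h : IsAperiodic P) (i : S) :
    ∃ N, ∀ n ≥ N, 0 < (P ^ n) i i := by
  -- The additive closure of a set of naturals contains all large multiples of its gcd, here all
  -- large integers. The times with positive return probability are themselves closed under
  -- addition, so nothing is gained by passing to the closure.
  obtain ⟨N, hN⟩ := Nat.exists_mem_closure_of_ge {n : ℕ | 0 < n ∧ 0 < (P ^ n) i i}
  have hgcd : Nat.setGcd {n : ℕ | 0 < n ∧ 0 < (P ^ n) i i} = 1 :=
    h i _ fun n h₀ h₁ => Nat.setGcd_dvd_of_mem ⟨h₀, h₁⟩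
  refine ⟨N, fun n hn => ?_⟩
  have hmem := hN n hn (by simp [hgcd])
  clear hn
  induction hmem using AddSubmonoid.closure_induction with
  | mem x hx => exact hx.2
  | zero => simp
  | add x y _ _ hx hy => exact pow_add_apply_pos hP hx hy

/-- An irreducible aperiodic matrix is primitive. -/
lemma exists_pow_pos (h : P.IsIrreducible) (h' : IsAperiodic P) :
    ∃ N, 0 < N ∧ ∀ i j, 0 < (P ^ N) i j := by
  choose n hn using exists_forall_ge_pow_apply_self_pos h.nonneg h'
  choose k _ hk using (isIrreducible_iff_exists_pow_pos h.nonneg).1 h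
  -- One exponent for all pairs: after removing the path length `k i j`, at least `n i` steps
  -- remain, and these are spent on a loop at `i`. The `+ 1` makes the exponent positive.
  refine ⟨(∑ i, ∑ j, k i j) + ∑ i, n i + 1, by omega, fun i j => ?_⟩
  have h₁ : k i j ≤ ∑ i, ∑ j, k i j :=
    (Finset.single_le_sum (f := fun j => k i j) (fun _ _ => Nat.zero_le _)
      (Finset.mem_univ j)).trans
      (Finset.single_le_sum (f := fun i => ∑ j, k i j) (fun _ _ => Nat.zero_le _)
      (Finset.mem_univ i))
  have h₂ : n i ≤ ∑ i, n i := Finset.single_le_sum (f := n) (fun _ _ => Nat.zero_le _)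
    (Finset.mem_univ i)
  have : (∑ i, ∑ j, k i j) + ∑ i, n i + 1 = ((∑ i, ∑ j, k i j) + ∑ i, n i + 1 - k i j) + k i j := by
    omega
  rw [this]
  exact pow_add_apply_pos h.nonneg (hn i _ (by omega)) (hk i j)

lemma IsStationaryDist.vecMul_pow {μ : S → ℝ} (h : IsStationaryDist P μ) (n : ℕ) :
    μ ᵥ* (P ^ n) = μ := by
  induction n with
  | zero => simp
  | succ n ih => rw [pow_succ, ← vecMul_vecMul, ih, h.2]

/-- Every finite stochastic matrix has a stationary distribution. -/
lemma exists_isStationaryDist [Nonempty S] (hP : P ∈ rowStochastic ℝ S) :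
    ∃ μ, IsStationaryDist P μ := by
  -- The vector of ones is a right null vector of `1 - P`, so a left null vector exists too; only
  -- its sign is unknown.
  have hdet : (1 - P).det = 0 := by
    refine exists_mulVec_eq_zero_iff.1 ⟨1, one_ne_zero, ?_⟩
    rw [sub_mulVec, hP.2, one_mulVec, sub_self]
  obtain ⟨v, hv0, hv⟩ := exists_vecMul_eq_zero_iff.2 hdet
  have hvP : v ᵥ* P = v := by
    rw [vecMul_sub, vecMul_one, sub_eq_zero] at hv
    exact hv.symm
  -- By the triangle inequality |v| ≤ |v| P entrywise. Both sides have the same total mass because P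
  -- is stochastic, so they are equal, and |v| only has to be normalized.
  set w : S → ℝ := fun i => |v i| with hw
  have hle : ∀ j, w j ≤ (w ᵥ* P) j := fun j => by
    calc w j = |∑ i, v i * P i j| := by
          exact congrArg abs (congrFun hvP j).symm
      _ ≤ ∑ i, |v i * P i j| := Finset.abs_sum_le_sum_abs _ _
      _ = (w ᵥ* P) j := by
          simp only [vecMul, dotProduct, hw, abs_mul, abs_of_nonneg (hP.1 _ _)]
  have hsum : ∑ j, w j = ∑ j, (w ᵥ* P) j := by
    simp only [vecMul, dotProduct]
    rw [Finset.sum_comm]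
    simp [← Finset.mul_sum, sum_row_of_mem_rowStochastic hP]
  have heq : w ᵥ* P = w := funext fun j =>
    ((Finset.sum_eq_sum_iff_of_le fun j _ => hle j).1 hsum j (Finset.mem_univ j)).symm
  have hpos : 0 < ∑ j, w j := by
    obtain ⟨i, hi⟩ := Function.ne_iff.1 hv0
    exact Finset.sum_pos' (fun _ _ => abs_nonneg _) ⟨i, Finset.mem_univ _, abs_pos.2 hi⟩
  refine ⟨(∑ j, w j)⁻¹ • w, ⟨fun i => ?_, ?_⟩, ?_⟩
  · exact mul_nonneg (inv_nonneg.2 hpos.le) (abs_nonneg _)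
  · simp only [Pi.smul_apply, smul_eq_mul, ← Finset.mul_sum]
    exact inv_mul_cancel₀ hpos.ne'
  · rw [smul_vecMul, heq]

lemma IsStationaryDist.pos {μ : S → ℝ} (h : IsStationaryDist P μ) {N : ℕ}
    (hN : ∀ i j, 0 < (P ^ N) i j) (s : S) : 0 < μ s := by
  rw [← h.vecMul_pow N]
  have : ∃ i, μ i ≠ 0 := by
    by_contra! hc
    have := h.1.2
    simp [hc] at this
  obtain ⟨i, hi⟩ := this
  exact Finset.sum_pos' (fun j _ => mul_nonneg (h.1.1 j) (hN j s).le)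
    ⟨i, Finset.mem_univ i, mul_pos ((h.1.1 i).lt_of_ne' hi) (hN i s)⟩

/-- Doeblin's contraction: a stochastic matrix with entries at least `δ` contracts vectors of zero
sum by the factor `1 - δ`. -/
lemma sum_abs_vecMul_le [Nonempty S] {Q : Matrix S S ℝ} (hQ : Q ∈ rowStochastic ℝ S) {δ : ℝ}
    (hδ : ∀ i j, δ ≤ Q i j) (h0 : 0 ≤ δ) {w : S → ℝ} (hw : ∑ i, w i = 0) :
    ∑ j, |(w ᵥ* Q) j| ≤ (1 - δ) * ∑ i, |w i| := by
  -- Zero total mass allows the constant `δ` to be subtracted from every entry at no cost. The rows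
  -- of the remaining nonnegative matrix have mass 1 - |S| δ.
  have h1 : ∀ j, (w ᵥ* Q) j = ∑ i, w i * (Q i j - δ) := fun j => by
    simp only [vecMul, dotProduct, mul_sub, Finset.sum_sub_distrib, ← Finset.sum_mul, hw]
    ring
  calc ∑ j, |(w ᵥ* Q) j| ≤ ∑ j, ∑ i, |w i| * (Q i j - δ) := by
        refine Finset.sum_le_sum fun j _ => ?_
        rw [h1]
        refine (Finset.abs_sum_le_sum_abs _ _).trans_eq (Finset.sum_congr rfl fun i _ => ?_)
        rw [abs_mul, abs_of_nonneg (sub_nonneg.2 (hδ i j))]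
    _ = (1 - Fintype.card S * δ) * ∑ i, |w i| := by
        rw [Finset.sum_comm, Finset.mul_sum]
        refine Finset.sum_congr rfl fun i _ => ?_
        rw [← Finset.mul_sum, Finset.sum_sub_distrib, sum_row_of_mem_rowStochastic hQ i]
        simp [mul_comm]
    _ ≤ (1 - δ) * ∑ i, |w i| := by
        refine mul_le_mul_of_nonneg_right ?_ (Finset.sum_nonneg fun _ _ => abs_nonneg _)
        have : (1 : ℝ) ≤ Fintype.card S := by exact_mod_cast Fintype.card_pos
        nlinarith

lemma sum_vecMul {Q : Matrix S S ℝ} (hQ : Q ∈ rowStochastic ℝ S) (w : S → ℝ) :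
    ∑ j, (w ᵥ* Q) j = ∑ i, w i := by
  simp only [vecMul, dotProduct]
  rw [Finset.sum_comm]
  simp [← Finset.mul_sum, sum_row_of_mem_rowStochastic hQ]

lemma sum_abs_vecMul_le_sum_abs [Nonempty S] {Q : Matrix S S ℝ} (hQ : Q ∈ rowStochastic ℝ S)
    {w : S → ℝ} (hw : ∑ i, w i = 0) : ∑ j, |(w ᵥ* Q) j| ≤ ∑ i, |w i| := by
  simpa using sum_abs_vecMul_le hQ hQ.1 le_rfl hw

lemma sum_abs_vecMul_pow_le [Nonempty S] {Q : Matrix S S ℝ} (hQ : Q ∈ rowStochastic ℝ S) {δ : ℝ}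
    (hδ : ∀ i j, δ ≤ Q i j) (h0 : 0 ≤ δ) (h1 : δ ≤ 1) (n : ℕ) {w : S → ℝ} (hw : ∑ i, w i = 0) :
    ∑ j, |(w ᵥ* (Q ^ n)) j| ≤ (1 - δ) ^ n * ∑ i, |w i| := by
  induction n with
  | zero => simp
  | succ n ih =>
    rw [pow_succ, ← vecMul_vecMul]
    refine (sum_abs_vecMul_le hQ hδ h0 ((sum_vecMul (pow_mem hQ n) w).trans hw)).trans ?_
    rw [pow_succ, mul_comm (_ ^ n), mul_assoc]
    exact mul_le_mul_of_nonneg_left ih (by linarith)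

/-- The cap 1/2 keeps `1 - δ` positive, so that it can be divided by and has a positive root. -/
lemma exists_forall_le_of_pos {ι : Type*} [Finite ι] [Nonempty ι] {Q : Matrix ι ι ℝ} (hQ : ∀ i j, 0 < Q i j) :
    ∃ δ, 0 < δ ∧ δ ≤ 1 / 2 ∧ ∀ i j, δ ≤ Q i j := by
  obtain ⟨p, hp⟩ := Finite.exists_min fun p : ι × ι => Q p.1 p.2
  exact ⟨min (Q p.1 p.2) (1 / 2), lt_min (hQ _ _) (by norm_num), min_le_right _ _,
    fun i j => (min_le_left _ _).trans (hp (i, j))⟩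

/-- The difference of two stationary laws has zero sum and is fixed by `P ^ N`, which is a strict
contraction on such vectors. -/
lemma IsStationaryDist.eq [Nonempty S] {μ ν : S → ℝ} (hP : P ∈ rowStochastic ℝ S)
    (hμ : IsStationaryDist P μ) (hν : IsStationaryDist P ν) {N : ℕ}
    (hN : ∀ i j, 0 < (P ^ N) i j) : μ = ν := by
  obtain ⟨δ, h0, -, hδ⟩ := exists_forall_le_of_pos hN
  have hw : ∑ i, (μ - ν) i = 0 := by
    simp [Finset.sum_sub_distrib, hμ.1.2, hν.1.2]
  have := sum_abs_vecMul_le (pow_mem hP N) hδ h0.le hw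
  rw [sub_vecMul, hμ.vecMul_pow, hν.vecMul_pow] at this
  have h : ∑ i, |(μ - ν) i| = 0 :=
    le_antisymm (by nlinarith) (Finset.sum_nonneg fun _ _ => abs_nonneg _)
  rw [Finset.sum_eq_zero_iff_of_nonneg fun _ _ => abs_nonneg _] at h
  exact funext fun i => sub_eq_zero.1 (abs_eq_zero.1 (h i (Finset.mem_univ i)))

lemma single_sub_vecMul_pow {μ : S → ℝ} (hμ : IsStationaryDist P μ) (s s' : S) (τ : ℕ) :
    ((Pi.single s 1 - μ) ᵥ* (P ^ τ)) s' = (P ^ τ) s s' - μ s' := by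
  rw [sub_vecMul, hμ.vecMul_pow, single_one_vecMul]
  rfl

lemma sum_single_sub {μ : S → ℝ} (hμ : IsStationaryDist P μ) (s : S) :
    ∑ i, (Pi.single s 1 - μ : S → ℝ) i = 0 := by
  simp [Finset.sum_sub_distrib, hμ.1.2]

lemma sum_abs_sub_le_two {ι : Type*} [Fintype ι] {μ ν : ι → ℝ} (hμ : μ ∈ stdSimplex ℝ ι)
    (hν : ν ∈ stdSimplex ℝ ι) :
    ∑ i, |μ i - ν i| ≤ 2 :=
  calc ∑ i, |μ i - ν i| ≤ ∑ i, (μ i + ν i) := Finset.sum_le_sum fun i _ =>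
        abs_le.2 ⟨by linarith [hμ.1 i, hν.1 i], by linarith [hμ.1 i, hν.1 i]⟩
    _ = 2 := by rw [Finset.sum_add_distrib, hμ.2, hν.2]; norm_num

lemma row_mem_stdSimplex (hP : P ∈ rowStochastic ℝ S) (s : S) : P s ∈ stdSimplex ℝ S :=
  ⟨hP.1 s, sum_row_of_mem_rowStochastic hP s⟩

/-- Geometric mixing of a primitive chain. -/
lemma exists_isMixing [Nonempty S] {μ : S → ℝ} (hP : P ∈ rowStochastic ℝ S)
    (hμ : IsStationaryDist P μ) {N : ℕ} (hN0 : 0 < N) (hN : ∀ i j, 0 < (P ^ N) i j) :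
    ∃ C β : ℝ, IsMixing P μ C β := by
  obtain ⟨δ, h0, h2, hδ⟩ := exists_forall_le_of_pos hN
  have hb : 0 < 1 - δ := by linarith
  have hN' : (N : ℝ) ≠ 0 := by exact_mod_cast hN0.ne'
  -- Only blocks of `N` steps contract, by the factor 1 - δ; the root spreads this over single
  -- steps.
  set β : ℝ := (1 - δ) ^ (1 / (N : ℝ)) with hβ
  have hβ0 : 0 < β := Real.rpow_pos_of_pos hb _
  have hβ1 : β < 1 := Real.rpow_lt_one hb.le (by linarith) (by positivity)
  have hβN : β ^ N = 1 - δ := by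
    rw [hβ, ← Real.rpow_natCast, ← Real.rpow_mul hb.le, one_div, inv_mul_cancel₀ hN', Real.rpow_one]
  -- The 2 bounds the mass of a point mass minus `μ`, and the division by 1 - δ pays for the last
  -- incomplete block.
  refine ⟨2 / (1 - δ), β, ?_, hβ0.le, hβ1, fun τ s => ?_⟩
  · rw [lt_div_iff₀ hb]; linarith
  have key : ∑ s', |(P ^ τ) s s' - μ s'| ≤ (1 - δ) ^ (τ / N) * 2 := by
    simp_rw [← single_sub_vecMul_pow hμ]
    have : P ^ τ = (P ^ N) ^ (τ / N) * P ^ (τ % N) := by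
      rw [← pow_mul, ← pow_add, Nat.div_add_mod]
    rw [this, ← vecMul_vecMul]
    refine (sum_abs_vecMul_le_sum_abs (pow_mem hP _) ?_).trans
      ((sum_abs_vecMul_pow_le (pow_mem hP N) hδ h0.le (by linarith) _
        (sum_single_sub hμ s)).trans ?_)
    · rw [sum_vecMul (pow_mem (pow_mem hP N) _), sum_single_sub hμ]
    · refine mul_le_mul_of_nonneg_left ?_ (by positivity)
      refine sum_abs_sub_le_two ?_ hμ.1
      exact single_mem_stdSimplex ℝ s
  refine key.trans ?_
  have : β ^ (N * (τ / N) + N) ≤ β ^ τ := by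
    refine pow_le_pow_of_le_one hβ0.le hβ1.le ?_
    have := Nat.div_add_mod τ N
    have := Nat.mod_lt τ hN0
    omega
  rw [pow_add, pow_mul, hβN] at this
  rw [div_mul_eq_mul_div, le_div_iff₀ hb]
  nlinarith

end Stochastic

/-! ### The mean dynamics: the quadratic form, η and θ*. -/

namespace PolicyEvaluation

open Matrix

variable {S : Type*} {A : Type*} [Fintype S] [Fintype A] {d : ℕ} (M : PolicyEvaluation S A d)

lemma P_nonneg (s s' : S) : 0 ≤ M.P s s' :=
  Finset.sum_nonneg fun a _ => mul_nonneg (M.Penv_nonneg s a s') (M.pol_nonneg s a)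

lemma P_sum (s : S) : ∑ s', M.P s s' = 1 := by
  simp only [P, of_apply]
  rw [Finset.sum_comm]
  simp [← Finset.sum_mul, M.Penv_sum, M.pol_sum]

lemma P_mem_rowStochastic [DecidableEq S] : M.P ∈ rowStochastic ℝ S :=
  mem_rowStochastic_iff_sum.2 ⟨M.P_nonneg, M.P_sum⟩

lemma abs_r_le_rmax (s : S) (a : A) : |M.r s a| ≤ M.rmax :=
  le_ciSup (f := fun p : S × A => |M.r p.1 p.2|) (Set.finite_range _).bddAbove (s, a)

lemma rmax_nonneg : 0 ≤ M.rmax := Real.iSup_nonneg fun _ => abs_nonneg _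

lemma abs_R_le_rmax (s : S) : |M.R s| ≤ M.rmax :=
  calc |M.R s| ≤ ∑ a, |M.pol s a * M.r s a| := Finset.abs_sum_le_sum_abs _ _
    _ ≤ ∑ a, M.pol s a * M.rmax := Finset.sum_le_sum fun a _ => by
        rw [abs_mul, abs_of_nonneg (M.pol_nonneg s a)]
        exact mul_le_mul_of_nonneg_left (M.abs_r_le_rmax s a) (M.pol_nonneg s a)
    _ = M.rmax := by rw [← Finset.sum_mul, M.pol_sum, one_mul]

lemma Φ_mulVec_apply (x : EuclideanSpace ℝ (Fin d)) (s : S) :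
    (M.Φ *ᵥ x) s = inner ℝ (M.φ s) x := by
  simp [Φ, mulVec, dotProduct, PiLp.inner_apply, mul_comm]

lemma abs_inner_φ_le (x : EuclideanSpace ℝ (Fin d)) (s : S) : |inner ℝ (M.φ s) x| ≤ ‖x‖ :=
  (abs_real_inner_le_norm _ _).trans
    (mul_le_of_le_one_left (norm_nonneg _) (M.norm_φ_le s))

lemma Φ_mulVec_injective {x : EuclideanSpace ℝ (Fin d)} (h : M.Φ *ᵥ x = 0) : x = 0 := by
  have := Fintype.linearIndependent_iff.1 M.φ_columns (fun j => x j) (by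
    ext s
    have := congrFun h s
    simpa [Φ, mulVec, dotProduct, mul_comm] using this)
  ext j
  simpa using this j

/-- The quadratic form `‖Φ x‖²_Dir + (μᵀ Φ x)²` whose minimum over the unit sphere is `η`. -/
noncomputable def quad (μ : S → ℝ) (x : EuclideanSpace ℝ (Fin d)) : ℝ :=
  M.dirichletSq μ (M.Φ *ᵥ x) + (μ ⬝ᵥ M.Φ *ᵥ x) ^ 2

variable {M} {μ : S → ℝ}

lemma dirichletSq_nonneg (hμ : ∀ s, 0 ≤ μ s) (f : S → ℝ) : 0 ≤ M.dirichletSq μ f :=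
  mul_nonneg (by norm_num) <| Finset.sum_nonneg fun s _ => Finset.sum_nonneg fun s' _ =>
    mul_nonneg (mul_nonneg (hμ s) (M.P_nonneg s s')) (sq_nonneg _)

lemma quad_nonneg (hμ : ∀ s, 0 ≤ μ s) (x : EuclideanSpace ℝ (Fin d)) : 0 ≤ M.quad μ x :=
  add_nonneg (dirichletSq_nonneg hμ _) (sq_nonneg _)

lemma quad_smul (c : ℝ) (x : EuclideanSpace ℝ (Fin d)) : M.quad μ (c • x) = c ^ 2 * M.quad μ x := by
  have h : M.Φ *ᵥ (c • x).ofLp = c • (M.Φ *ᵥ x.ofLp) := by rw [← mulVec_smul]; rfl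
  simp only [quad, h, dirichletSq, dotProduct_smul, Pi.smul_apply, smul_eq_mul, mul_add, mul_pow,
    Finset.mul_sum]
  congr 1
  refine Finset.sum_congr rfl fun s _ => Finset.sum_congr rfl fun s' _ => ?_
  ring

lemma eta_le_quad (hμ : ∀ s, 0 ≤ μ s) {x : EuclideanSpace ℝ (Fin d)} (hx : ‖x‖ = 1) :
    M.eta μ ≤ M.quad μ x :=
  csInf_le ⟨0, by rintro _ ⟨y, -, rfl⟩; exact quad_nonneg hμ y⟩ ⟨x, by simpa using hx, rfl⟩

lemma eta_mul_sq_le_quad (hμ : ∀ s, 0 ≤ μ s) (x : EuclideanSpace ℝ (Fin d)) :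
    M.eta μ * ‖x‖ ^ 2 ≤ M.quad μ x := by
  rcases eq_or_ne x 0 with rfl | hx
  · simpa using quad_nonneg hμ _
  have hx' : 0 < ‖x‖ := norm_pos_iff.2 hx
  have h := eta_le_quad (M := M) hμ (x := ‖x‖⁻¹ • x) (by
    rw [norm_smul, norm_inv, norm_norm, inv_mul_cancel₀ hx'.ne'])
  rw [quad_smul, inv_pow, inv_mul_eq_div, le_div_iff₀ (by positivity)] at h
  exact h

/-- With m the μ-mean of f = Φ x, expand f(s) - f(s') around m. By stationarity the Dirichlet form
is at most twice the variance, so the whole form is at most 2 E f² - m². The bound η ≤ 2 that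
follows serves throughout to absorb powers of η into constants. -/
lemma quad_le [DecidableEq S] (hμ : IsStationaryDist M.P μ) (x : EuclideanSpace ℝ (Fin d)) :
    M.quad μ x ≤ 2 * ‖x‖ ^ 2 := by
  set f := M.Φ *ᵥ x with hf
  set m := μ ⬝ᵥ f with hm
  have hstat : ∀ q : S → ℝ, ∑ s, ∑ s', μ s * M.P s s' * q s' = ∑ s, μ s * q s := fun q => by
    rw [Finset.sum_comm]
    simp_rw [← Finset.sum_mul]
    exact Finset.sum_congr rfl fun s _ => by rw [← congrFun hμ.2 s]; rfl
  have hrow : ∀ q : S → ℝ, ∑ s, ∑ s', μ s * M.P s s' * q s = ∑ s, μ s * q s := fun q => by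
    refine Finset.sum_congr rfl fun s _ => ?_
    rw [← Finset.sum_mul, ← Finset.mul_sum, M.P_sum, mul_one]
  have h1 : M.dirichletSq μ f ≤ 2 * ∑ s, μ s * (f s - m) ^ 2 := by
    rw [dirichletSq]
    calc (1 / 2) * ∑ s, ∑ s', μ s * M.P s s' * (f s - f s') ^ 2
        ≤ (1 / 2) * ∑ s, ∑ s', (μ s * M.P s s' * (2 * (f s - m) ^ 2) +
            μ s * M.P s s' * (2 * (f s' - m) ^ 2)) := by
          refine mul_le_mul_of_nonneg_left (Finset.sum_le_sum fun s _ =>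
            Finset.sum_le_sum fun s' _ => ?_) (by norm_num)
          rw [← mul_add]
          refine mul_le_mul_of_nonneg_left ?_ (mul_nonneg (hμ.1.1 s) (M.P_nonneg s s'))
          nlinarith [sq_nonneg ((f s - m) + (f s' - m))]
      _ = 2 * ∑ s, μ s * (f s - m) ^ 2 := by
          simp_rw [Finset.sum_add_distrib]
          rw [hrow fun s => 2 * (f s - m) ^ 2, hstat fun s => 2 * (f s - m) ^ 2, ← Finset.sum_add_distrib]
          simp_rw [Finset.mul_sum]
          exact Finset.sum_congr rfl fun s _ => by ring
  have h2 : ∑ s, μ s * (f s - m) ^ 2 = ∑ s, μ s * f s ^ 2 - m ^ 2 := by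
    have : ∀ s, μ s * (f s - m) ^ 2 = μ s * f s ^ 2 - 2 * m * (μ s * f s) + m ^ 2 * μ s :=
      fun s => by ring
    simp_rw [this, Finset.sum_add_distrib, Finset.sum_sub_distrib, ← Finset.mul_sum, hμ.1.2]
    have : ∑ s, μ s * f s = m := rfl
    rw [this]; ring
  have h3 : ∑ s, μ s * f s ^ 2 ≤ ‖x‖ ^ 2 := by
    calc ∑ s, μ s * f s ^ 2 ≤ ∑ s, μ s * ‖x‖ ^ 2 := by
          refine Finset.sum_le_sum fun s _ => mul_le_mul_of_nonneg_left ?_ (hμ.1.1 s)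
          rw [hf, Φ_mulVec_apply, sq_le_sq, abs_norm]
          exact M.abs_inner_φ_le x s
      _ = ‖x‖ ^ 2 := by rw [← Finset.sum_mul, hμ.1.2, one_mul]
  have : M.quad μ x = M.dirichletSq μ f + m ^ 2 := rfl
  nlinarith [sq_nonneg m]

lemma eta_le_two [DecidableEq S] (hd : 0 < d) (hμ : IsStationaryDist M.P μ) : M.eta μ ≤ 2 := by
  have : Nonempty (Fin d) := ⟨⟨0, hd⟩⟩
  obtain ⟨x, hx⟩ := exists_norm_eq (EuclideanSpace ℝ (Fin d)) (zero_le_one (α := ℝ))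
  have := (eta_le_quad (M := M) hμ.1.1 hx).trans (quad_le hμ x)
  rwa [hx, one_pow, mul_one] at this

/-- Zero energy makes f constant along every transition of positive probability, hence P f = f and
P^τ f = f for all τ. Mixing sends P^τ f to the constant μᵀ f. -/
lemma eq_const_of_dirichletSq_eq_zero [DecidableEq S] {C β : ℝ} (hμ : ∀ s, 0 < μ s)
    (hmix : IsMixing M.P μ C β) {f : S → ℝ} (hf : M.dirichletSq μ f = 0) (s : S) :
    f s = μ ⬝ᵥ f := by
  have h0 : ∀ s s', M.P s s' * f s' = M.P s s' * f s := fun s s' => by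
    have hnn : ∀ s s', 0 ≤ μ s * M.P s s' * (f s - f s') ^ 2 := fun s s' =>
      mul_nonneg (mul_nonneg (hμ s).le (M.P_nonneg s s')) (sq_nonneg _)
    rw [dirichletSq, mul_eq_zero, or_iff_right (by norm_num),
      Finset.sum_eq_zero_iff_of_nonneg fun s _ => Finset.sum_nonneg fun s' _ => hnn s s'] at hf
    have := (Finset.sum_eq_zero_iff_of_nonneg fun s' _ => hnn s s').1
      (hf s (Finset.mem_univ s)) s' (Finset.mem_univ s')
    rcases mul_eq_zero.1 this with h | h
    · rw [(mul_eq_zero.1 h).resolve_left (hμ s).ne', zero_mul, zero_mul]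
    · rw [sub_eq_zero.1 (pow_eq_zero_iff two_ne_zero |>.1 h)]
  have h1 : M.P *ᵥ f = f := funext fun s => by
    simp only [mulVec, dotProduct, h0 s]
    rw [← Finset.sum_mul, M.P_sum, one_mul]
  have h2 : ∀ τ : ℕ, (M.P ^ τ) *ᵥ f = f := fun τ => by
    induction τ with
    | zero => simp
    | succ n ih => rw [pow_succ, ← mulVec_mulVec, h1, ih]
  have h3 : ∀ τ : ℕ, |f s - μ ⬝ᵥ f| ≤ C * β ^ τ * ∑ s', |f s'| := fun τ => by
    have : f s - μ ⬝ᵥ f = ∑ s', ((M.P ^ τ) s s' - μ s') * f s' := by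
      simp_rw [sub_mul, Finset.sum_sub_distrib]
      conv_lhs => rw [← h2 τ]
      congr 1
      rw [h2 τ]; rfl
    rw [this]
    refine (Finset.abs_sum_le_sum_abs _ _).trans ?_
    refine le_trans ?_ (mul_le_mul_of_nonneg_right (hmix.2.2.2 τ s)
      (Finset.sum_nonneg fun _ _ => abs_nonneg _))
    rw [Finset.sum_mul]
    refine Finset.sum_le_sum fun s' _ => ?_
    rw [abs_mul]
    exact mul_le_mul_of_nonneg_left (Finset.single_le_sum (f := fun s => |f s|)
      (fun _ _ => abs_nonneg _) (Finset.mem_univ s')) (abs_nonneg _)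
  have h4 : Filter.Tendsto (fun τ : ℕ => C * β ^ τ * ∑ s', |f s'|) Filter.atTop (nhds 0) := by
    simpa using ((tendsto_pow_atTop_nhds_zero_of_lt_one hmix.2.1 hmix.2.2.1).const_mul C).mul_const
      (∑ s', |f s'|)
  exact sub_eq_zero.1 (abs_nonpos_iff.1 (ge_of_tendsto' h4 h3))

/-- The Dirichlet form vanishes on constants only, and the square of the mean excludes nonzero
constants. The constant vector may therefore lie in the column space of Φ. -/
lemma quad_pos [DecidableEq S] {C β : ℝ} (hμ : ∀ s, 0 < μ s) (hmix : IsMixing M.P μ C β)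
    {x : EuclideanSpace ℝ (Fin d)} (hx : x ≠ 0) : 0 < M.quad μ x := by
  refine (quad_nonneg (fun s => (hμ s).le) x).lt_of_ne' fun h => hx ?_
  have h1 := dirichletSq_nonneg (M := M) (fun s => (hμ s).le) (M.Φ *ᵥ x)
  have h2 := sq_nonneg (μ ⬝ᵥ M.Φ *ᵥ x)
  rw [quad] at h
  have h3 : M.dirichletSq μ (M.Φ *ᵥ x) = 0 := by linarith
  have h4 : μ ⬝ᵥ M.Φ *ᵥ x = 0 := pow_eq_zero_iff two_ne_zero |>.1 (by linarith)
  exact M.Φ_mulVec_injective (funext fun s => by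
    rw [eq_const_of_dirichletSq_eq_zero hμ hmix h3 s, h4]; rfl)

lemma eta_pos [DecidableEq S] {C β : ℝ} (hd : 0 < d) (hμ : ∀ s, 0 < μ s)
    (hmix : IsMixing M.P μ C β) : 0 < M.eta μ := by
  have : Nonempty (Fin d) := ⟨⟨0, hd⟩⟩
  have hcont : Continuous (M.quad μ) := by
    unfold quad dirichletSq dotProduct
    simp only [Φ_mulVec_apply]
    fun_prop
  have hne : (Metric.sphere (0 : EuclideanSpace ℝ (Fin d)) 1).Nonempty :=
    NormedSpace.sphere_nonempty.2 zero_le_one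
  obtain ⟨x, hx, hxη⟩ := ((isCompact_sphere (0 : EuclideanSpace ℝ (Fin d)) 1).image hcont).sInf_mem
    (hne.image _)
  have : M.eta μ = M.quad μ x := hxη.symm
  rw [this]
  refine quad_pos hμ hmix ?_
  rintro rfl
  simp at hx

/-- The bilinear form of the matrix `Φᵀ D (I - Π P) Φ`. -/
noncomputable def bil (M : PolicyEvaluation S A d) (μ : S → ℝ)
    (x y : EuclideanSpace ℝ (Fin d)) : ℝ :=
  ∑ s, μ s * (M.Φ *ᵥ x) s * ((M.Φ *ᵥ y) s - (M.P *ᵥ (M.Φ *ᵥ y)) s) +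
    (μ ⬝ᵥ M.Φ *ᵥ x) * (μ ⬝ᵥ M.Φ *ᵥ y)

/-- The linear form of the vector `Φᵀ D Π R`. -/
noncomputable def lin (M : PolicyEvaluation S A d) (μ : S → ℝ) (x : EuclideanSpace ℝ (Fin d)) : ℝ :=
  ∑ s, μ s * (M.Φ *ᵥ x) s * M.R s - (μ ⬝ᵥ M.Φ *ᵥ x) * (μ ⬝ᵥ M.R)

/-- Expanding the square in the Dirichlet form, stationarity makes the two diagonal sums equal. What
remains is ⟨f, (I - P) f⟩ in L²(μ); reversibility plays no role. -/
lemma bil_self [DecidableEq S] (hμ : IsStationaryDist M.P μ) (x : EuclideanSpace ℝ (Fin d)) :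
    M.bil μ x x = M.quad μ x := by
  rw [bil, quad, ← sq]
  congr 1
  set f := M.Φ *ᵥ x
  have hstat : ∑ s, ∑ s', μ s * M.P s s' * f s' ^ 2 = ∑ s, μ s * f s ^ 2 := by
    rw [Finset.sum_comm]
    simp_rw [← Finset.sum_mul]
    exact Finset.sum_congr rfl fun s _ => by rw [← congrFun hμ.2 s]; rfl
  have hrow : ∑ s, ∑ s', μ s * M.P s s' * f s ^ 2 = ∑ s, μ s * f s ^ 2 := by
    refine Finset.sum_congr rfl fun s _ => ?_
    rw [← Finset.sum_mul, ← Finset.mul_sum, M.P_sum, mul_one]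
  have h1 : ∀ s s', μ s * M.P s s' * (f s - f s') ^ 2 = μ s * M.P s s' * f s ^ 2 +
      μ s * M.P s s' * f s' ^ 2 - 2 * (μ s * f s * (M.P s s' * f s')) := fun s s' => by ring
  rw [dirichletSq]
  simp_rw [h1, Finset.sum_sub_distrib, Finset.sum_add_distrib, hstat, hrow, ← Finset.mul_sum]
  have h2 : ∀ s, μ s * f s * (f s - (M.P *ᵥ f) s) = μ s * f s ^ 2 -
    μ s * f s * ∑ s', M.P s s' * f s' := fun s => by
      simp only [mulVec, dotProduct]; ring
  simp_rw [h2, Finset.sum_sub_distrib]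
  ring

variable (M) in
lemma dotProduct_transpose_diagonal_mulVec [DecidableEq S] (μ : S → ℝ) (x : Fin d → ℝ)
    (w : S → ℝ) :
    x ⬝ᵥ (M.Φ.transpose * Matrix.diagonal μ) *ᵥ w = ∑ s, μ s * (M.Φ *ᵥ x) s * w s := by
  rw [← mulVec_mulVec, mulVec_transpose, dotProduct_comm, ← dotProduct_mulVec, dotProduct]
  exact Finset.sum_congr rfl fun s _ => by rw [mulVec_diagonal]; ring

lemma proj_mulVec [DecidableEq S] (μ w : S → ℝ) : proj μ *ᵥ w = fun s => w s - μ ⬝ᵥ w := by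
  rw [proj, sub_mulVec, one_mulVec, vecMulVec_mulVec]
  ext s; simp

lemma dotProduct_mulVec_eq_bil [DecidableEq S] (hμ : IsStationaryDist M.P μ)
    (x θ : EuclideanSpace ℝ (Fin d)) : x.ofLp ⬝ᵥ
      (M.Φ.transpose * Matrix.diagonal μ * (1 - proj μ * M.P) * M.Φ).mulVec θ = M.bil μ x θ := by
  have hμP : ∀ w, μ ⬝ᵥ M.P *ᵥ w = μ ⬝ᵥ w := fun w => by rw [dotProduct_mulVec, hμ.2]
  rw [Matrix.mul_assoc, ← mulVec_mulVec, dotProduct_transpose_diagonal_mulVec, ← mulVec_mulVec,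
    sub_mulVec, one_mulVec, ← mulVec_mulVec, proj_mulVec, hμP, bil]
  have : (μ ⬝ᵥ M.Φ *ᵥ x.ofLp) = ∑ s, μ s * (M.Φ *ᵥ x.ofLp) s := rfl
  rw [this, Finset.sum_mul, ← Finset.sum_add_distrib]
  exact Finset.sum_congr rfl fun s _ => by simp only [Pi.sub_apply]; ring

lemma dotProduct_mulVec_eq_lin [DecidableEq S] (x : EuclideanSpace ℝ (Fin d)) :
    x.ofLp ⬝ᵥ (M.Φ.transpose * Matrix.diagonal μ * proj μ).mulVec M.R = M.lin μ x := by
  rw [← mulVec_mulVec, dotProduct_transpose_diagonal_mulVec, proj_mulVec, lin]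
  have : (μ ⬝ᵥ M.Φ *ᵥ x.ofLp) = ∑ s, μ s * (M.Φ *ᵥ x.ofLp) s := rfl
  rw [this, Finset.sum_mul, ← Finset.sum_sub_distrib]
  exact Finset.sum_congr rfl fun s _ => by ring

lemma IsFixedPoint.bil_eq_lin [DecidableEq S] (hμ : IsStationaryDist M.P μ)
    {θ : EuclideanSpace ℝ (Fin d)} (h : M.IsFixedPoint μ θ) (x : EuclideanSpace ℝ (Fin d)) :
    M.bil μ x θ = M.lin μ x := by
  rw [← dotProduct_mulVec_eq_bil hμ, ← dotProduct_mulVec_eq_lin, h]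

/-- The matrix is square and its quadratic form is positive definite, so its kernel is trivial and
it is invertible, although it need not be symmetric. -/
lemma existsUnique_isFixedPoint [DecidableEq S] {C β : ℝ} (hμ : IsStationaryDist M.P μ)
    (hpos : ∀ s, 0 < μ s) (hmix : IsMixing M.P μ C β) :
    ∃! θs : EuclideanSpace ℝ (Fin d), M.IsFixedPoint μ θs := by
  set B := M.Φ.transpose * Matrix.diagonal μ * (1 - proj μ * M.P) * M.Φ with hB
  have hker : ∀ x : Fin d → ℝ, B *ᵥ x = 0 → x = 0 := by
    intro x hx
    by_contra hne
    have h1 : M.quad μ (WithLp.toLp 2 x) = 0 := by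
      rw [← bil_self hμ, ← dotProduct_mulVec_eq_bil hμ]
      exact (congrArg (x ⬝ᵥ ·) hx).trans (dotProduct_zero x)
    exact (quad_pos hpos hmix (x := WithLp.toLp 2 x) (by simpa using hne)).ne' h1
  have hinj : Function.Injective B.mulVec := by
    intro x y hxy
    refine sub_eq_zero.1 (hker _ ?_)
    rw [mulVec_sub, sub_eq_zero]
    exact hxy
  have hsurj := mulVec_surjective_iff_isUnit.2 (mulVec_injective_iff_isUnit.1 hinj)
  obtain ⟨θ, hθ⟩ := hsurj ((M.Φ.transpose * Matrix.diagonal μ * proj μ).mulVec M.R)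
  refine ⟨WithLp.toLp 2 θ, hθ, fun y hy => ?_⟩
  ext j
  exact congrFun (hinj (hy.trans hθ.symm)) j

end PolicyEvaluation

/-! ### The Poisson equation, with bounds in terms of L₁. -/

section Poisson

open Matrix

/-- A solution `Z` of the Poisson equation `Z - Q Z = I - e νᵀ` of a mixing chain. -/
lemma exists_poisson {I : Type*} [Fintype I] [DecidableEq I] {Q : Matrix I I ℝ} {ν : I → ℝ}
    {b : ℕ → ℝ} (hb : Summable b) (hrow : ∀ i, ∑ j, Q i j = 1)
    (hQ : ∀ k i, ∑ j, |(Q ^ k) i j - ν j| ≤ b k) :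
    ∃ Z : Matrix I I ℝ, (∀ i, ∑ j, |Z i j| ≤ ∑' k, b k) ∧
      ∀ i j, Z i j - ∑ l, Q i l * Z l j = (1 : Matrix I I ℝ) i j - ν j := by
  have habs : ∀ i j, Summable fun k => |(Q ^ k) i j - ν j| := fun i j =>
    Summable.of_nonneg_of_le (fun _ => abs_nonneg _) (fun k =>
      (Finset.single_le_sum (f := fun j => |(Q ^ k) i j - ν j|) (fun _ _ => abs_nonneg _)
        (Finset.mem_univ j)).trans (hQ k i)) hb
  have hs : ∀ i j, Summable fun k => (Q ^ k) i j - ν j := fun i j => (habs i j).of_abs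
  have hle : ∀ i j, |∑' k, ((Q ^ k) i j - ν j)| ≤ ∑' k, |(Q ^ k) i j - ν j| := fun i j =>
    norm_tsum_le_tsum_norm (f := fun k => (Q ^ k) i j - ν j) (habs i j)
  -- The Neumann series of I - Q with the limit of `Q ^ k` subtracted.
  refine ⟨of fun i j => ∑' k, ((Q ^ k) i j - ν j), fun i => ?_, fun i j => ?_⟩
  · simp only [of_apply]
    calc ∑ j, |∑' k, ((Q ^ k) i j - ν j)| ≤ ∑ j, ∑' k, |(Q ^ k) i j - ν j| :=
          Finset.sum_le_sum fun j _ => hle i j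
      _ = ∑' k, ∑ j, |(Q ^ k) i j - ν j| := (Summable.tsum_finsetSum fun j _ => habs i j).symm
      _ ≤ ∑' k, b k := Summable.tsum_le_tsum (fun k => hQ k i) (summable_sum fun j _ => habs i j) hb
  · simp only [of_apply]
    -- Multiplication by `Q` shifts the series by one because the rows of `Q` sum to 1, so Z - Q Z
    -- is the term with k = 0.
    have h1 : ∑ l, Q i l * ∑' k, ((Q ^ k) l j - ν j) = ∑' k, ((Q ^ (k + 1)) i j - ν j) := by
      simp_rw [← tsum_mul_left]
      rw [← Summable.tsum_finsetSum fun l _ => (hs l j).mul_left _]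
      refine tsum_congr fun k => ?_
      simp_rw [mul_sub, Finset.sum_sub_distrib, ← Finset.sum_mul, hrow, one_mul]
      rw [pow_succ', mul_apply]
    rw [h1, (hs i j).tsum_eq_zero_add]
    simp

lemma one_le_L1 (C β : ℝ) : 1 ≤ L1 C β := le_max_left _ _

lemma log_add_one_le_L1_mul {C β : ℝ} (hβ0 : 0 < β) (hβ1 : β < 1) :
    Real.log C + 1 ≤ L1 C β * Real.log (1 / β) := by
  have h : 0 < Real.log (1 / β) := Real.log_pos (by rw [lt_div_iff₀ hβ0]; linarith)
  rw [← div_le_iff₀ h]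
  exact le_max_right _ _

/-- From log(1/β) ≤ 1/β - 1 and log C > 0 one gets 1 ≤ L₁ (1/β - 1), that is, β ≤ L₁ (1 - β). The
geometric tail thus costs no more than the time needed to absorb C. -/
lemma inv_one_sub_le_L1 {C β : ℝ} (hC : 1 < C) (hβ0 : 0 ≤ β) (hβ1 : β < 1) :
    (1 - β)⁻¹ ≤ 1 + L1 C β := by
  rcases hβ0.eq_or_lt with rfl | hβ0
  · have := one_le_L1 C 0
    norm_num; linarith
  have h : 0 < Real.log (1 / β) := Real.log_pos (by rw [lt_div_iff₀ hβ0]; linarith)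
  have h1 := log_add_one_le_L1_mul (C := C) hβ0 hβ1
  have h2 : Real.log (1 / β) ≤ 1 / β - 1 := Real.log_le_sub_one_of_pos (by positivity)
  have h3 := Real.log_pos hC
  have h4 : 1 ≤ L1 C β * (1 / β - 1) := by
    have := mul_le_mul_of_nonneg_left h2 (zero_le_one.trans (one_le_L1 C β))
    linarith
  have h5 : β ≤ L1 C β * (1 - β) := by
    have := mul_le_mul_of_nonneg_right h4 hβ0.le
    rwa [one_mul, mul_assoc, sub_mul, one_div, inv_mul_cancel₀ hβ0.ne', one_mul] at this
  rw [inv_le_iff_one_le_mul₀ (by linarith)]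
  linarith

/-- After at most `L₁ + 1` steps the mixing bound is at most `1`. -/
lemma exists_mul_pow_le_one {C β : ℝ} (hC : 1 < C) (hβ0 : 0 ≤ β) (hβ1 : β < 1) :
    ∃ n : ℕ, (n : ℝ) ≤ L1 C β + 1 ∧ C * β ^ n ≤ 1 := by
  rcases hβ0.eq_or_lt with rfl | hβ0
  -- The exponent 0 would not do, since `0 ^ 0 = 1` and `C > 1`.
  · exact ⟨1, by have := one_le_L1 C 0; norm_num; linarith, by norm_num⟩
  refine ⟨⌈L1 C β⌉₊, (Nat.ceil_lt_add_one (zero_le_one.trans (one_le_L1 C β))).le, ?_⟩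
  have h : 0 < Real.log (1 / β) := Real.log_pos (by rw [lt_div_iff₀ hβ0]; linarith)
  have h1 := log_add_one_le_L1_mul (C := C) hβ0 hβ1
  have h2 := mul_le_mul_of_nonneg_right (Nat.le_ceil (L1 C β)) h.le
  rw [one_div, Real.log_inv] at h1 h2
  have hC0 : 0 < C := by linarith
  rw [← Real.log_nonpos_iff (by positivity), Real.log_mul hC0.ne' (by positivity), Real.log_pow]
  linarith

/-- A summable majorant of `min 2 (2 C β ^ k)` whose sum is `O(L₁)`. -/
lemma exists_summable_majorant {C β : ℝ} (hC : 1 < C) (hβ0 : 0 ≤ β) (hβ1 : β < 1) :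
    ∃ b : ℕ → ℝ, Summable b ∧ ∑' k, b k ≤ 8 * L1 C β ∧
      ∀ k x, x ≤ 2 → x ≤ 2 * (C * β ^ k) → x ≤ b k := by
  obtain ⟨n, hn, hCn⟩ := exists_mul_pow_le_one hC hβ0 hβ1
  -- The trivial bound 2 is used until C β^n ≤ 1 and a pure geometric series afterwards, so C enters
  -- only through n ≤ L₁ + 1. The sum is at most 2 (L₁ + 1) + 2 (1 + L₁) ≤ 8 L₁.
  set b : ℕ → ℝ := fun k => if k < n then 2 else 2 * β ^ (k - n) with hb
  have hshift : ∀ k, b (k + n) = 2 * β ^ k := fun k => by simp [hb]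
  have hgeo := (summable_geometric_of_lt_one hβ0 hβ1).mul_left 2
  have hsum : Summable b := (summable_nat_add_iff n).1 (hgeo.congr fun k => (hshift k).symm)
  refine ⟨b, hsum, ?_, fun k x h2 hx => ?_⟩
  · rw [← hsum.sum_add_tsum_nat_add n]
    simp_rw [hshift]
    rw [tsum_mul_left, tsum_geometric_of_lt_one hβ0 hβ1]
    have h1 : ∑ k ∈ Finset.range n, b k = n * 2 := by
      rw [Finset.sum_congr rfl (g := fun _ => (2 : ℝ)) fun k hk => by
        simp [hb, Finset.mem_range.1 hk]]
      simp
    have := inv_one_sub_le_L1 hC hβ0 hβ1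
    have := one_le_L1 C β
    linarith
  · by_cases hk : k < n
    · simpa [hb, hk] using h2
    · simp only [hb, hk, if_false]
      refine hx.trans (mul_le_mul_of_nonneg_left ?_ (by norm_num))
      have : k = n + (k - n) := by omega
      conv_lhs => rw [this, pow_add, ← mul_assoc]
      exact mul_le_of_le_one_left (pow_nonneg hβ0 _) hCn

end Poisson

/-! ### The pair of chains and the stationary mean of the update. -/

section DoubleChain

open Matrix

variable {S : Type*} [Fintype S]

/-- The transition matrix of two independent chains. -/
def pairMatrix (P : Matrix S S ℝ) : Matrix (S × S) (S × S) ℝ :=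
  of fun i j => P i.1 j.1 * P i.2 j.2

/-- The product of a distribution with itself. -/
def pairDist (μ : S → ℝ) (i : S × S) : ℝ := μ i.1 * μ i.2

lemma pairMatrix_sum {P : Matrix S S ℝ} (hP : ∀ s, ∑ s', P s s' = 1) (i : S × S) :
    ∑ j, pairMatrix P i j = 1 := by
  simp [pairMatrix, Fintype.sum_prod_type, ← Finset.mul_sum, hP]

lemma pairMatrix_pow [DecidableEq S] (P : Matrix S S ℝ) (k : ℕ) :
    pairMatrix P ^ k = pairMatrix (P ^ k) := by
  induction k with
  | zero =>
    ext ⟨i, i'⟩ ⟨j, j'⟩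
    simp only [pow_zero, pairMatrix, of_apply, one_apply, Prod.mk.injEq]
    split_ifs <;> simp_all
  | succ k ih =>
    ext i j
    rw [pow_succ, ih]
    simp only [pow_succ, mul_apply, pairMatrix, of_apply, Fintype.sum_prod_type,
      Finset.sum_mul_sum]
    exact Finset.sum_congr rfl fun s _ => Finset.sum_congr rfl fun s' _ => by ring

/-- Replace one factor at a time. Consequently the pair of chains mixes at the same rate β, with 2C
in place of C. -/
lemma sum_abs_mul_sub_mul_le {p q μ : S → ℝ} (hp : p ∈ stdSimplex ℝ S) (hμ : μ ∈ stdSimplex ℝ S) :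
    ∑ x, ∑ y, |p x * q y - μ x * μ y| ≤ ∑ y, |q y - μ y| + ∑ x, |p x - μ x| :=
  calc ∑ x, ∑ y, |p x * q y - μ x * μ y|
      ≤ ∑ x, ∑ y, (p x * |q y - μ y| + |p x - μ x| * μ y) := by
        refine Finset.sum_le_sum fun x _ => Finset.sum_le_sum fun y _ => ?_
        have : p x * q y - μ x * μ y = p x * (q y - μ y) + (p x - μ x) * μ y := by ring
        rw [this]
        refine (abs_add_le _ _).trans_eq ?_
        rw [abs_mul, abs_mul, abs_of_nonneg (hp.1 x), abs_of_nonneg (hμ.1 y)]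
    _ = _ := by
        simp_rw [Finset.sum_add_distrib, ← Finset.mul_sum, ← Finset.sum_mul, hp.2, hμ.2]
        ring

lemma pairDist_mem_stdSimplex {μ : S → ℝ} (hμ : μ ∈ stdSimplex ℝ S) :
    pairDist μ ∈ stdSimplex ℝ (S × S) := by
  refine ⟨fun i => mul_nonneg (hμ.1 _) (hμ.1 _), ?_⟩
  simp [pairDist, Fintype.sum_prod_type, ← Finset.mul_sum, hμ.2]

lemma pairMatrix_mem_rowStochastic [DecidableEq S] {P : Matrix S S ℝ} (hP : P ∈ rowStochastic ℝ S) :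
    pairMatrix P ∈ rowStochastic ℝ (S × S) :=
  mem_rowStochastic_iff_sum.2 ⟨fun _ _ => mul_nonneg (hP.1 _ _) (hP.1 _ _),
    pairMatrix_sum (sum_row_of_mem_rowStochastic hP)⟩

/-- The Poisson equation of two independent chains. -/
lemma exists_poisson_pair [DecidableEq S] {P : Matrix S S ℝ} {μ : S → ℝ} {C β : ℝ}
    (hP : P ∈ rowStochastic ℝ S) (hμ : IsStationaryDist P μ) (hmix : IsMixing P μ C β) :
    ∃ Z : Matrix (S × S) (S × S) ℝ, (∀ i, ∑ j, |Z i j| ≤ 8 * L1 C β) ∧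
      ∀ i j, Z i j - ∑ l, pairMatrix P i l * Z l j =
        (1 : Matrix (S × S) (S × S) ℝ) i j - pairDist μ j := by
  obtain ⟨b, hb, hb8, hmaj⟩ := exists_summable_majorant hmix.1 hmix.2.1 hmix.2.2.1
  obtain ⟨Z, hZ, hZ'⟩ := exists_poisson (Q := pairMatrix P) (ν := pairDist μ) hb
    (pairMatrix_sum (sum_row_of_mem_rowStochastic hP)) (fun k i => by
      refine hmaj k _ (sum_abs_sub_le_two ?_ (pairDist_mem_stdSimplex hμ.1)) ?_
      · exact row_mem_stdSimplex (pow_mem (pairMatrix_mem_rowStochastic hP) k) i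
      · rw [pairMatrix_pow, Fintype.sum_prod_type]
        refine (sum_abs_mul_sub_mul_le (row_mem_stdSimplex (pow_mem hP k) i.1) hμ.1).trans ?_
        have := hmix.2.2.2 k i.1
        have := hmix.2.2.2 k i.2
        linarith)
  exact ⟨Z, fun i => (hZ i).trans hb8, hZ'⟩

namespace PolicyEvaluation

variable {A : Type*} [Fintype A] {d : ℕ} (M : PolicyEvaluation S A d)

/-- The update direction as a function of two consecutive states of the pair of chains. -/
noncomputable def field (i j : S × S) (θ : EuclideanSpace ℝ (Fin d)) : EuclideanSpace ℝ (Fin d) :=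
  M.f i.1 i.2 θ + M.g i.1 j.1 θ

lemma norm_smul_φ_le (c : ℝ) (s : S) : ‖c • M.φ s‖ ≤ |c| := by
  rw [norm_smul, Real.norm_eq_abs]
  exact mul_le_of_le_one_right (abs_nonneg _) (M.norm_φ_le s)

/-- Of the Lipschitz constant 3, one unit comes from `f` and two from the temporal difference in
`g`. -/
lemma norm_field_sub_le (i j : S × S) (θ θ' : EuclideanSpace ℝ (Fin d)) :
    ‖M.field i j θ - M.field i j θ'‖ ≤ 3 * ‖θ - θ'‖ := by
  have h : M.field i j θ - M.field i j θ' = (-(inner ℝ (M.φ i.1) (θ - θ'))) • M.φ i.2 +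
      (inner ℝ (M.φ j.1) (θ - θ') - inner ℝ (M.φ i.1) (θ - θ')) • M.φ i.1 := by
    simp only [field, f, g, inner_sub_right]
    module
  rw [h]
  refine (norm_add_le _ _).trans ((add_le_add (M.norm_smul_φ_le _ _) (M.norm_smul_φ_le _ _)).trans ?_)
  rw [abs_neg]
  have h1 := M.abs_inner_φ_le (θ - θ') i.1
  have h2 := M.abs_inner_φ_le (θ - θ') j.1
  have h3 := abs_sub (inner ℝ (M.φ j.1) (θ - θ')) (inner ℝ (M.φ i.1) (θ - θ'))
  linarith

lemma norm_field_le (i j : S × S) (θ : EuclideanSpace ℝ (Fin d)) :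
    ‖M.field i j θ‖ ≤ 2 * (M.rmax + 3 * ‖θ‖) := by
  rw [field, f, g]
  refine (norm_add_le _ _).trans ((add_le_add (M.norm_smul_φ_le _ _) (M.norm_smul_φ_le _ _)).trans ?_)
  rw [abs_neg]
  have h1 := M.abs_inner_φ_le θ i.1
  have h2 := M.abs_inner_φ_le θ j.1
  have h3 := M.abs_R_le_rmax i.1
  have h4 := abs_add_le (M.R i.1) (inner ℝ (M.φ i.1) θ)
  have h5 := abs_sub (M.R i.1 + inner ℝ (M.φ j.1) θ) (inner ℝ (M.φ i.1) θ)
  have h6 := abs_add_le (M.R i.1) (inner ℝ (M.φ j.1) θ)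
  linarith [norm_nonneg θ]

/-- The mean of the update direction in the stationary regime. -/
lemma inner_mean_field {μ : S → ℝ} (hμ : μ ∈ stdSimplex ℝ S) (x θ : EuclideanSpace ℝ (Fin d)) :
    inner ℝ x (∑ i, pairDist μ i • ∑ j, pairMatrix M.P i j • M.field i j θ) =
      M.lin μ x - M.bil μ x θ := by
  simp only [inner_sum, inner_smul_right, Fintype.sum_prod_type]
  have h1 : ∀ s ŝ s' ŝ', inner ℝ x (M.field (s, ŝ) (s', ŝ') θ) =
      (-(M.R s + (M.Φ *ᵥ θ) s) * (M.Φ *ᵥ x) ŝ + (M.R s - (M.Φ *ᵥ θ) s) * (M.Φ *ᵥ x) s) +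
        (M.Φ *ᵥ θ) s' * (M.Φ *ᵥ x) s := fun s ŝ s' ŝ' => by
    simp only [field, f, g, inner_add_right, inner_smul_right, Φ_mulVec_apply]
    rw [real_inner_comm x (M.φ s), real_inner_comm x (M.φ ŝ)]
    ring
  have h2 : ∀ s ŝ, ∑ s', ∑ ŝ', pairMatrix M.P (s, ŝ) (s', ŝ') *
      inner ℝ x (M.field (s, ŝ) (s', ŝ') θ) =
      (-(M.R s + (M.Φ *ᵥ θ) s) * (M.Φ *ᵥ x) ŝ + (M.R s - (M.Φ *ᵥ θ) s) * (M.Φ *ᵥ x) s) +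
        (M.P *ᵥ (M.Φ *ᵥ θ)) s * (M.Φ *ᵥ x) s := fun s ŝ => by
    simp only [h1, pairMatrix, of_apply]
    have : ∀ s' ŝ', M.P s s' * M.P ŝ ŝ' *
      ((-(M.R s + (M.Φ *ᵥ θ) s) * (M.Φ *ᵥ x) ŝ + (M.R s - (M.Φ *ᵥ θ) s) * (M.Φ *ᵥ x) s) +
        (M.Φ *ᵥ θ) s' * (M.Φ *ᵥ x) s) = (M.P s s' *
      (-(M.R s + (M.Φ *ᵥ θ) s) * (M.Φ *ᵥ x) ŝ + (M.R s - (M.Φ *ᵥ θ) s) * (M.Φ *ᵥ x) s) +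
        M.P s s' * (M.Φ *ᵥ θ) s' * (M.Φ *ᵥ x) s) * M.P ŝ ŝ' := fun s' ŝ' => by ring
    simp_rw [this, ← Finset.mul_sum, M.P_sum, mul_one, Finset.sum_add_distrib, ← Finset.sum_mul,
      M.P_sum, one_mul]
    rfl
  simp only [h2, pairDist]
  -- Under μ ⊗ μ the first term separates into a function of `s` times a function of `ŝ`. It
  -- averages to a product of two means, which is where the second chain is needed.
  have h3 : ∀ s ŝ, μ s * μ ŝ *
      ((-(M.R s + (M.Φ *ᵥ θ) s) * (M.Φ *ᵥ x) ŝ + (M.R s - (M.Φ *ᵥ θ) s) * (M.Φ *ᵥ x) s) +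
        (M.P *ᵥ (M.Φ *ᵥ θ)) s * (M.Φ *ᵥ x) s) =
      -(μ s * M.R s + μ s * (M.Φ *ᵥ θ) s) * (μ ŝ * (M.Φ *ᵥ x) ŝ) +
      (μ s * (M.Φ *ᵥ x) s * M.R s -
        μ s * (M.Φ *ᵥ x) s * ((M.Φ *ᵥ θ) s - (M.P *ᵥ (M.Φ *ᵥ θ)) s)) * μ ŝ := fun s ŝ => by ring
  simp_rw [h3, Finset.sum_add_distrib, ← Finset.mul_sum, hμ.2, mul_one, ← Finset.sum_mul,
    Finset.sum_sub_distrib, Finset.sum_neg_distrib, Finset.sum_add_distrib]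
  simp only [lin, bil, dotProduct]
  ring

lemma bil_add_right (μ : S → ℝ) (x y z : EuclideanSpace ℝ (Fin d)) :
    M.bil μ x (y + z) = M.bil μ x y + M.bil μ x z := by
  have h : M.Φ *ᵥ (y + z).ofLp = M.Φ *ᵥ y.ofLp + M.Φ *ᵥ z.ofLp := by rw [← mulVec_add]; rfl
  simp only [bil, h, mulVec_add, Pi.add_apply, dotProduct_add]
  have : ∀ s, μ s * (M.Φ *ᵥ x.ofLp) s * ((M.Φ *ᵥ y.ofLp) s + (M.Φ *ᵥ z.ofLp) s -
      ((M.P *ᵥ M.Φ *ᵥ y.ofLp) s + (M.P *ᵥ M.Φ *ᵥ z.ofLp) s)) =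
      μ s * (M.Φ *ᵥ x.ofLp) s * ((M.Φ *ᵥ y.ofLp) s - (M.P *ᵥ M.Φ *ᵥ y.ofLp) s) +
      μ s * (M.Φ *ᵥ x.ofLp) s * ((M.Φ *ᵥ z.ofLp) s - (M.P *ᵥ M.Φ *ᵥ z.ofLp) s) := fun s => by ring
  simp_rw [this, Finset.sum_add_distrib]
  ring

/-- The mean update direction points towards the fixed point. -/
lemma inner_mean_field_le [DecidableEq S] {μ : S → ℝ} (hμ : IsStationaryDist M.P μ)
    {θs : EuclideanSpace ℝ (Fin d)} (hθs : M.IsFixedPoint μ θs) (θ : EuclideanSpace ℝ (Fin d)) :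
    inner ℝ (θ - θs) (∑ i, pairDist μ i • ∑ j, pairMatrix M.P i j • M.field i j θ) ≤
      -(M.eta μ * ‖θ - θs‖ ^ 2) := by
  -- Splitting θ = θ* + (θ - θ*) lets the fixed point equation cancel the linear form, and minus the
  -- quadratic form at θ - θ* is left.
  have h : M.bil μ (θ - θs) θ = M.bil μ (θ - θs) θs + M.bil μ (θ - θs) (θ - θs) := by
    rw [← bil_add_right, add_sub_cancel]
  rw [inner_mean_field M hμ.1, h, hθs.bil_eq_lin hμ, bil_self hμ]
  linarith [eta_mul_sq_le_quad (M := M) hμ.1.1 (θ - θs)]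

end PolicyEvaluation

end DoubleChain

/-! ### The Markov property in expectation, by summation over finite histories. -/

section FiniteIndex

variable {Ω : Type*} [MeasurableSpace Ω] {E : Type*} [MeasurableSpace E] {I : Type*} [Finite I]
  [MeasurableSpace I] [MeasurableSingletonClass I]

lemma measurable_finite_index {γ : Type*} [MeasurableSpace γ] {ψ : I → E → γ}
    (hψ : ∀ i, Measurable (ψ i)) {X : Ω → I} (hX : Measurable X) {Y : Ω → E} (hY : Measurable Y) :
    Measurable fun ω => ψ (X ω) (Y ω) :=
  (measurable_from_prod_countable_left (f := fun p : E × I => ψ p.2 p.1) hψ).comp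
    (hY.prodMk hX)

/-- The expectation of a function of a random vector and of an independent random variable with
finitely many values. -/
lemma integral_finite_index_of_indepFun {I : Type*} [Fintype I] [MeasurableSpace I]
    [MeasurableSingletonClass I] {Pr : Measure Ω}
    [IsProbabilityMeasure Pr] {ψ : I → E → ℝ} (hψ : ∀ i, Measurable (ψ i)) {X : Ω → I}
    (hX : Measurable X) {Y : Ω → E} (hY : Measurable Y) (hind : IndepFun Y X Pr)
    (hint : Integrable (fun ω => ψ (X ω) (Y ω)) Pr) :
    ∫ ω, ψ (X ω) (Y ω) ∂Pr = ∑ q, (∫ ω, ψ q (Y ω) ∂Pr) * Pr.real (X ⁻¹' {q}) := by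
  classical
  -- Decompose along the values of `X`, so that every summand is a function of `Y` times an
  -- indicator of `X` and independence applies.
  have h1 : ∀ ω, ψ (X ω) (Y ω) = ∑ q, ψ q (Y ω) * ({q} : Set I).indicator 1 (X ω) := fun ω => by
    simp [Set.indicator_apply]
  have h2 : ∀ q, Integrable (fun ω => ψ q (Y ω) * ({q} : Set I).indicator 1 (X ω)) Pr := fun q => by
    have := hint.indicator (hX (measurableSet_singleton q))
    refine this.congr (Filter.Eventually.of_forall fun ω => ?_)
    by_cases h : X ω = q
    · simp [h]
    · simp [h]
  simp_rw [h1]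
  rw [integral_finsetSum _ fun q _ => h2 q]
  refine Finset.sum_congr rfl fun q _ => ?_
  rw [hind.integral_fun_comp_mul_comp (f := ψ q) (g := ({q} : Set I).indicator 1)
    hY.aemeasurable hX.aemeasurable (hψ q).aestronglyMeasurable
    (measurable_one.indicator (measurableSet_singleton q)).aestronglyMeasurable]
  congr 1
  rw [← integral_indicator_one (hX (measurableSet_singleton q))]
  rfl

end FiniteIndex

section History

variable {S : Type*} {Ω : Type*}

/-- The sequence that follows the history `p` up to the time `t` and is then equal to `y`. -/
def extendHistory {t : ℕ} (p : Fin (t + 1) → S) (y : S) (i : ℕ) : S :=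
  if h : i < t + 1 then p ⟨i, h⟩ else y

lemma extendHistory_of_le {t : ℕ} (p : Fin (t + 1) → S) (y : S) {i : ℕ} (h : i ≤ t) :
    extendHistory p y i = p ⟨i, Nat.lt_succ_of_le h⟩ := by
  rw [extendHistory, dif_pos]

lemma extendHistory_succ {t : ℕ} (p : Fin (t + 1) → S) (y : S) :
    extendHistory p y (t + 1) = y := by
  rw [extendHistory, dif_neg (lt_irrefl _)]

/-- The definition of the chain speaks of infinite sequences; functions on `Fin (t + 1)` form a
finite type, over which expectations can be summed. -/
lemma IsMarkovChain.measure_history_succ [MeasurableSpace S] [MeasurableSpace Ω] {P : Matrix S S ℝ} {Pr : Measure Ω} {s : ℕ → Ω → S}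
    (h : IsMarkovChain P Pr s) {t : ℕ} (p : Fin (t + 1) → S) (y : S) :
    Pr ((fun ω => ((fun i : Fin (t + 1) => s i ω), s (t + 1) ω)) ⁻¹' {(p, y)}) =
      Pr ((fun ω => fun i : Fin (t + 1) => s i ω) ⁻¹' {p}) *
        ENNReal.ofReal (P (p (Fin.last t)) y) := by
  have h1 : (fun ω => ((fun i : Fin (t + 1) => s i ω), s (t + 1) ω)) ⁻¹' {(p, y)} =
      {ω | ∀ i ≤ t + 1, s i ω = extendHistory p y i} := by
    ext ω
    simp only [Set.mem_preimage, Set.mem_singleton_iff, Prod.mk.injEq, Set.mem_ofPred_eq]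
    constructor
    · rintro ⟨h1, h2⟩ i hi
      rcases Nat.lt_or_ge i (t + 1) with h | h
      · rw [extendHistory_of_le p y (Nat.lt_succ_iff.1 h), ← h1]
      · obtain rfl : i = t + 1 := le_antisymm hi h
        rw [extendHistory_succ, h2]
    · intro h
      refine ⟨funext fun i => ?_, ?_⟩
      · rw [h i i.2.le, extendHistory_of_le p y (Nat.lt_succ_iff.1 i.2)]
      · rw [h _ le_rfl, extendHistory_succ]
  have h2 : (fun ω => fun i : Fin (t + 1) => s i ω) ⁻¹' {p} =
      {ω | ∀ i ≤ t, s i ω = extendHistory p y i} := by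
    ext ω
    simp only [Set.mem_preimage, Set.mem_singleton_iff, Set.mem_ofPred_eq]
    constructor
    · intro h1 i hi
      rw [extendHistory_of_le p y hi, ← h1]
    · intro h
      refine funext fun i => ?_
      rw [h i (Nat.lt_succ_iff.1 i.2), extendHistory_of_le p y (Nat.lt_succ_iff.1 i.2)]
  rw [h1, h2, h.2 t, extendHistory_succ, extendHistory_of_le p y le_rfl]
  rfl

end History

namespace PolicyEvaluation

variable {S : Type*} {A : Type*} [Fintype S] [Fintype A] {d : ℕ} (M : PolicyEvaluation S A d)
  {Ω : Type*} {α : ℕ → ℝ} {s sHat : ℕ → Ω → S} {θ₀ : Ω → EuclideanSpace ℝ (Fin d)}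

lemma iterate_succ (t : ℕ) (ω : Ω) :
    M.iterate α s sHat θ₀ (t + 1) ω = M.iterate α s sHat θ₀ t ω +
      α t • M.field (s t ω, sHat t ω) (s (t + 1) ω, sHat (t + 1) ω) (M.iterate α s sHat θ₀ t ω) :=
  rfl

/-- The iterate at time `t` is determined by the initial parameter and the states up to `t`. -/
lemma iterate_eq_of_history {x y : ℕ → S} {t : ℕ} {ω : Ω} (hx : ∀ i ≤ t, s i ω = x i)
    (hy : ∀ i ≤ t, sHat i ω = y i) :
    M.iterate α s sHat θ₀ t ω = M.iterate α (fun i _ => x i) (fun i _ => y i) id t (θ₀ ω) := by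
  induction t with
  | zero => rfl
  | succ t ih =>
    rw [iterate_succ, iterate_succ, ih (fun i hi => hx i (hi.trans t.le_succ))
      (fun i hi => hy i (hi.trans t.le_succ)), hx t t.le_succ, hy t t.le_succ, hx _ le_rfl,
      hy _ le_rfl]

lemma continuous_field (i j : S × S) : Continuous (M.field i j) := by
  unfold field f g
  fun_prop

lemma abs_sum_pairMatrix_mul_le (i : S × S) {w : S × S → ℝ} {c : ℝ} (hw : ∀ j, |w j| ≤ c) :
    |∑ j, pairMatrix M.P i j * w j| ≤ c :=
  calc |∑ j, pairMatrix M.P i j * w j| ≤ ∑ j, pairMatrix M.P i j * c := by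
        refine (Finset.abs_sum_le_sum_abs _ _).trans (Finset.sum_le_sum fun j _ => ?_)
        have h0 : 0 ≤ pairMatrix M.P i j := mul_nonneg (M.P_nonneg _ _) (M.P_nonneg _ _)
        rw [abs_mul, abs_of_nonneg h0]
        exact mul_le_mul_of_nonneg_left (hw j) h0
    _ = c := by rw [← Finset.sum_mul, pairMatrix_sum M.P_sum, one_mul]

variable [MeasurableSpace S] [DiscreteMeasurableSpace S] [MeasurableSpace Ω]

lemma measurable_iterate (hs : ∀ t, Measurable (s t)) (hsHat : ∀ t, Measurable (sHat t))
    (hθ₀ : Measurable θ₀) (t : ℕ) : Measurable (M.iterate α s sHat θ₀ t) := by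
  induction t with
  | zero => exact hθ₀
  | succ t ih =>
    refine ih.add (Measurable.const_smul ?_ (α t))
    exact measurable_finite_index (I := (S × S) × (S × S)) (ψ := fun p θ => M.field p.1 p.2 θ)
      (fun p => (M.continuous_field p.1 p.2).measurable)
      (((hs t).prodMk (hsHat t)).prodMk ((hs (t + 1)).prodMk (hsHat (t + 1)))) ih

lemma memLp_iterate {Pr : Measure Ω} [IsProbabilityMeasure Pr] (hs : ∀ t, Measurable (s t))
    (hsHat : ∀ t, Measurable (sHat t)) (hθ₀ : Measurable θ₀) (hθ₀' : MemLp θ₀ 2 Pr) (t : ℕ) :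
    MemLp (M.iterate α s sHat θ₀ t) 2 Pr := by
  induction t with
  | zero => exact hθ₀'
  | succ t ih =>
    have h1 : MemLp (fun ω => |α t| * (2 * (M.rmax + 3 * ‖M.iterate α s sHat θ₀ t ω‖))) 2 Pr :=
      (((memLp_const M.rmax).add (ih.norm.const_mul 3)).const_mul 2).const_mul |α t|
    have h2 : M.iterate α s sHat θ₀ (t + 1) = M.iterate α s sHat θ₀ t +
        (M.iterate α s sHat θ₀ (t + 1) - M.iterate α s sHat θ₀ t) := by
      rw [add_sub_cancel]
    have h3 : MemLp (M.iterate α s sHat θ₀ (t + 1) - M.iterate α s sHat θ₀ t) 2 Pr := by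
      refine h1.mono' ((M.measurable_iterate hs hsHat hθ₀ _).sub
        (M.measurable_iterate hs hsHat hθ₀ _)).aestronglyMeasurable
        (Filter.Eventually.of_forall fun ω => ?_)
      rw [Pi.sub_apply, iterate_succ, add_sub_cancel_left, norm_smul, Real.norm_eq_abs]
      exact mul_le_mul_of_nonneg_left (M.norm_field_le _ _ _) (abs_nonneg _)
    rw [h2]
    exact ih.add h3

/-- Functions of at most quadratic growth of a square integrable vector are integrable. -/
lemma integrable_of_quadratic_growth {I : Type*} [Finite I] [MeasurableSpace I]
    [MeasurableSingletonClass I] {Pr : Measure Ω} [IsProbabilityMeasure Pr]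
    {ψ : I → EuclideanSpace ℝ (Fin d) → ℝ} (hψ : ∀ i, Measurable (ψ i)) {c : ℝ}
    (hc : ∀ i θ, |ψ i θ| ≤ c * (1 + ‖θ‖ ^ 2)) {X : Ω → I} (hX : Measurable X)
    {Y : Ω → EuclideanSpace ℝ (Fin d)} (hY : Measurable Y) (hY' : MemLp Y 2 Pr) :
    Integrable (fun ω => ψ (X ω) (Y ω)) Pr :=
  Integrable.mono' (((integrable_const 1).add (hY'.integrable_norm_pow two_ne_zero)).const_mul c)
    (measurable_finite_index hψ hX hY).aestronglyMeasurable
    (Filter.Eventually.of_forall fun _ => hc _ _)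

lemma integrable_sum_pairMatrix_mul {Pr : Measure Ω} [IsProbabilityMeasure Pr]
    {ψ : S × S → S × S → EuclideanSpace ℝ (Fin d) → ℝ}
    (hψ : ∀ i j, Measurable (ψ i j)) {c : ℝ} (hc : ∀ i j θ, |ψ i j θ| ≤ c * (1 + ‖θ‖ ^ 2))
    {X : Ω → S × S} (hX : Measurable X) {Y : Ω → EuclideanSpace ℝ (Fin d)} (hY : Measurable Y)
    (hY' : MemLp Y 2 Pr) :
    Integrable (fun ω => ∑ j, pairMatrix M.P (X ω) j * ψ (X ω) j (Y ω)) Pr :=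
  integrable_of_quadratic_growth (I := S × S) (c := c)
    (ψ := fun i θ => ∑ j, pairMatrix M.P i j * ψ i j θ)
    (fun i => Finset.measurable_sum _ fun j _ => (hψ i j).const_mul _)
    (fun i θ => M.abs_sum_pairMatrix_mul_le i fun j => hc i j θ) hX hY hY'

/-- The Markov property of the pair of chains, in the form of an identity for functions of two
consecutive states and of the current iterate. -/
lemma integral_markov_step {Pr : Measure Ω} [IsProbabilityMeasure Pr]
    (h : IsDoubleChain M.P Pr s sHat θ₀) {ψ : S × S → S × S → EuclideanSpace ℝ (Fin d) → ℝ}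
    (hψ : ∀ i j, Measurable (ψ i j)) {c : ℝ} (hc : ∀ i j θ, |ψ i j θ| ≤ c * (1 + ‖θ‖ ^ 2)) (t : ℕ) :
    ∫ ω, ψ (s t ω, sHat t ω) (s (t + 1) ω, sHat (t + 1) ω) (M.iterate α s sHat θ₀ t ω) ∂Pr =
      ∫ ω, ∑ j, pairMatrix M.P (s t ω, sHat t ω) j *
        ψ (s t ω, sHat t ω) j (M.iterate α s sHat θ₀ t ω) ∂Pr := by
  classical
  have hs := h.chain.1
  have hsHat := h.chainHat.1
  -- `K` records both histories up to time t + 1. It has finitely many values and is independent of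
  -- `θ₀`, so conditioning becomes a finite sum.
  set K : Ω → ((Fin (t + 1) → S) × S) × ((Fin (t + 1) → S) × S) := fun ω =>
    (((fun i => s i ω), s (t + 1) ω), ((fun i => sHat i ω), sHat (t + 1) ω)) with hK
  have hKs : Measurable fun ω => ((fun i : Fin (t + 1) => s i ω), s (t + 1) ω) :=
    (measurable_pi_lambda _ fun i : Fin (t + 1) => hs i).prodMk (hs _)
  have hKsHat : Measurable fun ω => ((fun i : Fin (t + 1) => sHat i ω), sHat (t + 1) ω) :=
    (measurable_pi_lambda _ fun i : Fin (t + 1) => hsHat i).prodMk (hsHat _)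
  have hKm : Measurable K := hKs.prodMk hKsHat
  have hpre : Measurable fun x : ℕ → S => ((fun i : Fin (t + 1) => x i), x (t + 1)) := by fun_prop
  have hind : IndepFun θ₀ K Pr := h.indep_init.comp measurable_id
    (hpre.prodMap hpre)
  have hind2 : IndepFun (fun ω => ((fun i : Fin (t + 1) => s i ω), s (t + 1) ω))
      (fun ω => ((fun i : Fin (t + 1) => sHat i ω), sHat (t + 1) ω)) Pr := h.indep.comp hpre hpre
  -- the iterate at time `t` as a function of the history and the initial parameter
  set Θ : (Fin (t + 1) → S) → (Fin (t + 1) → S) → EuclideanSpace ℝ (Fin d) →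
      EuclideanSpace ℝ (Fin d) := fun p q θ => M.iterate α (fun i _ => extendHistory p (p 0) i)
    (fun i _ => extendHistory q (q 0) i) id t θ with hΘ
  have hΘm : ∀ p q, Measurable (Θ p q) := fun p q =>
    M.measurable_iterate (fun _ => measurable_const) (fun _ => measurable_const) measurable_id t
  have hΘeq : ∀ ω, M.iterate α s sHat θ₀ t ω = Θ (K ω).1.1 (K ω).2.1 (θ₀ ω) := fun ω =>
    M.iterate_eq_of_history (fun i hi => by rw [extendHistory_of_le _ _ hi])
      (fun i hi => by rw [extendHistory_of_le _ _ hi])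
  -- With the history frozen, `Θ` is again an iterate of the method, driven by deterministic
  -- sequences, so the square integrability already proved applies.
  have hΘLp : ∀ p q, MemLp (fun ω => Θ p q (θ₀ ω)) 2 Pr := fun p q => by
    have h1 : ∀ ω, M.iterate α (fun i _ => extendHistory p (p 0) i)
      (fun i _ => extendHistory q (q 0) i) θ₀ t ω = Θ p q (θ₀ ω) := fun ω =>
        M.iterate_eq_of_history (fun _ _ => rfl) (fun _ _ => rfl)
    have h2 := M.memLp_iterate (α := α) (s := fun i _ => extendHistory p (p 0) i)
      (sHat := fun i _ => extendHistory q (q 0) i) (Pr := Pr) (fun _ => measurable_const)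
      (fun _ => measurable_const) h.measurable_init h.memLp_init t
    exact h2.congr_norm ((hΘm p q).comp h.measurable_init).aestronglyMeasurable
      (Filter.Eventually.of_forall fun ω => by rw [h1])
  have hψint : ∀ p q i j, Integrable (fun ω => ψ i j (Θ p q (θ₀ ω))) Pr := fun p q i j =>
    integrable_of_quadratic_growth (I := Unit) (ψ := fun _ => ψ i j) (fun _ => hψ i j)
      (fun _ => hc i j) (X := fun _ => ()) measurable_const ((hΘm p q).comp h.measurable_init) (hΘLp p q)
  set l : ((Fin (t + 1) → S) × S) × ((Fin (t + 1) → S) × S) → S × S := fun k => (k.1.1 (Fin.last t), k.2.1 (Fin.last t)) with hl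
  set n : ((Fin (t + 1) → S) × S) × ((Fin (t + 1) → S) × S) → S × S := fun k => (k.1.2, k.2.2) with hn
  have hYm : ∀ t, Measurable fun ω => (s t ω, sHat t ω) := fun t => (hs t).prodMk (hsHat t)
  have hiter := M.measurable_iterate (α := α) hs hsHat h.measurable_init t
  have hiterLp := M.memLp_iterate (α := α) hs hsHat h.measurable_init h.memLp_init t
  -- the law of the history
  have hlaw : ∀ p y q z, Pr.real (K ⁻¹' {((p, y), (q, z))}) =
      (Pr.real ((fun ω => fun i : Fin (t + 1) => s i ω) ⁻¹' {p}) *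
        Pr.real ((fun ω => fun i : Fin (t + 1) => sHat i ω) ⁻¹' {q})) *
        pairMatrix M.P (p (Fin.last t), q (Fin.last t)) (y, z) := fun p y q z => by
    have h1 : K ⁻¹' {((p, y), (q, z))} =
        (fun ω => ((fun i : Fin (t + 1) => s i ω), s (t + 1) ω)) ⁻¹' {(p, y)} ∩
        (fun ω => ((fun i : Fin (t + 1) => sHat i ω), sHat (t + 1) ω)) ⁻¹' {(q, z)} := by
      ext ω
      simp only [hK, Set.mem_preimage, Set.mem_singleton_iff, Set.mem_inter_iff, Prod.ext_iff]
    rw [h1, measureReal_def, hind2.measure_inter_preimage_eq_mul _ _ (measurableSet_singleton _)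
      (measurableSet_singleton _), h.chain.measure_history_succ, h.chainHat.measure_history_succ]
    simp only [ENNReal.toReal_mul, ENNReal.toReal_ofReal (M.P_nonneg _ _), measureReal_def,
      pairMatrix, Matrix.of_apply]
    ring
  have hL : ∫ ω, ψ (s t ω, sHat t ω) (s (t + 1) ω, sHat (t + 1) ω)
      (M.iterate α s sHat θ₀ t ω) ∂Pr =
      ∑ k, (∫ ω, ψ (l k) (n k) (Θ k.1.1 k.2.1 (θ₀ ω)) ∂Pr) * Pr.real (K ⁻¹' {k}) := by
    have hint := integrable_of_quadratic_growth (I := (S × S) × (S × S)) (Pr := Pr)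
      (ψ := fun p => ψ p.1 p.2) (fun p => hψ p.1 p.2) (fun p => hc p.1 p.2)
      ((hYm t).prodMk (hYm (t + 1))) hiter hiterLp
    simp_rw [hΘeq] at hint ⊢
    exact integral_finite_index_of_indepFun
      (ψ := fun k θ => ψ (l k) (n k) (Θ k.1.1 k.2.1 θ))
      (fun k => (hψ _ _).comp (hΘm _ _)) hKm h.measurable_init hind hint
  have hR : ∫ ω, ∑ j, pairMatrix M.P (s t ω, sHat t ω) j *
        ψ (s t ω, sHat t ω) j (M.iterate α s sHat θ₀ t ω) ∂Pr =
      ∑ k, (∫ ω, ∑ j, pairMatrix M.P (l k) j * ψ (l k) j (Θ k.1.1 k.2.1 (θ₀ ω)) ∂Pr) *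
        Pr.real (K ⁻¹' {k}) := by
    have hint := M.integrable_sum_pairMatrix_mul hψ hc (hYm t) hiter hiterLp
    simp_rw [hΘeq] at hint ⊢
    exact integral_finite_index_of_indepFun
      (ψ := fun k θ => ∑ j, pairMatrix M.P (l k) j * ψ (l k) j (Θ k.1.1 k.2.1 θ))
      (fun k => Finset.measurable_sum _ fun j _ => ((hψ _ _).comp (hΘm _ _)).const_mul _)
      hKm h.measurable_init hind hint
  have hRint : ∀ k, ∫ ω, ∑ j, pairMatrix M.P (l k) j * ψ (l k) j (Θ k.1.1 k.2.1 (θ₀ ω)) ∂Pr =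
      ∑ j, pairMatrix M.P (l k) j * ∫ ω, ψ (l k) j (Θ k.1.1 k.2.1 (θ₀ ω)) ∂Pr := fun k => by
    rw [integral_finsetSum _ fun j _ => (hψint _ _ _ _).const_mul _]
    simp_rw [integral_const_mul]
  rw [hL, hR]
  simp_rw [hRint, Fintype.sum_prod_type, hlaw, hl, hn]
  refine Finset.sum_congr rfl fun p _ => ?_
  -- The sum over `K` runs in the order p, y, q, z. On both sides y and q are exchanged, so that for
  -- fixed histories p, q the next states y, z are summed against the transition probabilities.
  refine (Finset.sum_comm.trans (Finset.sum_congr rfl fun q _ => ?_)).trans Finset.sum_comm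
  have hsum : ∑ y, ∑ z, pairMatrix M.P (p (Fin.last t), q (Fin.last t)) (y, z) = 1 := by
    rw [← Fintype.sum_prod_type', pairMatrix_sum M.P_sum]
  simp_rw [← Finset.mul_sum, hsum, mul_one]
  rw [Finset.sum_mul]
  refine Finset.sum_congr rfl fun y _ => ?_
  rw [Finset.sum_mul]
  exact Finset.sum_congr rfl fun z _ => by ring

end PolicyEvaluation

/-! ### The corrected Lyapunov function and its drift. -/

/-- One step of a stochastic approximation, for the Lyapunov function corrected by the solution of
the Poisson equation. -/
lemma lyapunov_step {E : Type*} [NormedAddCommGroup E] [InnerProductSpace ℝ E] {x f v v' : E}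
    {a a' Λ q : ℝ} (ha' : 0 ≤ a') (haa' : a' ≤ a) (ha : 3 * a ≤ 1) (hΛ : 1 ≤ Λ)
    (hx : 3 * ‖x‖ ≤ q) (hf : ‖f‖ ≤ q) (hv : ‖v‖ ≤ Λ * q) (hv' : ‖v' - v‖ ≤ 3 * Λ * (a * q)) :
    ‖x + a • f‖ ^ 2 + 2 * a' * inner ℝ (x + a • f) v' ≤
      ‖x‖ ^ 2 + 2 * a * inner ℝ x (f + v) + (7 * a ^ 2 * Λ + (a - a') * Λ) * q ^ 2 := by
  have hq : 0 ≤ q := (norm_nonneg f).trans hf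
  have ha0 : 0 ≤ a := ha'.trans haa'
  have hΛ0 : 0 ≤ Λ := zero_le_one.trans hΛ
  have e1 : ‖x + a • f‖ ^ 2 = ‖x‖ ^ 2 + 2 * a * inner ℝ x f + a ^ 2 * ‖f‖ ^ 2 := by
    rw [norm_add_sq_real, inner_smul_right, norm_smul, mul_pow, Real.norm_eq_abs, sq_abs]
    ring
  -- Here `v` and `v'` stand for the corrector at the new state, taken at the old and at the new
  -- iterate. The main term 2a⟨x, v⟩ is kept for the Poisson equation. The others come from the
  -- change of stepsize, of the corrector and of the iterate, and their coefficients with that of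
  -- ‖f‖² add up to 1 + 2 + 4 = 7 and to (a - a').
  have e2 : 2 * a' * inner ℝ (x + a • f) v' = 2 * a * inner ℝ x v - 2 * (a - a') * inner ℝ x v +
      2 * a' * inner ℝ x (v' - v) + 2 * a' * a * inner ℝ f v' := by
    rw [inner_add_left, inner_smul_left, inner_sub_right]
    simp only [conj_trivial]
    ring
  have b1 : a ^ 2 * ‖f‖ ^ 2 ≤ a ^ 2 * Λ * q ^ 2 := by
    have h1 : ‖f‖ ^ 2 ≤ q ^ 2 := pow_le_pow_left₀ (norm_nonneg _) hf 2
    have h2 : q ^ 2 ≤ Λ * q ^ 2 := le_mul_of_one_le_left (sq_nonneg q) hΛ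
    rw [mul_assoc]
    exact mul_le_mul_of_nonneg_left (h1.trans h2) (sq_nonneg a)
  have hxv : |inner ℝ x v| ≤ (q / 3) * (Λ * q) := (abs_real_inner_le_norm x v).trans
    (mul_le_mul (by linarith) hv (norm_nonneg _) (by linarith))
  have b2 : -(2 * (a - a') * inner ℝ x v) ≤ (a - a') * Λ * q ^ 2 := by
    have h1 : -inner ℝ x v ≤ (q / 3) * (Λ * q) := (neg_le_abs _).trans hxv
    have h2 : 0 ≤ (a - a') * Λ * q ^ 2 :=
      mul_nonneg (mul_nonneg (by linarith) hΛ0) (sq_nonneg q)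
    have h3 := mul_le_mul_of_nonneg_left h1 (sub_nonneg.2 haa')
    have h4 : (a - a') * (q / 3 * (Λ * q)) = (a - a') * Λ * q ^ 2 / 3 := by ring
    linarith
  have b3 : 2 * a' * inner ℝ x (v' - v) ≤ 2 * a ^ 2 * Λ * q ^ 2 := by
    have h1 : inner ℝ x (v' - v) ≤ (q / 3) * (3 * Λ * (a * q)) := (real_inner_le_norm _ _).trans
      (mul_le_mul (by linarith) hv' (norm_nonneg _) (by linarith))
    have h2 : 0 ≤ (q / 3) * (3 * Λ * (a * q)) := by positivity
    have h3 := mul_le_mul_of_nonneg_left h1 ha'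
    have h4 := mul_le_mul_of_nonneg_right haa' h2
    have h5 : a * (q / 3 * (3 * Λ * (a * q))) = a ^ 2 * Λ * q ^ 2 := by ring
    linarith
  have b4 : 2 * a' * a * inner ℝ f v' ≤ 4 * a ^ 2 * Λ * q ^ 2 := by
    have h0 : ‖v'‖ ≤ 2 * Λ * q := by
      have h1 : ‖v'‖ ≤ ‖v' - v‖ + ‖v‖ := by simpa using norm_add_le (v' - v) v
      have h2 : 3 * Λ * (a * q) ≤ Λ * q := by
        have := mul_le_mul_of_nonneg_right ha (mul_nonneg hΛ0 hq)
        linarith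
      linarith
    have h1 : inner ℝ f v' ≤ q * (2 * Λ * q) := (real_inner_le_norm _ _).trans
      (mul_le_mul hf h0 (norm_nonneg _) hq)
    have h2 : 0 ≤ a * (q * (2 * Λ * q)) := by positivity
    have h3 := mul_le_mul_of_nonneg_left h1 (mul_nonneg ha' ha0)
    have h4 := mul_le_mul_of_nonneg_right haa' h2
    have h5 : a * (a * (q * (2 * Λ * q))) = 2 * a ^ 2 * Λ * q ^ 2 := by ring
    linarith
  rw [e1, e2, inner_add_right]
  linarith

/-- The scalar recursion that results from the drift inequality for the Lyapunov function. -/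
lemma lyapunov_recursion {W W' E G a δ η Λ : ℝ} (hE : 0 ≤ E) (ha : 0 ≤ a)
    (hΛ : 0 ≤ Λ) (hη : 0 ≤ η) (hη2 : η ≤ 2) (haΛ : 8 * (a * Λ) ≤ 1 / 8)
    (hε : 18 * (7 * a ^ 2 * Λ + δ * Λ) ≤ 3 / 4 * (η * a))
    (hstep : W' ≤ W - 2 * a * (η * E) + (7 * a ^ 2 * Λ + δ * Λ) * (8 * G ^ 2 + 18 * E))
    (hW : |W - E| ≤ 2 * (a * Λ) * (G ^ 2 + 4 * E)) :
    W' ≤ (1 - η * a) * W + G ^ 2 * Λ * (60 * a ^ 2 + 8 * δ) := by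
  have h1 := (abs_le.1 hW).2
  -- Of the drift 2ηaE, the part 3/4 pays for the error proportional to E. The remaining 5/4
  -- dominates ηaW up to 2ηa²ΛG² ≤ 4a²ΛG², which turns 8 · 7 = 56 into 60.
  have h2 : W ≤ 5 / 4 * E + 2 * (a * Λ) * G ^ 2 := by nlinarith
  have h3 : (7 * a ^ 2 * Λ + δ * Λ) * (18 * E) ≤ 3 / 4 * (η * a) * E := by nlinarith
  have h4 : η * a * W ≤ η * a * (5 / 4 * E + 2 * (a * Λ) * G ^ 2) :=
    mul_le_mul_of_nonneg_left h2 (mul_nonneg hη ha)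
  have h5 : η * (2 * (a ^ 2 * Λ * G ^ 2)) ≤ 2 * (2 * (a ^ 2 * Λ * G ^ 2)) :=
    mul_le_mul_of_nonneg_right hη2 (by positivity)
  linarith

namespace PolicyEvaluation

variable {S : Type*} {A : Type*} [Fintype S] [Fintype A] {d : ℕ} (M : PolicyEvaluation S A d)

/-- The corrector, which solves the Poisson equation of the update direction. -/
lemma exists_corrector [DecidableEq S] {μ : S → ℝ} {C β : ℝ} (hμ : IsStationaryDist M.P μ)
    (hmix : IsMixing M.P μ C β) (θs : EuclideanSpace ℝ (Fin d)) :
    ∃ V : S × S → EuclideanSpace ℝ (Fin d) → EuclideanSpace ℝ (Fin d),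
      (∀ i θ θ', ‖V i θ - V i θ'‖ ≤ 3 * (8 * L1 C β) * ‖θ - θ'‖) ∧
      (∀ i, ‖V i θs‖ ≤ 8 * L1 C β * (2 * (M.rmax + 3 * ‖θs‖))) ∧
      ∀ i θ, ∑ j, pairMatrix M.P i j • (M.field i j θ + V j θ) =
        (∑ k, pairDist μ k • ∑ j, pairMatrix M.P k j • M.field k j θ) + V i θ := by
  obtain ⟨Z, hZ, hZ'⟩ := exists_poisson_pair M.P_mem_rowStochastic hμ hmix
  set h : S × S → EuclideanSpace ℝ (Fin d) → EuclideanSpace ℝ (Fin d) :=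
    fun k θ => ∑ j, pairMatrix M.P k j • M.field k j θ with hh
  have hQ0 : ∀ i j, 0 ≤ pairMatrix M.P i j := fun _ _ => mul_nonneg (M.P_nonneg _ _) (M.P_nonneg _ _)
  have havg : ∀ k (w : S × S → EuclideanSpace ℝ (Fin d)) (c : ℝ), (∀ j, ‖w j‖ ≤ c) →
      ‖∑ j, pairMatrix M.P k j • w j‖ ≤ c := fun k w c hw => by
    refine (norm_sum_le _ _).trans ?_
    calc ∑ j, ‖pairMatrix M.P k j • w j‖ ≤ ∑ j, pairMatrix M.P k j * c :=
          Finset.sum_le_sum fun j _ => by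
            rw [norm_smul, Real.norm_eq_abs, abs_of_nonneg (hQ0 _ _)]
            exact mul_le_mul_of_nonneg_left (hw j) (hQ0 _ _)
      _ = c := by rw [← Finset.sum_mul, pairMatrix_sum M.P_sum, one_mul]
  have hZavg : ∀ i (w : S × S → EuclideanSpace ℝ (Fin d)) (c : ℝ), 0 ≤ c → (∀ j, ‖w j‖ ≤ c) →
      ‖∑ k, Z i k • w k‖ ≤ 8 * L1 C β * c := fun i w c hc hw => by
    refine (norm_sum_le _ _).trans ?_
    calc ∑ k, ‖Z i k • w k‖ ≤ ∑ k, |Z i k| * c :=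
          Finset.sum_le_sum fun j _ => by
            rw [norm_smul, Real.norm_eq_abs]
            exact mul_le_mul_of_nonneg_left (hw j) (abs_nonneg _)
      _ ≤ 8 * L1 C β * c := by
          rw [← Finset.sum_mul]
          exact mul_le_mul_of_nonneg_right (hZ i) hc
  -- The direction is first averaged over the successor state, so the Poisson equation lives on
  -- states of the pair chain rather than on transitions. `V` inherits the Lipschitz constant and
  -- the bound of the field, multiplied by the row sums of Z.
  refine ⟨fun i θ => ∑ k, Z i k • h k θ, fun i θ θ' => ?_, fun i => ?_, fun i θ => ?_⟩
  · rw [← Finset.sum_sub_distrib]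
    simp_rw [← smul_sub]
    have := hZavg i (fun k => h k θ - h k θ') (3 * ‖θ - θ'‖) (by positivity) (fun k => by
      simp only [hh]
      rw [← Finset.sum_sub_distrib]
      simp_rw [← smul_sub]
      exact havg k _ _ fun j => M.norm_field_sub_le k j θ θ')
    linarith
  · exact hZavg i _ _ (by have := M.rmax_nonneg; positivity)
      fun k => havg k _ _ fun j => M.norm_field_le k j θs
  · simp_rw [smul_add, Finset.sum_add_distrib]
    have h1 : ∑ j, pairMatrix M.P i j • ∑ k, Z j k • h k θ =
        ∑ k, (∑ j, pairMatrix M.P i j * Z j k) • h k θ := by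
      simp_rw [Finset.smul_sum, Finset.sum_smul, smul_smul]
      exact Finset.sum_comm
    have h2 : ∀ k, ∑ j, pairMatrix M.P i j * Z j k =
        Z i k - (1 : Matrix (S × S) (S × S) ℝ) i k + pairDist μ k := fun k => by
      linarith [hZ' i k]
    rw [h1]
    simp_rw [h2, add_smul, sub_smul, Finset.sum_add_distrib, Finset.sum_sub_distrib]
    have h3 : ∑ k, (1 : Matrix (S × S) (S × S) ℝ) i k • h k θ = h i θ := by
      simp [Matrix.one_apply]
    rw [h3]
    simp only [hh]
    abel

variable {Ω : Type*} [MeasurableSpace Ω] [MeasurableSpace S] [DiscreteMeasurableSpace S]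

/-- A Lyapunov sequence for the mean square error of the double-chain method. -/
lemma exists_lyapunov [DecidableEq S] {μ : S → ℝ} {C β : ℝ} {θs : EuclideanSpace ℝ (Fin d)}
    {Pr : Measure Ω} [IsProbabilityMeasure Pr] {s sHat : ℕ → Ω → S}
    {θ₀ : Ω → EuclideanSpace ℝ (Fin d)} {α : ℕ → ℝ} (hd : 0 < d) (hη : 0 ≤ M.eta μ)
    (hμ : IsStationaryDist M.P μ) (hmix : IsMixing M.P μ C β) (hθs : M.IsFixedPoint μ θs)
    (h : IsDoubleChain M.P Pr s sHat θ₀) (hα0 : ∀ t, 0 ≤ α t) (hα : ∀ t, α (t + 1) ≤ α t)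
    (hα3 : ∀ t, 3 * α t ≤ 1) (hαΛ : ∀ t, 8 * (α t * (8 * L1 C β)) ≤ 1 / 8)
    (hε : ∀ t, 18 * (7 * α t ^ 2 * (8 * L1 C β) + (α t - α (t + 1)) * (8 * L1 C β)) ≤
      3 / 4 * (M.eta μ * α t)) :
    ∃ W : ℕ → ℝ,
      (∀ t, W (t + 1) ≤ (1 - M.eta μ * α t) * W t +
        (M.rmax + 3 * ‖θs‖) ^ 2 * (8 * L1 C β) * (60 * α t ^ 2 + 8 * (α t - α (t + 1)))) ∧
      ∀ t, |W t - ∫ ω, ‖M.iterate α s sHat θ₀ t ω - θs‖ ^ 2 ∂Pr| ≤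
        2 * (α t * (8 * L1 C β)) * ((M.rmax + 3 * ‖θs‖) ^ 2 +
          4 * ∫ ω, ‖M.iterate α s sHat θ₀ t ω - θs‖ ^ 2 ∂Pr) := by
  obtain ⟨V, hVlip, hVs, hV⟩ := M.exists_corrector hμ hmix θs
  have hΛ : 1 ≤ 8 * L1 C β := by have := one_le_L1 C β; linarith
  generalize 8 * L1 C β = Λ at *
  set G := M.rmax + 3 * ‖θs‖ with hG
  have hG0 : 0 ≤ G := by have := M.rmax_nonneg; positivity
  set η := M.eta μ
  have hη2 : η ≤ 2 := eta_le_two hd hμ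
  set X := M.iterate α s sHat θ₀
  have hs := h.chain.1
  have hsHat := h.chainHat.1
  have hYm : ∀ t, Measurable fun ω => (s t ω, sHat t ω) := fun t => (hs t).prodMk (hsHat t)
  have hXm : ∀ t, Measurable (X t) := fun t => M.measurable_iterate hs hsHat h.measurable_init t
  have hXLp : ∀ t, MemLp (X t) 2 Pr := fun t =>
    M.memLp_iterate hs hsHat h.measurable_init h.memLp_init t
  -- A common majorant: `q` bounds the field, Λq bounds the corrector, and 3‖θ - θ*‖ ≤ q. All
  -- remainders become multiples of q², whose expectation is at most 8G² + 18E‖θ - θ*‖².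
  set q : EuclideanSpace ℝ (Fin d) → ℝ := fun θ => 2 * G + 3 * ‖θ - θs‖ with hq
  have hq0 : ∀ θ, 0 ≤ q θ := fun θ => by simp only [hq]; positivity
  have hqx : ∀ θ, 3 * ‖θ - θs‖ ≤ q θ := fun θ => by simp only [hq]; linarith
  have hqf : ∀ i j θ, ‖M.field i j θ‖ ≤ q θ := fun i j θ => by
    have h1 := M.norm_field_sub_le i j θ θs
    have h2 := M.norm_field_le i j θs
    have h3 : ‖M.field i j θ‖ ≤ ‖M.field i j θ - M.field i j θs‖ + ‖M.field i j θs‖ := by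
      simpa using norm_add_le (M.field i j θ - M.field i j θs) (M.field i j θs)
    simp only [hq]; linarith
  have hqV : ∀ i θ, ‖V i θ‖ ≤ Λ * q θ := fun i θ => by
    have h1 := hVlip i θ θs
    have h2 := hVs i
    have h3 : ‖V i θ‖ ≤ ‖V i θ - V i θs‖ + ‖V i θs‖ := by
      simpa using norm_add_le (V i θ - V i θs) (V i θs)
    simp only [hq]; linarith
  have hVc : ∀ i, Continuous (V i) := fun i => by
    refine (LipschitzWith.of_dist_le_mul (K := ⟨3 * Λ, by positivity⟩) fun θ θ' => ?_).continuous
    rw [dist_eq_norm, dist_eq_norm]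
    exact hVlip i θ θ'
  set c₁ : ℝ := 2 * (2 * G + 3 * ‖θs‖) ^ 2 + 18 with hc₁
  have hqc : ∀ θ, q θ ^ 2 ≤ c₁ * (1 + ‖θ‖ ^ 2) := fun θ => by
    have h1 : q θ ≤ (2 * G + 3 * ‖θs‖) + 3 * ‖θ‖ := by
      have := norm_sub_le θ θs
      simp only [hq]; linarith
    have h2 := pow_le_pow_left₀ (hq0 θ) h1 2
    have h3 : 0 ≤ (2 * G + 3 * ‖θs‖) ^ 2 * ‖θ‖ ^ 2 := by positivity
    simp only [hc₁]
    nlinarith [sq_nonneg ((2 * G + 3 * ‖θs‖) - 3 * ‖θ‖)]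
  have hqcont : Continuous q := by simp only [hq]; fun_prop
  have hqint : ∀ t, Integrable (fun ω => q (X t ω) ^ 2) Pr := fun t =>
    integrable_of_quadratic_growth (ψ := fun _ θ => q θ ^ 2) (c := c₁)
      (fun _ => (hqcont.pow 2).measurable)
      (fun _ θ => by rw [abs_of_nonneg (sq_nonneg _)]; exact hqc θ) (hYm t) (hXm t) (hXLp t)
  have hsub : ∀ t, MemLp (fun ω => X t ω - θs) 2 Pr := fun t => (hXLp t).sub (memLp_const θs)
  have hEint : ∀ t, Integrable (fun ω => ‖X t ω - θs‖ ^ 2) Pr := fun t =>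
    (hsub t).integrable_norm_pow two_ne_zero
  have hinner : ∀ i θ, |inner ℝ (θ - θs) (V i θ)| ≤ Λ * q θ ^ 2 := fun i θ => by
    refine (abs_real_inner_le_norm _ _).trans ?_
    have h1 : ‖θ - θs‖ ≤ q θ := by linarith [hqx θ, norm_nonneg (θ - θs)]
    refine (mul_le_mul h1 (hqV i θ) (norm_nonneg _) (hq0 θ)).trans_eq ?_
    ring
  have hVint : ∀ t, Integrable (fun ω => inner ℝ (X t ω - θs) (V (s t ω, sHat t ω) (X t ω))) Pr :=
    fun t => integrable_of_quadratic_growth (I := S × S) (ψ := fun i θ => inner ℝ (θ - θs) (V i θ))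
      (c := Λ * c₁)
      (fun i => ((continuous_id.sub continuous_const).inner (hVc i)).measurable)
      (fun i θ => (hinner i θ).trans (by
        rw [mul_assoc]; exact mul_le_mul_of_nonneg_left (hqc θ) (by linarith)))
      (hYm t) (hXm t) (hXLp t)
  have hW : ∀ t, |∫ ω, (‖X t ω - θs‖ ^ 2 + 2 * α t * inner ℝ (X t ω - θs)
      (V (s t ω, sHat t ω) (X t ω))) ∂Pr - ∫ ω, ‖X t ω - θs‖ ^ 2 ∂Pr| ≤
      2 * (α t * Λ) * (G ^ 2 + 4 * ∫ ω, ‖X t ω - θs‖ ^ 2 ∂Pr) := fun t => by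
    rw [integral_add (hEint t) ((hVint t).const_mul _), add_sub_cancel_left]
    have hint : Integrable (fun ω => 2 * (α t * Λ) * (G ^ 2 + 4 * ‖X t ω - θs‖ ^ 2)) Pr :=
      ((integrable_const _).add ((hEint t).const_mul 4)).const_mul _
    have h1 := norm_integral_le_of_norm_le (f := fun ω => 2 * α t * inner ℝ (X t ω - θs)
      (V (s t ω, sHat t ω) (X t ω))) hint (Filter.Eventually.of_forall fun ω => by
        rw [Real.norm_eq_abs, abs_mul, abs_of_nonneg (by have := hα0 t; positivity)]
        have h2 := (abs_real_inner_le_norm (X t ω - θs) (V (s t ω, sHat t ω) (X t ω))).trans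
          (mul_le_mul_of_nonneg_left (hqV _ _) (norm_nonneg _))
        have h3 : ‖X t ω - θs‖ * q (X t ω) ≤ G ^ 2 + 4 * ‖X t ω - θs‖ ^ 2 := by
          simp only [hq]
          nlinarith [sq_nonneg (G - ‖X t ω - θs‖)]
        have h4 := mul_le_mul_of_nonneg_left h3 (zero_le_one.trans hΛ)
        have h5 : |inner ℝ (X t ω - θs) (V (s t ω, sHat t ω) (X t ω))| ≤
            Λ * (G ^ 2 + 4 * ‖X t ω - θs‖ ^ 2) := by linarith
        have h6 := mul_le_mul_of_nonneg_left h5 (mul_nonneg zero_le_two (hα0 t))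
        linarith)
    refine h1.trans_eq ?_
    rw [integral_const_mul, integral_add (integrable_const _) ((hEint t).const_mul 4),
      integral_const_mul, integral_const, probReal_univ, one_smul]
  -- The corrector carries the stepsize of the same time; the mismatch with the next stepsize
  -- produces the terms in α_t - α_{t+1}.
  refine ⟨fun t => ∫ ω, (‖X t ω - θs‖ ^ 2 +
    2 * α t * inner ℝ (X t ω - θs) (V (s t ω, sHat t ω) (X t ω))) ∂Pr, fun t => ?_, hW⟩
  refine lyapunov_recursion (E := ∫ ω, ‖X t ω - θs‖ ^ 2 ∂Pr)
    (integral_nonneg fun _ => sq_nonneg _) (hα0 t)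
    (by linarith) hη hη2 (hαΛ t) (hε t) ?_ (hW t)
  set ψ : S × S → S × S → EuclideanSpace ℝ (Fin d) → ℝ := fun i j θ =>
    2 * α t * inner ℝ (θ - θs) (M.field i j θ + V j θ) with hψ
  have hψm : ∀ i j, Measurable (ψ i j) := fun i j =>
    (((continuous_id.sub continuous_const).inner
      ((M.continuous_field i j).add (hVc j))).measurable).const_mul _
  have hψc : ∀ i j θ, |ψ i j θ| ≤ 2 * α t * ((1 + Λ) * c₁) * (1 + ‖θ‖ ^ 2) := fun i j θ => by
    simp only [hψ]
    rw [abs_mul, abs_of_nonneg (by have := hα0 t; positivity), mul_assoc (2 * α t)]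
    refine mul_le_mul_of_nonneg_left ?_ (by have := hα0 t; positivity)
    refine (abs_real_inner_le_norm _ _).trans ?_
    have h1 : ‖θ - θs‖ ≤ q θ := by linarith [hqx θ, norm_nonneg (θ - θs)]
    have h2 : ‖M.field i j θ + V j θ‖ ≤ (1 + Λ) * q θ := by
      have := norm_add_le (M.field i j θ) (V j θ)
      linarith [hqf i j θ, hqV j θ]
    calc ‖θ - θs‖ * ‖M.field i j θ + V j θ‖ ≤ q θ * ((1 + Λ) * q θ) :=
          mul_le_mul h1 h2 (norm_nonneg _) (hq0 θ)
      _ = (1 + Λ) * q θ ^ 2 := by ring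
      _ ≤ (1 + Λ) * (c₁ * (1 + ‖θ‖ ^ 2)) := mul_le_mul_of_nonneg_left (hqc θ) (by linarith)
      _ = _ := by ring
  have hψint : Integrable (fun ω => ψ (s t ω, sHat t ω) (s (t + 1) ω, sHat (t + 1) ω) (X t ω)) Pr :=
    integrable_of_quadratic_growth (I := (S × S) × (S × S)) (ψ := fun p => ψ p.1 p.2)
      (fun p => hψm p.1 p.2) (fun p => hψc p.1 p.2) ((hYm t).prodMk (hYm (t + 1))) (hXm t) (hXLp t)
  -- Averaging over the successor replaces F + V at the next state by the stationary mean plus V at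
  -- the present state. The first part gives the drift -2α_tη and the second is the cross term
  -- already contained in W_t.
  have hψint' : ∫ ω, ψ (s t ω, sHat t ω) (s (t + 1) ω, sHat (t + 1) ω) (X t ω) ∂Pr ≤
      ∫ ω, (2 * α t * inner ℝ (X t ω - θs) (V (s t ω, sHat t ω) (X t ω)) -
        2 * α t * η * ‖X t ω - θs‖ ^ 2) ∂Pr := by
    rw [M.integral_markov_step h hψm hψc t]
    refine integral_mono (M.integrable_sum_pairMatrix_mul hψm hψc (hYm t) (hXm t) (hXLp t))
      (((hVint t).const_mul _).sub ((hEint t).const_mul _)) fun ω => ?_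
    have h1 : ∀ i θ, ∑ j, pairMatrix M.P i j * ψ i j θ = 2 * α t * inner ℝ (θ - θs)
        (∑ j, pairMatrix M.P i j • (M.field i j θ + V j θ)) := fun i θ => by
      rw [inner_sum, Finset.mul_sum]
      refine Finset.sum_congr rfl fun j _ => ?_
      rw [inner_smul_right]
      simp only [hψ]
      ring
    simp only [h1, hV, inner_add_right]
    have h2 := mul_le_mul_of_nonneg_left (M.inner_mean_field_le hμ hθs (X t ω))
      (mul_nonneg zero_le_two (hα0 t))
    linarith
  -- This pathwise inequality evaluates the corrector at the next state but at the old iterate,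
  -- which is the form that the Markov property can average.
  have hpath : ∀ ω, ‖X (t + 1) ω - θs‖ ^ 2 + 2 * α (t + 1) * inner ℝ (X (t + 1) ω - θs)
      (V (s (t + 1) ω, sHat (t + 1) ω) (X (t + 1) ω)) ≤
      ‖X t ω - θs‖ ^ 2 + ψ (s t ω, sHat t ω) (s (t + 1) ω, sHat (t + 1) ω) (X t ω) +
      (7 * α t ^ 2 * Λ + (α t - α (t + 1)) * Λ) * q (X t ω) ^ 2 := fun ω => by
    have hX : X (t + 1) ω - θs = (X t ω - θs) + α t •
        M.field (s t ω, sHat t ω) (s (t + 1) ω, sHat (t + 1) ω) (X t ω) := by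
      have : X (t + 1) ω = X t ω + α t •
        M.field (s t ω, sHat t ω) (s (t + 1) ω, sHat (t + 1) ω) (X t ω) := M.iterate_succ t ω
      rw [this]; abel
    have hdiff : ‖X (t + 1) ω - X t ω‖ ≤ α t * q (X t ω) := by
      have : X (t + 1) ω - X t ω = α t •
        M.field (s t ω, sHat t ω) (s (t + 1) ω, sHat (t + 1) ω) (X t ω) := by
        rw [← sub_sub_sub_cancel_right _ _ θs, hX, add_sub_cancel_left]
      rw [this, norm_smul, Real.norm_eq_abs, abs_of_nonneg (hα0 t)]
      exact mul_le_mul_of_nonneg_left (hqf _ _ _) (hα0 t)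
    rw [hX]
    exact lyapunov_step (hα0 _) (hα t) (hα3 t) hΛ (hqx _) (hqf _ _ _) (hqV _ _)
      ((hVlip _ _ _).trans (mul_le_mul_of_nonneg_left hdiff (by linarith)))
  have hqle : ∫ ω, q (X t ω) ^ 2 ∂Pr ≤ 8 * G ^ 2 + 18 * ∫ ω, ‖X t ω - θs‖ ^ 2 ∂Pr := by
    have h1 : ∫ ω, q (X t ω) ^ 2 ∂Pr ≤ ∫ ω, (8 * G ^ 2 + 18 * ‖X t ω - θs‖ ^ 2) ∂Pr := by
      refine integral_mono (hqint t) ((integrable_const _).add ((hEint t).const_mul _)) fun ω => ?_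
      simp only [hq]
      nlinarith [sq_nonneg (2 * G - 3 * ‖X t ω - θs‖)]
    rwa [integral_add (integrable_const _) ((hEint t).const_mul _), integral_const, probReal_univ,
      one_smul, integral_const_mul] at h1
  have hε0 : 0 ≤ 7 * α t ^ 2 * Λ + (α t - α (t + 1)) * Λ :=
    add_nonneg (by positivity) (mul_nonneg (sub_nonneg.2 (hα t)) (by linarith))
  have hmono := integral_mono ((hEint (t + 1)).add ((hVint (t + 1)).const_mul (2 * α (t + 1))))
    (((hEint t).add hψint).add ((hqint t).const_mul
      (7 * α t ^ 2 * Λ + (α t - α (t + 1)) * Λ))) hpath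
  have e1 : ∫ ω, (‖X t ω - θs‖ ^ 2 + ψ (s t ω, sHat t ω) (s (t + 1) ω, sHat (t + 1) ω) (X t ω) +
      (7 * α t ^ 2 * Λ + (α t - α (t + 1)) * Λ) * q (X t ω) ^ 2) ∂Pr =
      ∫ ω, ‖X t ω - θs‖ ^ 2 ∂Pr +
      ∫ ω, ψ (s t ω, sHat t ω) (s (t + 1) ω, sHat (t + 1) ω) (X t ω) ∂Pr +
      (7 * α t ^ 2 * Λ + (α t - α (t + 1)) * Λ) * ∫ ω, q (X t ω) ^ 2 ∂Pr := by
    have hadd : Integrable (fun ω => ‖X t ω - θs‖ ^ 2 +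
      ψ (s t ω, sHat t ω) (s (t + 1) ω, sHat (t + 1) ω) (X t ω)) Pr := (hEint t).add hψint
    rw [integral_add hadd ((hqint t).const_mul _), integral_add (hEint t) hψint,
      integral_const_mul (7 * α t ^ 2 * Λ + (α t - α (t + 1)) * Λ)]
  have e2 : ∫ ω, (‖X t ω - θs‖ ^ 2 + 2 * α t * inner ℝ (X t ω - θs)
      (V (s t ω, sHat t ω) (X t ω))) ∂Pr = ∫ ω, ‖X t ω - θs‖ ^ 2 ∂Pr +
      2 * α t * ∫ ω, inner ℝ (X t ω - θs) (V (s t ω, sHat t ω) (X t ω)) ∂Pr := by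
    rw [integral_add (hEint t) ((hVint t).const_mul _), integral_const_mul]
  have e3 : ∫ ω, (2 * α t * inner ℝ (X t ω - θs) (V (s t ω, sHat t ω) (X t ω)) -
      2 * α t * η * ‖X t ω - θs‖ ^ 2) ∂Pr =
      2 * α t * ∫ ω, inner ℝ (X t ω - θs) (V (s t ω, sHat t ω) (X t ω)) ∂Pr -
      2 * α t * η * ∫ ω, ‖X t ω - θs‖ ^ 2 ∂Pr := by
    rw [integral_sub ((hVint t).const_mul _) ((hEint t).const_mul _), integral_const_mul,
      integral_const_mul]
  have h6 := hψint'.trans_eq e3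
  have h7 := mul_le_mul_of_nonneg_left hqle hε0
  have hmono' := hmono.trans_eq e1
  beta_reduce
  rw [e2]
  refine hmono'.trans ?_
  linarith

end PolicyEvaluation

/-! ### Supersolutions of the scalar recursion. -/

section Scalar

/-- Comparison with a supersolution of the linear recursion. -/
lemma le_of_recursion {W H v ρ ε : ℕ → ℝ} {B w : ℝ} (hρ : ∀ t, 0 ≤ ρ t) (hB : 0 ≤ B)
    (hw : 0 ≤ w) (hW : ∀ t, W (t + 1) ≤ ρ t * W t + B * ε t) (hW0 : W 0 ≤ w) (hH0 : H 0 = 1)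
    (hH : ∀ t, ρ t * H t ≤ H (t + 1)) (hv0 : 0 ≤ v 0) (hv : ∀ t, ρ t * v t + ε t ≤ v (t + 1))
    (t : ℕ) : W t ≤ w * H t + B * v t := by
  induction t with
  | zero =>
    rw [hH0]
    have := mul_nonneg hB hv0
    linarith
  | succ t ih =>
    have h1 := mul_le_mul_of_nonneg_left ih (hρ t)
    have h2 := mul_le_mul_of_nonneg_left (hH t) hw
    have h3 := mul_le_mul_of_nonneg_left (hv t) hB
    have h4 := hW t
    linarith

/-- Since log(1 + 1/x) ≤ 1/x, the contraction factor is below a ratio of powers, and the product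
over time telescopes to (c₀/(T + c₀))^m. -/
lemma one_sub_div_le_rpow {m x : ℝ} (hm : 0 ≤ m) (hx : 0 < x) :
    1 - m / x ≤ (x / (x + 1)) ^ m := by
  have h1 : Real.log ((x + 1) / x) ≤ 1 / x := by
    have := Real.log_le_sub_one_of_pos (x := (x + 1) / x) (by positivity)
    have h2 : (x + 1) / x - 1 = 1 / x := by field_simp; ring
    linarith
  have h3 : Real.log (x / (x + 1)) = -Real.log ((x + 1) / x) := by
    rw [← Real.log_inv, inv_div]
  rw [Real.rpow_def_of_pos (by positivity), h3]
  have h4 := Real.add_one_le_exp (-Real.log ((x + 1) / x) * m)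
  have h5 := mul_le_mul_of_nonneg_right h1 hm
  have h6 : 1 / x * m = m / x := by ring
  linarith

/-- Concavity of the power 1 - ξ, in the form of Bernoulli's inequality. It compares one stepsize
with one increment of the exponent in the exponential decay. -/
lemma add_one_rpow_sub_le {ξ x : ℝ} (hξ0 : 0 ≤ ξ) (hξ : ξ ≤ 1) (hx : 0 < x) :
    (x + 1) ^ (1 - ξ) - x ^ (1 - ξ) ≤ (1 - ξ) / x ^ ξ := by
  have h1 := rpow_one_add_le_one_add_mul_self (s := 1 / x) (p := 1 - ξ)
    (by have : 0 < 1 / x := by positivity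
        linarith) (by linarith) (by linarith)
  have h2 : (x + 1) ^ (1 - ξ) = x ^ (1 - ξ) * (1 + 1 / x) ^ (1 - ξ) := by
    rw [← Real.mul_rpow hx.le (by positivity)]
    congr 1
    field_simp
  have h3 : x ^ (1 - ξ) * (1 / x) = 1 / x ^ ξ := by
    rw [Real.rpow_sub hx, Real.rpow_one]
    field_simp
  have h4 := mul_le_mul_of_nonneg_left h1 (Real.rpow_nonneg hx.le (1 - ξ))
  have h5 : x ^ (1 - ξ) * (1 + (1 - ξ) * (1 / x)) = x ^ (1 - ξ) + (1 - ξ) / x ^ ξ := by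
    calc _ = x ^ (1 - ξ) + (1 - ξ) * (x ^ (1 - ξ) * (1 / x)) := by ring
      _ = _ := by rw [h3]; ring
  linarith

variable {a c₀ ξ : ℝ}

lemma stepsize_pos (ha : 0 < a) (hc : 0 < c₀) (t : ℕ) : 0 < stepsize a c₀ ξ t :=
  div_pos ha (Real.rpow_pos_of_pos (by positivity) _)

lemma stepsize_le (ha : 0 < a) (hc : 0 < c₀) (hξ : 0 ≤ ξ) (t : ℕ) :
    stepsize a c₀ ξ t ≤ a / c₀ ^ ξ :=
  div_le_div_of_nonneg_left ha.le (Real.rpow_pos_of_pos hc _)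
    (Real.rpow_le_rpow hc.le (by linarith [Nat.cast_nonneg (α := ℝ) t]) hξ)

lemma stepsize_succ_le (ha : 0 < a) (hc : 0 < c₀) (hξ : 0 ≤ ξ) (t : ℕ) :
    stepsize a c₀ ξ (t + 1) ≤ stepsize a c₀ ξ t :=
  div_le_div_of_nonneg_left ha.le (Real.rpow_pos_of_pos (by positivity) _)
    (Real.rpow_le_rpow (by positivity) (by push_cast; linarith) hξ)

/-- For ξ ≤ 1 the ratio of consecutive stepsizes is at least x/(x + 1) ≥ 1 - 1/x, so the increments
are of second order. -/
lemma stepsize_sub_succ_le (ha : 0 < a) (hc : 0 < c₀) (hξ : ξ ≤ 1) (t : ℕ) :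
    stepsize a c₀ ξ t - stepsize a c₀ ξ (t + 1) ≤ stepsize a c₀ ξ t / (t + c₀) := by
  have hx : 0 < (t : ℝ) + c₀ := by positivity
  have h1 : stepsize a c₀ ξ (t + 1) =
      stepsize a c₀ ξ t * (((t : ℝ) + c₀) / ((t : ℝ) + c₀ + 1)) ^ ξ := by
    rw [stepsize, stepsize, Real.div_rpow hx.le (by positivity)]
    have h2 : ((t + 1 : ℕ) : ℝ) + c₀ = t + c₀ + 1 := by push_cast; ring
    rw [h2]
    have := (Real.rpow_pos_of_pos hx ξ).ne'
    field_simp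
  have h2 : ((t : ℝ) + c₀) / ((t : ℝ) + c₀ + 1) ≤
      (((t : ℝ) + c₀) / ((t : ℝ) + c₀ + 1)) ^ ξ := by
    conv_lhs => rw [← Real.rpow_one (((t : ℝ) + c₀) / ((t : ℝ) + c₀ + 1))]
    exact Real.rpow_le_rpow_of_exponent_ge (by positivity)
      (by rw [div_le_one (by positivity)]; linarith) hξ
  have h3 : 1 - 1 / ((t : ℝ) + c₀) ≤ ((t : ℝ) + c₀) / ((t : ℝ) + c₀ + 1) := by
    rw [le_div_iff₀ (by positivity)]
    have : 0 ≤ 1 / ((t : ℝ) + c₀) := by positivity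
    have h4 : 1 / ((t : ℝ) + c₀) * ((t : ℝ) + c₀) = 1 := by field_simp
    linarith
  rw [h1]
  have h5 := mul_le_mul_of_nonneg_left (h3.trans h2) (stepsize_pos (ξ := ξ) ha hc t).le
  have h6 : stepsize a c₀ ξ t / (t + c₀) = stepsize a c₀ ξ t * (1 / (t + c₀)) := by ring
  linarith

lemma stepsize_one (t : ℕ) : stepsize a c₀ 1 t = a / (t + c₀) := by
  rw [stepsize, Real.rpow_one]

variable {m k x : ℝ}

/-- The function k/((m - 1)x) solves v' = -m v/x + k/x², and the discretization error has the
favourable sign. -/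
lemma supersolution_of_one_lt (hm : 1 < m) (hk : 0 ≤ k) (hx : 0 < x) :
    (1 - m / x) * (k / ((m - 1) * x)) + k / x ^ 2 ≤ k / ((m - 1) * (x + 1)) := by
  have hm1 : 0 < m - 1 := by linarith
  have : k / ((m - 1) * (x + 1)) - ((1 - m / x) * (k / ((m - 1) * x)) + k / x ^ 2) =
      k / ((m - 1) * x ^ 2 * (x + 1)) := by
    field_simp
    ring
  have h2 : 0 ≤ k / ((m - 1) * x ^ 2 * (x + 1)) := by positivity
  linarith

/-- At m = 1 the equation v' = -m v/x + k/x² is resonant and k log x / x solves it; a larger m only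
helps. The discrete remainder is nonnegative once log x ≥ 2, and 8 is large enough for that. -/
lemma supersolution_log (hm : 1 ≤ m) (hk : 0 ≤ k) (hx : 8 ≤ x) :
    (1 - m / x) * (k * Real.log x / x) + k / x ^ 2 ≤ k * Real.log (x + 1) / (x + 1) := by
  have hx0 : 0 < x := by linarith
  have hlog : 2 ≤ Real.log x := by
    have h1 : Real.log 8 ≤ Real.log x := Real.log_le_log (by norm_num) hx
    have h2 : Real.log 8 = 3 * Real.log 2 := by
      rw [show (8 : ℝ) = 2 ^ 3 by norm_num, Real.log_pow]; norm_num
    linarith [Real.log_two_gt_d9]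
  have h1 : Real.log x + 1 / (x + 1) ≤ Real.log (x + 1) := by
    have h2 := Real.one_sub_inv_le_log_of_pos (x := (x + 1) / x) (by positivity)
    rw [Real.log_div (by positivity) hx0.ne', inv_div] at h2
    have h3 : 1 - x / (x + 1) = 1 / (x + 1) := by field_simp; ring
    linarith
  have h2 : (1 - m / x) * (k * Real.log x / x) ≤ (1 - 1 / x) * (k * Real.log x / x) := by
    refine mul_le_mul_of_nonneg_right ?_ (by positivity)
    have := div_le_div_of_nonneg_right hm hx0.le
    linarith
  have h3 : k * (Real.log x + 1 / (x + 1)) / (x + 1) ≤ k * Real.log (x + 1) / (x + 1) := by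
    gcongr
  have h4 : k * (Real.log x + 1 / (x + 1)) / (x + 1) -
      ((1 - 1 / x) * (k * Real.log x / x) + k / x ^ 2) =
      k * ((x + 1) * (Real.log x - 2) + 1) / (x ^ 2 * (x + 1) ^ 2) := by
    field_simp
    ring
  have h5 : 0 ≤ k * ((x + 1) * (Real.log x - 2) + 1) / (x ^ 2 * (x + 1) ^ 2) := by
    have := mul_nonneg (by linarith : 0 ≤ x + 1) (sub_nonneg.2 hlog)
    positivity
  linarith

/-- The continuous solution is k/(1 - m) times x^(-m) - 1/x: the homogeneous part x^(-m) costs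
nothing and -1/x produces the forcing. Doubling the coefficient leaves room for the discretization
when (1 - m)x ≥ 2. -/
lemma supersolution_of_lt_one (hm0 : 0 ≤ m) (hm : m < 1) (hk : 0 ≤ k) (hx0 : 0 < x)
    (hx : 2 / (1 - m) ≤ x) :
    (1 - m / x) * (2 * k / (1 - m) * (x ^ (-m) - x⁻¹)) + k / x ^ 2 ≤
      2 * k / (1 - m) * ((x + 1) ^ (-m) - (x + 1)⁻¹) := by
  have hm1 : 0 < 1 - m := by linarith
  have h1 : (1 - m / x) * x ^ (-m) ≤ (x + 1) ^ (-m) := by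
    have h2 := mul_le_mul_of_nonneg_right (one_sub_div_le_rpow hm0 hx0)
      (Real.rpow_nonneg hx0.le (-m))
    refine h2.trans_eq ?_
    rw [Real.div_rpow hx0.le (by positivity), Real.rpow_neg hx0.le, Real.rpow_neg (by positivity)]
    have := (Real.rpow_pos_of_pos hx0 m).ne'
    field_simp
  have h2 := mul_le_mul_of_nonneg_left h1 (by positivity : 0 ≤ 2 * k / (1 - m))
  have h3 : k / x ^ 2 ≤ 2 * k / (1 - m) * ((1 - m / x) * x⁻¹ - (x + 1)⁻¹) := by
    have h4 : 2 * k / (1 - m) * ((1 - m / x) * x⁻¹ - (x + 1)⁻¹) - k / x ^ 2 =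
        k * ((1 - m) * x - (1 + m)) / ((1 - m) * x ^ 2 * (x + 1)) := by
      field_simp
      ring
    rw [div_le_iff₀ hm1] at hx
    have h5 : 0 ≤ k * ((1 - m) * x - (1 + m)) / ((1 - m) * x ^ 2 * (x + 1)) := by
      refine div_nonneg (mul_nonneg hk (by linarith)) (by positivity)
    linarith
  linarith

/-- The equilibrium for a frozen stepsize α is kα/η. The factor 2 covers the decrease of the
stepsize, which is at most ηα²/2. -/
lemma supersolution_stepsize {η : ℝ} (ha : 0 < a) (hc : 0 < c₀) (hξ : ξ ≤ 1)
    (hη : 0 < η) (hk : 0 ≤ k) (t : ℕ) (hx : 2 / ((t : ℝ) + c₀) ≤ η * stepsize a c₀ ξ t) :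
    (1 - η * stepsize a c₀ ξ t) * (2 * k * stepsize a c₀ ξ t / η) + k * stepsize a c₀ ξ t ^ 2 ≤
      2 * k * stepsize a c₀ ξ (t + 1) / η := by
  have h1 := stepsize_sub_succ_le ha hc hξ t
  have h0 := stepsize_pos (ξ := ξ) ha hc t
  generalize stepsize a c₀ ξ (t + 1) = α' at *
  generalize stepsize a c₀ ξ t = α at *
  have h2 : α / (t + c₀) ≤ η * α ^ 2 / 2 := by
    have h3 := mul_le_mul_of_nonneg_left hx h0.le
    have h4 : α * (2 / (t + c₀)) = 2 * (α / (t + c₀)) := by ring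
    linarith
  have h5 : (1 - η * α) * (2 * k * α / η) + k * α ^ 2 = (2 * k * α - η * k * α ^ 2) / η := by
    field_simp
    ring
  rw [h5]
  refine div_le_div_of_nonneg_right ?_ hη.le
  have h6 := mul_le_mul_of_nonneg_left (h1.trans h2) hk
  linarith

end Scalar

/-! ### The offset and what it guarantees. -/

/-- How large `c₀` has to be. -/
noncomputable def minOffset (a ξ η C β : ℝ) : ℝ :=
  -- In order, the entries ensure: log ≥ 2; 2048 α_t L₁ ≤ η; 2048 L₁/(t + c₀) ≤ η; for ξ < 1, 2/(t +
  -- c₀) ≤ ηα_t; log c₀ - log a ≥ 1/a; and, for ξ = 1, (1 - aη)c₀ ≥ 2 when aη < 1. The default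
  -- values are harmless: for ξ = 1 the exponent 1/(1 - ξ) is 0 and that entry is 1, and for aη ≥ 1
  -- the last entry is not positive.
  max (max (max 8 ((2048 * a * L1 C β / η) ^ (1 / ξ))) (max (2048 * L1 C β / η)
    ((2 / (a * η)) ^ (1 / (1 - ξ))))) (max (a * Real.exp (1 / a))
      (if ξ = 1 then 2 / (1 - a * η) else 0))

lemma minOffset_pos (a ξ η C β : ℝ) : 0 < minOffset a ξ η C β :=
  lt_max_of_lt_left (lt_max_of_lt_left (lt_max_of_lt_left (by norm_num)))

section Offset

variable {a ξ η C β c₀ : ℝ}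

lemma eight_le_of_minOffset_le (h : minOffset a ξ η C β ≤ c₀) : 8 ≤ c₀ := by
  simp only [minOffset, max_le_iff] at h
  exact h.1.1.1

lemma stepsize_mul_L1_le (ha : 0 < a) (hξ : 0 < ξ) (hη : 0 < η) (h : minOffset a ξ η C β ≤ c₀)
    (t : ℕ) : 2048 * (stepsize a c₀ ξ t * L1 C β) ≤ η := by
  have hc : 0 < c₀ := (minOffset_pos a ξ η C β).trans_le h
  have hL := one_le_L1 C β
  simp only [minOffset, max_le_iff] at h
  have h1 := h.1.1.2
  have h2 : 2048 * a * L1 C β / η ≤ c₀ ^ ξ := by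
    have := Real.rpow_le_rpow (by positivity) h1 hξ.le
    rwa [← Real.rpow_mul (by positivity), one_div, inv_mul_cancel₀ hξ.ne', Real.rpow_one] at this
  have h3 := stepsize_le (ξ := ξ) ha hc hξ.le t
  have hp : 0 < c₀ ^ ξ := Real.rpow_pos_of_pos hc _
  calc 2048 * (stepsize a c₀ ξ t * L1 C β) ≤ 2048 * (a / c₀ ^ ξ * L1 C β) := by gcongr
    _ = 2048 * a * L1 C β / c₀ ^ ξ := by ring
    _ ≤ η := by rwa [div_le_iff₀ hp, ← div_le_iff₀' hη]

lemma L1_div_le (hη : 0 < η) (h : minOffset a ξ η C β ≤ c₀) (t : ℕ) :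
    2048 * (L1 C β / ((t : ℝ) + c₀)) ≤ η := by
  have hc : 0 < c₀ := (minOffset_pos a ξ η C β).trans_le h
  simp only [minOffset, max_le_iff] at h
  have h1 := h.1.2.1
  rw [div_le_iff₀ hη] at h1
  rw [← mul_div_assoc, div_le_iff₀ (by positivity)]
  have : 0 ≤ η * t := by positivity
  linarith

lemma two_div_le_eta_mul_stepsize (ha : 0 < a) (hξ : ξ < 1) (hη : 0 < η)
    (h : minOffset a ξ η C β ≤ c₀) (t : ℕ) :
    2 / ((t : ℝ) + c₀) ≤ η * stepsize a c₀ ξ t := by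
  have hc : 0 < c₀ := (minOffset_pos a ξ η C β).trans_le h
  simp only [minOffset, max_le_iff] at h
  have hx : 0 < (t : ℝ) + c₀ := by positivity
  have h1 : (2 / (a * η)) ^ (1 / (1 - ξ)) ≤ (t : ℝ) + c₀ :=
    h.1.2.2.trans (by linarith [Nat.cast_nonneg (α := ℝ) t])
  have hξ' : 0 < 1 - ξ := by linarith
  have h2 := Real.rpow_le_rpow (by positivity) h1 hξ'.le
  rw [← Real.rpow_mul (by positivity), one_div, inv_mul_cancel₀ hξ'.ne', Real.rpow_one,
    Real.rpow_sub hx, Real.rpow_one] at h2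
  have hp : 0 < ((t : ℝ) + c₀) ^ ξ := Real.rpow_pos_of_pos hx _
  rw [div_le_div_iff₀ (by positivity) hp] at h2
  rw [stepsize, ← mul_div_assoc, div_le_div_iff₀ hx hp]
  linarith

/-- The decrease of the stepsize contributes terms linear in a, whereas the target has only a² times
this logarithmic factor. The 1/a lets a² times the factor cover a² + a. -/
lemma one_add_inv_le_log (ha : 0 < a) (h : minOffset a ξ η C β ≤ c₀) (t : ℕ) :
    1 + 1 / a ≤ Real.log ((t : ℝ) + c₀) - Real.log a + 1 := by
  simp only [minOffset, max_le_iff] at h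
  have h1 := Real.log_le_log (by positivity) (h.2.1.trans (by
    linarith [Nat.cast_nonneg (α := ℝ) t] : c₀ ≤ (t : ℝ) + c₀))
  rw [Real.log_mul ha.ne' (Real.exp_pos _).ne', Real.log_exp] at h1
  linarith

lemma two_div_one_sub_le (h : minOffset a 1 η C β ≤ c₀) : 2 / (1 - a * η) ≤ c₀ := by
  simp only [minOffset, max_le_iff, if_true] at h
  exact h.2.2

end Offset

/-! ### From supersolutions to mean square bounds. -/

namespace PolicyEvaluation

variable {S : Type*} {A : Type*} [Fintype S] [Fintype A] {d : ℕ} (M : PolicyEvaluation S A d)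
  {Ω : Type*} [MeasurableSpace Ω] {μ : S → ℝ} {C β : ℝ} {θs : EuclideanSpace ℝ (Fin d)}
  {Pr : Measure Ω} [IsProbabilityMeasure Pr] {s sHat : ℕ → Ω → S}
  {θ₀ : Ω → EuclideanSpace ℝ (Fin d)} {a ξ c₀ : ℝ}

lemma beta1_ge (hθ₀ : MemLp θ₀ 2 Pr) :
    2 * (∫ ω, ‖θ₀ ω - θs‖ ^ 2 ∂Pr) + (M.rmax + 3 * ‖θs‖) ^ 2 / 4 ≤ beta1 Pr θ₀ M.rmax θs := by
  have hr := M.rmax_nonneg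
  have h1 : ∫ _, (M.rmax + 2 * ‖θs‖) ^ 2 ∂Pr ≤ ∫ ω, (‖θ₀ ω‖ + M.rmax + 2 * ‖θs‖) ^ 2 ∂Pr := by
    refine integral_mono (integrable_const _) ?_ fun ω => ?_
    · have h2 : MemLp (fun ω => ‖θ₀ ω‖ + M.rmax + 2 * ‖θs‖) 2 Pr :=
        (hθ₀.norm.add (memLp_const _)).add (memLp_const _)
      exact h2.integrable_sq
    · exact pow_le_pow_left₀ (by positivity) (by linarith [norm_nonneg (θ₀ ω)]) 2
  rw [integral_const, probReal_univ, one_smul] at h1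
  rw [beta1]
  -- The expectation in β₁ is thus at least 4/9 of (r_max + 3‖θ*‖)², and 2 · 4/9 exceeds 1/4.
  have h2 : (M.rmax + 3 * ‖θs‖) ^ 2 ≤ (3 / 2 * (M.rmax + 2 * ‖θs‖)) ^ 2 :=
    pow_le_pow_left₀ (by positivity) (by linarith [norm_nonneg θs]) 2
  have h3 := sq_nonneg (M.rmax + 2 * ‖θs‖)
  linarith

variable [MeasurableSpace S] [DiscreteMeasurableSpace S] [DecidableEq S]

/-- The mean square error is controlled by any supersolution of the scalar recursion. -/
lemma meanSquareLE_of_supersolution (hd : 0 < d) (hη : 0 < M.eta μ)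
    (hμ : IsStationaryDist M.P μ) (hmix : IsMixing M.P μ C β) (hθs : M.IsFixedPoint μ θs)
    (h : IsDoubleChain M.P Pr s sHat θ₀) (ha : 0 < a) (hξ0 : 0 < ξ) (hξ : ξ ≤ 1)
    (hc : minOffset a ξ (M.eta μ) C β ≤ c₀) {H v : ℕ → ℝ} (hH0 : H 0 = 1)
    (hH : ∀ t, (1 - M.eta μ * stepsize a c₀ ξ t) * H t ≤ H (t + 1)) (hv0 : 0 ≤ v 0)
    (hv : ∀ t, (1 - M.eta μ * stepsize a c₀ ξ t) * v t + (60 * stepsize a c₀ ξ t ^ 2 +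
      8 * (stepsize a c₀ ξ t - stepsize a c₀ ξ (t + 1))) ≤ v (t + 1)) (T : ℕ) :
    MeanSquareLE Pr (fun ω => M.iterate (stepsize a c₀ ξ) s sHat θ₀ T ω - θs)
      ((2 * (∫ ω, ‖θ₀ ω - θs‖ ^ 2 ∂Pr) + (M.rmax + 3 * ‖θs‖) ^ 2 / 4) * H T +
        16 * (L1 C β * (M.rmax + 3 * ‖θs‖) ^ 2) * (v T + 2 * stepsize a c₀ ξ T)) := by
  have hc0 : 0 < c₀ := (minOffset_pos _ _ _ _ _).trans_le hc
  have hη2 : M.eta μ ≤ 2 := eta_le_two hd hμ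
  have hL := one_le_L1 C β
  have hα0 : ∀ t, 0 < stepsize a c₀ ξ t := stepsize_pos ha hc0
  have hαL := stepsize_mul_L1_le ha hξ0 hη hc
  have hxL := L1_div_le hη hc
  have hαle : ∀ t, stepsize a c₀ ξ t ≤ stepsize a c₀ ξ t * L1 C β := fun t =>
    le_mul_of_one_le_right (hα0 t).le hL
  obtain ⟨W, hW, hWE⟩ := M.exists_lyapunov (α := stepsize a c₀ ξ) hd hη.le hμ hmix hθs h
    (fun t => (hα0 t).le) (stepsize_succ_le ha hc0 hξ0.le)
    (fun t => by linarith [hαL t, hαle t]) (fun t => by linarith [hαL t])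
    -- Both α_t L₁ and L₁/(t + c₀) are at most η/2048, so the left side is at most (1008 +
    -- 144)ηα_t/2048, below 3/4 of ηα_t.
    (fun t => by
      have h1 := mul_le_mul_of_nonneg_right (stepsize_sub_succ_le ha hc0 hξ t)
        (zero_le_one.trans hL)
      have h2 := mul_le_mul_of_nonneg_left (hαL t) (hα0 t).le
      have h3 := mul_le_mul_of_nonneg_left (hxL t) (hα0 t).le
      have h4 : stepsize a c₀ ξ t / (t + c₀) * L1 C β =
        stepsize a c₀ ξ t * (L1 C β / (t + c₀)) := by ring
      rw [h4] at h1
      generalize L1 C β / ((t : ℝ) + c₀) = y at *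
      have h5 := mul_pos hη (hα0 t)
      linarith)
  have hG := sq_nonneg (M.rmax + 3 * ‖θs‖)
  set G2 := (M.rmax + 3 * ‖θs‖) ^ 2
  set E : ℕ → ℝ := fun t => ∫ ω, ‖M.iterate (stepsize a c₀ ξ) s sHat θ₀ t ω - θs‖ ^ 2 ∂Pr with hE
  have hE0 : ∀ t, 0 ≤ E t := fun t => integral_nonneg fun _ => sq_nonneg _
  have hEinit : ∫ ω, ‖θ₀ ω - θs‖ ^ 2 ∂Pr = E 0 := rfl
  -- The correction is at most E/8 plus a multiple of the stepsize. Bounds thus pass from E to W at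
  -- time 0 and back from W to E at time T.
  have hbd : ∀ t, |W t - E t| ≤ 1 / 8 * E t + 16 * (L1 C β * G2) * stepsize a c₀ ξ t := fun t => by
    have h1 := hWE t
    have h2 : 64 * (stepsize a c₀ ξ t * L1 C β) * E t ≤ 1 / 8 * E t :=
      mul_le_mul_of_nonneg_right (by linarith [hαL t]) (hE0 t)
    have h3 : 2 * (stepsize a c₀ ξ t * (8 * L1 C β)) * (G2 + 4 * E t) =
      16 * (L1 C β * G2) * stepsize a c₀ ξ t + 64 * (stepsize a c₀ ξ t * L1 C β) * E t := by ring
    linarith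
  have hW0 : W 0 ≤ 9 / 8 * E 0 + G2 / 32 := by
    have h1 := (abs_le.1 (hbd 0)).2
    have h2 : stepsize a c₀ ξ 0 * L1 C β * G2 ≤ 2 / 2048 * G2 :=
      mul_le_mul_of_nonneg_right (by linarith [hαL 0]) hG
    linarith
  have hρ : ∀ t, 0 ≤ 1 - M.eta μ * stepsize a c₀ ξ t := fun t => by
    have h1 := mul_le_mul_of_nonneg_right hη2 (hα0 t).le
    linarith [hαL t, hαle t]
  have hWT := le_of_recursion (B := G2 * (8 * L1 C β)) (w := 9 / 8 * E 0 + G2 / 32) hρ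
    (by positivity) (by have := hE0 0; positivity) hW hW0 hH0 hH hv0 hv T
  have hHnn : ∀ t, 0 ≤ H t := fun t => by
    induction t with
    | zero => rw [hH0]; norm_num
    | succ t ih => exact (mul_nonneg (hρ t) ih).trans (hH t)
  have hvnn : ∀ t, 0 ≤ v t := fun t => by
    induction t with
    | zero => exact hv0
    | succ t ih =>
      have h1 := mul_nonneg (hρ t) ih
      have h2 := stepsize_succ_le (ξ := ξ) ha hc0 hξ0.le t
      have h3 := hv t
      have h4 := sq_nonneg (stepsize a c₀ ξ t)
      linarith
  refine ⟨(M.memLp_iterate h.chain.1 h.chainHat.1 h.measurable_init h.memLp_init T).sub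
    (memLp_const θs), ?_⟩
  change E T ≤ _
  rw [hEinit]
  -- Solving for E costs the factor 8/7; all coefficients of the claim are rounded up from there.
  have h1 := (abs_le.1 (hbd T)).1
  have h2 := mul_nonneg (hE0 0) (hHnn T)
  have h3 := mul_nonneg hG (hHnn T)
  have h4 : 0 ≤ L1 C β * G2 := by positivity
  have h5 := mul_nonneg h4 (hvnn T)
  have h6 := mul_nonneg h4 (hα0 T).le
  linarith

end PolicyEvaluation

lemma MeanSquareLE.mono {Ω : Type*} [MeasurableSpace Ω] {d : ℕ} {Pr : Measure Ω}
    {X : Ω → EuclideanSpace ℝ (Fin d)} {b b' : ℝ} (h : MeanSquareLE Pr X b) (hb : b ≤ b') :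
    MeanSquareLE Pr X b' :=
  ⟨h.1, h.2.trans hb⟩

section Scalar

variable {a c₀ ξ η : ℝ}

lemma cast_succ_add (t : ℕ) (c : ℝ) : ((t + 1 : ℕ) : ℝ) + c = t + c + 1 := by push_cast; ring

lemma one_sub_mul_rpow_le (ha : 0 < a) (hη : 0 < η) (hc : 0 < c₀) (t : ℕ) :
    (1 - η * stepsize a c₀ 1 t) * (c₀ / (t + c₀)) ^ (a * η) ≤
      (c₀ / (((t + 1 : ℕ) : ℝ) + c₀)) ^ (a * η) := by
  have hx : 0 < (t : ℝ) + c₀ := by positivity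
  rw [stepsize_one, cast_succ_add]
  have h1 : c₀ / ((t : ℝ) + c₀ + 1) = (t + c₀) / (t + c₀ + 1) * (c₀ / (t + c₀)) := by field_simp
  rw [h1, Real.mul_rpow (by positivity) (by positivity)]
  refine mul_le_mul_of_nonneg_right ?_ (by positivity)
  refine le_trans (le_of_eq ?_) (one_sub_div_le_rpow (by positivity) hx)
  ring

lemma one_sub_mul_exp_le (ha : 0 < a) (hη : 0 < η) (hc : 0 < c₀) (hξ0 : 0 < ξ) (hξ : ξ < 1) (t : ℕ) :
    (1 - η * stepsize a c₀ ξ t) *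
      Real.exp (-(η * a / (1 - ξ)) * (((t : ℝ) + c₀) ^ (1 - ξ) - c₀ ^ (1 - ξ))) ≤
      Real.exp (-(η * a / (1 - ξ)) * ((((t + 1 : ℕ) : ℝ) + c₀) ^ (1 - ξ) - c₀ ^ (1 - ξ))) := by
  have hx : 0 < (t : ℝ) + c₀ := by positivity
  have hξ' : 0 < 1 - ξ := by linarith
  have h1 := add_one_rpow_sub_le hξ0.le hξ.le hx
  have h2 := mul_le_mul_of_nonneg_left h1 (by positivity : 0 ≤ η * a / (1 - ξ))
  have h3 : η * a / (1 - ξ) * ((1 - ξ) / ((t : ℝ) + c₀) ^ ξ) = η * stepsize a c₀ ξ t := by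
    rw [stepsize]; field_simp
  rw [h3] at h2
  have h4 := Real.add_one_le_exp (-(η * stepsize a c₀ ξ t))
  rw [cast_succ_add]
  refine (mul_le_mul_of_nonneg_right (by linarith : _ ≤ Real.exp (-(η * stepsize a c₀ ξ t)))
    (Real.exp_pos _).le).trans ?_
  rw [← Real.exp_add, Real.exp_le_exp]
  linarith

lemma noise_le_of_eq_one (ha : 0 < a) (hc : 0 < c₀) (t : ℕ) :
    60 * stepsize a c₀ 1 t ^ 2 + 8 * (stepsize a c₀ 1 t - stepsize a c₀ 1 (t + 1)) ≤
      (60 * a ^ 2 + 8 * a) / ((t : ℝ) + c₀) ^ 2 := by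
  have h1 := stepsize_sub_succ_le ha hc le_rfl t
  have h2 : stepsize a c₀ 1 t / (t + c₀) = a / ((t : ℝ) + c₀) ^ 2 := by
    rw [stepsize_one, div_div, sq]
  have h3 : stepsize a c₀ 1 t ^ 2 = a ^ 2 / ((t : ℝ) + c₀) ^ 2 := by rw [stepsize_one, div_pow]
  have h4 : (60 * a ^ 2 + 8 * a) / ((t : ℝ) + c₀) ^ 2 =
    60 * (a ^ 2 / ((t : ℝ) + c₀) ^ 2) + 8 * (a / ((t : ℝ) + c₀) ^ 2) := by ring
  rw [h4, h3]
  linarith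

end Scalar

/-! ### Explicit bounds in the different regimes of ξ and aη. -/

namespace PolicyEvaluation

variable {S : Type*} {A : Type*} [Fintype S] [Fintype A] {d : ℕ} (M : PolicyEvaluation S A d)
  {Ω : Type*} [MeasurableSpace Ω] [MeasurableSpace S] [DiscreteMeasurableSpace S] [DecidableEq S]
  {μ : S → ℝ} {C β : ℝ} {θs : EuclideanSpace ℝ (Fin d)}
  {Pr : Measure Ω} [IsProbabilityMeasure Pr] {s sHat : ℕ → Ω → S}
  {θ₀ : Ω → EuclideanSpace ℝ (Fin d)} {a ξ c₀ : ℝ}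

lemma meanSquareLE_of_lt_one (hd : 0 < d) (hη : 0 < M.eta μ)
    (hμ : IsStationaryDist M.P μ) (hmix : IsMixing M.P μ C β) (hθs : M.IsFixedPoint μ θs)
    (h : IsDoubleChain M.P Pr s sHat θ₀) (ha : 0 < a) (hξ0 : 0 < ξ) (hξ : ξ < 1)
    (hc : minOffset a ξ (M.eta μ) C β ≤ c₀) (T : ℕ) :
    MeanSquareLE Pr (fun ω => M.iterate (stepsize a c₀ ξ) s sHat θ₀ T ω - θs)
      ((2 * (∫ ω, ‖θ₀ ω - θs‖ ^ 2 ∂Pr) + (M.rmax + 3 * ‖θs‖) ^ 2 / 4) *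
          Real.exp (-(M.eta μ * a / (1 - ξ)) * (((T : ℝ) + c₀) ^ (1 - ξ) - c₀ ^ (1 - ξ))) +
        2240 * L1 C β * (M.rmax + 3 * ‖θs‖) ^ 2 * (a / (M.eta μ * ((T : ℝ) + c₀) ^ ξ))) := by
  have hc0 : 0 < c₀ := (minOffset_pos _ _ _ _ _).trans_le hc
  have hη2 : M.eta μ ≤ 2 := eta_le_two hd hμ
  have hL := one_le_L1 C β
  have hα0 : ∀ t, 0 < stepsize a c₀ ξ t := stepsize_pos ha hc0
  refine (M.meanSquareLE_of_supersolution
    (H := fun t => Real.exp (-(M.eta μ * a / (1 - ξ)) *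
      (((t : ℝ) + c₀) ^ (1 - ξ) - c₀ ^ (1 - ξ))))
    -- The decrease of the stepsize is at most ηα²/2 ≤ α², so the noise is at most (60 + 8)α². With
    -- 2α ≤ 4α/η the total is 136 + 4 = 140, and 16 · 140 = 2240.
    (v := fun t => 2 * 68 * stepsize a c₀ ξ t / M.eta μ)
    hd hη hμ hmix hθs h ha hξ0 hξ.le hc (by simp)
    (one_sub_mul_exp_le ha hη hc0 hξ0 hξ)
    (div_nonneg (mul_nonneg (by norm_num) (hα0 0).le) hη.le) (fun t => ?_) T).mono ?_
  · have h1 := two_div_le_eta_mul_stepsize ha hξ hη hc t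
    have h2 := supersolution_stepsize (k := 68) ha hc0 hξ.le hη (by norm_num) t h1
    have h3 := stepsize_sub_succ_le ha hc0 hξ.le t
    have h4 := mul_le_mul_of_nonneg_right h1 (hα0 t).le
    have h5 := mul_le_mul_of_nonneg_right hη2 (sq_nonneg (stepsize a c₀ ξ t))
    have h6 : 2 / ((t : ℝ) + c₀) * stepsize a c₀ ξ t = 2 * (stepsize a c₀ ξ t / (t + c₀)) := by ring
    rw [h6] at h4
    generalize stepsize a c₀ ξ t / ((t : ℝ) + c₀) = y at *
    linarith
  · beta_reduce
    have h1 : a / (M.eta μ * ((T : ℝ) + c₀) ^ ξ) = stepsize a c₀ ξ T / M.eta μ := by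
      rw [stepsize, div_div, mul_comm]
    rw [h1]
    have h2 : stepsize a c₀ ξ T ≤ 2 * (stepsize a c₀ ξ T / M.eta μ) := by
      rw [← mul_div_assoc, le_div_iff₀ hη]
      have := mul_le_mul_of_nonneg_left hη2 (hα0 T).le
      linarith
    have h3 : 0 ≤ 16 * (L1 C β * (M.rmax + 3 * ‖θs‖) ^ 2) := by positivity
    have h4 : 2 * 68 * stepsize a c₀ ξ T / M.eta μ + 2 * stepsize a c₀ ξ T ≤
        140 * (stepsize a c₀ ξ T / M.eta μ) := by
      have : 2 * 68 * stepsize a c₀ ξ T / M.eta μ = 136 * (stepsize a c₀ ξ T / M.eta μ) := by ring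
      linarith
    have h5 := mul_le_mul_of_nonneg_left h4 h3
    linarith

/-- The bound for `ξ = 1` in terms of a supersolution of the scalar recursion. -/
lemma meanSquareLE_of_eq_one (hd : 0 < d) (hη : 0 < M.eta μ)
    (hμ : IsStationaryDist M.P μ) (hmix : IsMixing M.P μ C β) (hθs : M.IsFixedPoint μ θs)
    (h : IsDoubleChain M.P Pr s sHat θ₀) (ha : 0 < a)
    (hc : minOffset a 1 (M.eta μ) C β ≤ c₀) {v : ℝ → ℝ} (hv0 : 0 ≤ v c₀)
    (hv : ∀ x, c₀ ≤ x → (1 - a * M.eta μ / x) * v x + (60 * a ^ 2 + 8 * a) / x ^ 2 ≤ v (x + 1))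
    (T : ℕ) :
    MeanSquareLE Pr (fun ω => M.iterate (stepsize a c₀ 1) s sHat θ₀ T ω - θs)
      ((2 * (∫ ω, ‖θ₀ ω - θs‖ ^ 2 ∂Pr) + (M.rmax + 3 * ‖θs‖) ^ 2 / 4) *
          (c₀ / ((T : ℝ) + c₀)) ^ (a * M.eta μ) +
        16 * (L1 C β * (M.rmax + 3 * ‖θs‖) ^ 2) * (v (T + c₀) + 2 * a / (T + c₀))) := by
  have hc0 : 0 < c₀ := (minOffset_pos _ _ _ _ _).trans_le hc
  refine (M.meanSquareLE_of_supersolution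
    (H := fun t => (c₀ / ((t : ℝ) + c₀)) ^ (a * M.eta μ))
    (v := fun t => v (t + c₀))
    hd hη hμ hmix hθs h ha one_pos le_rfl hc (by simp [div_self hc0.ne'])
    (one_sub_mul_rpow_le ha hη hc0) (by simpa using hv0) (fun t => ?_) T).mono (le_of_eq ?_)
  · have h1 := noise_le_of_eq_one ha hc0 t
    have h2 := hv (t + c₀) (by linarith [Nat.cast_nonneg (α := ℝ) t])
    rw [cast_succ_add]
    have h3 : M.eta μ * stepsize a c₀ 1 t = a * M.eta μ / (t + c₀) := by
      rw [stepsize_one]; ring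
    rw [h3]
    linarith
  · beta_reduce
    rw [stepsize_one, mul_div_assoc 2 a]

lemma meanSquareLE_of_one_lt_mul (hd : 0 < d) (hη : 0 < M.eta μ)
    (hμ : IsStationaryDist M.P μ) (hmix : IsMixing M.P μ C β) (hθs : M.IsFixedPoint μ θs)
    (h : IsDoubleChain M.P Pr s sHat θ₀) (ha : 0 < a)
    (hc : minOffset a 1 (M.eta μ) C β ≤ c₀) (hm : 1 < a * M.eta μ) (T : ℕ) :
    MeanSquareLE Pr (fun ω => M.iterate (stepsize a c₀ 1) s sHat θ₀ T ω - θs)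
      ((2 * (∫ ω, ‖θ₀ ω - θs‖ ^ 2 ∂Pr) + (M.rmax + 3 * ‖θs‖) ^ 2 / 4) *
          (c₀ / ((T : ℝ) + c₀)) ^ (a * M.eta μ) +
        16 * (L1 C β * (M.rmax + 3 * ‖θs‖) ^ 2) *
          ((60 * a ^ 2 + 8 * a) / ((a * M.eta μ - 1) * (T + c₀)) + 2 * a / (T + c₀))) := by
  have hc0 : 0 < c₀ := (minOffset_pos _ _ _ _ _).trans_le hc
  have hm1 : 0 < a * M.eta μ - 1 := by linarith
  exact M.meanSquareLE_of_eq_one (v := fun x => (60 * a ^ 2 + 8 * a) / ((a * M.eta μ - 1) * x))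
    hd hη hμ hmix hθs h ha hc (by positivity)
    (fun x hx => supersolution_of_one_lt hm (by positivity) (hc0.trans_le hx)) T

/-- A bound uniform in aη ≥ 1, unlike the one with 1/(aη - 1). It is needed at aη = 1, and for the
sample complexity with ξ = 1, where aη may be arbitrarily close to 1. -/
lemma meanSquareLE_of_one_le_mul (hd : 0 < d) (hη : 0 < M.eta μ)
    (hμ : IsStationaryDist M.P μ) (hmix : IsMixing M.P μ C β) (hθs : M.IsFixedPoint μ θs)
    (h : IsDoubleChain M.P Pr s sHat θ₀) (ha : 0 < a)
    (hc : minOffset a 1 (M.eta μ) C β ≤ c₀) (hm : 1 ≤ a * M.eta μ) (T : ℕ) :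
    MeanSquareLE Pr (fun ω => M.iterate (stepsize a c₀ 1) s sHat θ₀ T ω - θs)
      ((2 * (∫ ω, ‖θ₀ ω - θs‖ ^ 2 ∂Pr) + (M.rmax + 3 * ‖θs‖) ^ 2 / 4) *
          (c₀ / ((T : ℝ) + c₀)) ^ (a * M.eta μ) +
        16 * (L1 C β * (M.rmax + 3 * ‖θs‖) ^ 2) *
          ((60 * a ^ 2 + 10 * a) * Real.log (T + c₀) / (T + c₀))) := by
  have hc8 := eight_le_of_minOffset_le hc
  have hlog : ∀ x, c₀ ≤ x → 1 ≤ Real.log x := fun x hx => by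
    rw [Real.le_log_iff_exp_le (by linarith)]
    linarith [Real.exp_one_lt_d9]
  refine (M.meanSquareLE_of_eq_one (v := fun x => (60 * a ^ 2 + 8 * a) * Real.log x / x)
    hd hη hμ hmix hθs h ha hc ?_
    (fun x hx => supersolution_log hm (by positivity) (hc8.trans hx)) T).mono ?_
  · have := hlog c₀ le_rfl
    positivity
  · have hx : c₀ ≤ (T : ℝ) + c₀ := by linarith [Nat.cast_nonneg (α := ℝ) T]
    have h1 := hlog _ hx
    have hL := one_le_L1 C β
    gcongr
    rw [← add_div]
    refine div_le_div_of_nonneg_right ?_ (by linarith)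
    have := mul_le_mul_of_nonneg_left h1 ha.le
    linarith

lemma meanSquareLE_of_mul_lt_one (hd : 0 < d) (hη : 0 < M.eta μ)
    (hμ : IsStationaryDist M.P μ) (hmix : IsMixing M.P μ C β) (hθs : M.IsFixedPoint μ θs)
    (h : IsDoubleChain M.P Pr s sHat θ₀) (ha : 0 < a)
    (hc : minOffset a 1 (M.eta μ) C β ≤ c₀) (hm : a * M.eta μ < 1) (T : ℕ) :
    MeanSquareLE Pr (fun ω => M.iterate (stepsize a c₀ 1) s sHat θ₀ T ω - θs)
      ((2 * (∫ ω, ‖θ₀ ω - θs‖ ^ 2 ∂Pr) + (M.rmax + 3 * ‖θs‖) ^ 2 / 4) *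
          (c₀ / ((T : ℝ) + c₀)) ^ (a * M.eta μ) +
        16 * (L1 C β * (M.rmax + 3 * ‖θs‖) ^ 2) *
          ((120 * a ^ 2 + 18 * a) / (1 - a * M.eta μ) / (T + c₀) ^ (a * M.eta μ))) := by
  have hc8 := eight_le_of_minOffset_le hc
  have hc0 : 0 < c₀ := by linarith
  have hm0 : 0 < a * M.eta μ := by positivity
  have hm1 : 0 < 1 - a * M.eta μ := by linarith
  have hpow : ∀ x, c₀ ≤ x → x⁻¹ ≤ x ^ (-(a * M.eta μ)) := fun x hx => by
    rw [← Real.rpow_neg_one]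
    exact Real.rpow_le_rpow_of_exponent_le (by linarith) (by linarith)
  refine (M.meanSquareLE_of_eq_one (v := fun x => 2 * (60 * a ^ 2 + 8 * a) / (1 - a * M.eta μ) *
      (x ^ (-(a * M.eta μ)) - x⁻¹))
    hd hη hμ hmix hθs h ha hc ?_
    (fun x hx => supersolution_of_lt_one hm0.le hm (by positivity) (hc0.trans_le hx)
      ((two_div_one_sub_le hc).trans hx)) T).mono ?_
  · exact mul_nonneg (by positivity) (sub_nonneg.2 (hpow c₀ le_rfl))
  · have hx : c₀ ≤ (T : ℝ) + c₀ := by linarith [Nat.cast_nonneg (α := ℝ) T]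
    have hL := one_le_L1 C β
    have hx0 : 0 < (T : ℝ) + c₀ := by linarith
    gcongr
    have h1 := hpow _ hx
    have h2 : (120 * a ^ 2 + 18 * a) / (1 - a * M.eta μ) / ((T : ℝ) + c₀) ^ (a * M.eta μ) =
        (120 * a ^ 2 + 18 * a) / (1 - a * M.eta μ) * ((T : ℝ) + c₀) ^ (-(a * M.eta μ)) := by
      rw [Real.rpow_neg hx0.le, div_eq_mul_inv _ (((T : ℝ) + c₀) ^ (a * M.eta μ))]
    have h3 : 2 * a / ((T : ℝ) + c₀) ≤
        2 * a / (1 - a * M.eta μ) * ((T : ℝ) + c₀) ^ (-(a * M.eta μ)) := by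
      rw [div_eq_mul_inv (2 * a)]
      refine mul_le_mul ?_ h1 (by positivity) (by positivity)
      rw [le_div_iff₀ hm1]
      have := mul_pos ha hm0
      linarith
    have h4 : 0 ≤ 2 * (60 * a ^ 2 + 8 * a) / (1 - a * M.eta μ) * ((T : ℝ) + c₀)⁻¹ := by positivity
    have h5 : (120 * a ^ 2 + 18 * a) / (1 - a * M.eta μ) =
      2 * (60 * a ^ 2 + 8 * a) / (1 - a * M.eta μ) + 2 * a / (1 - a * M.eta μ) := by ring
    rw [h2, h5]
    linarith

end PolicyEvaluation

/-! ### The error bounds in the stated form. -/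

namespace PolicyEvaluation

variable {S : Type*} {A : Type*} [Fintype S] [Fintype A] {d : ℕ} (M : PolicyEvaluation S A d)
  {Ω : Type*} [MeasurableSpace Ω] [MeasurableSpace S] [DiscreteMeasurableSpace S] [DecidableEq S]
  {μ : S → ℝ} {C β : ℝ} {θs : EuclideanSpace ℝ (Fin d)}
  {Pr : Measure Ω} [IsProbabilityMeasure Pr] {s sHat : ℕ → Ω → S}
  {θ₀ : Ω → EuclideanSpace ℝ (Fin d)} {a ξ c₀ : ℝ}

/-- The decay is counted from time 0, hence is at least as strong as the decay counted from any
later time τ. -/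
lemma meanSquareLE_error_bound_of_lt_one (hd : 0 < d) (hη : 0 < M.eta μ)
    (hμ : IsStationaryDist M.P μ) (hmix : IsMixing M.P μ C β) (hθs : M.IsFixedPoint μ θs)
    (h : IsDoubleChain M.P Pr s sHat θ₀) (ha : 0 < a) (hξ0 : 0 < ξ) (hξ : ξ < 1)
    (hc : minOffset a ξ (M.eta μ) C β ≤ c₀) (T τ : ℕ) :
    MeanSquareLE Pr (fun ω => M.iterate (stepsize a c₀ ξ) s sHat θ₀ T ω - θs)
      (beta1 Pr θ₀ M.rmax θs *
          Real.exp (-(M.eta μ * a / (1 - ξ)) * (((T : ℝ) + c₀) ^ (1 - ξ) -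
            ((τ : ℝ) + c₀) ^ (1 - ξ))) +
        2240 * L1 C β * (M.rmax + 3 * ‖θs‖) ^ 2 * (a / (M.eta μ * ((T : ℝ) + c₀) ^ ξ))) := by
  have hc0 : 0 < c₀ := (minOffset_pos _ _ _ _ _).trans_le hc
  refine (M.meanSquareLE_of_lt_one hd hη hμ hmix hθs h ha hξ0 hξ hc T).mono ?_
  have hξ' : 0 < 1 - ξ := by linarith
  refine add_le_add_left (mul_le_mul (M.beta1_ge h.memLp_init) ?_ (Real.exp_pos _).le ?_) _
  · rw [Real.exp_le_exp]
    have h1 : c₀ ^ (1 - ξ) ≤ ((τ : ℝ) + c₀) ^ (1 - ξ) :=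
      Real.rpow_le_rpow hc0.le (by linarith [Nat.cast_nonneg (α := ℝ) τ]) hξ'.le
    have h2 := mul_le_mul_of_nonneg_left h1 (by positivity : 0 ≤ M.eta μ * a / (1 - ξ))
    linarith
  · rw [beta1]
    have h1 : 0 ≤ ∫ ω, (‖θ₀ ω‖ + M.rmax + 2 * ‖θs‖) ^ 2 ∂Pr := integral_nonneg fun _ => sq_nonneg _
    have h2 : 0 ≤ ∫ ω, ‖θ₀ ω - θs‖ ^ 2 ∂Pr := integral_nonneg fun _ => sq_nonneg _
    linarith

/-- A weakening of the bound without logarithm: the logarithmic factor is at least 1 and 2240 ≤ 4 ·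
946. -/
lemma meanSquareLE_log_error_bound_of_lt_one (hd : 0 < d) (hη : 0 < M.eta μ)
    (hμ : IsStationaryDist M.P μ) (hmix : IsMixing M.P μ C β) (hθs : M.IsFixedPoint μ θs)
    (h : IsDoubleChain M.P Pr s sHat θ₀) (ha : 0 < a) (hξ0 : 0 < ξ) (hξ : ξ < 1)
    (hc : minOffset a ξ (M.eta μ) C β ≤ c₀) (T τ : ℕ) :
    MeanSquareLE Pr (fun ω => M.iterate (stepsize a c₀ ξ) s sHat θ₀ T ω - θs)
      (beta1 Pr θ₀ M.rmax θs *
          Real.exp (-(M.eta μ * a / (1 - ξ)) * (((T : ℝ) + c₀) ^ (1 - ξ) -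
            ((τ : ℝ) + c₀) ^ (1 - ξ))) +
        2 * a * betaTilde a c₀ (L1 C β) (beta2 M.rmax θs) T /
          (M.eta μ * ((T : ℝ) + c₀) ^ ξ)) := by
  have hc0 : 0 < c₀ := (minOffset_pos _ _ _ _ _).trans_le hc
  refine (M.meanSquareLE_error_bound_of_lt_one hd hη hμ hmix hθs h ha hξ0 hξ hc T τ).mono ?_
  have h1 := one_add_inv_le_log ha hc T
  have h2 : 0 < 1 / a := by positivity
  have hL := one_le_L1 C β
  have h3 : 0 ≤ L1 C β * (M.rmax + 3 * ‖θs‖) ^ 2 := by positivity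
  have h4 : 2240 * (L1 C β * (M.rmax + 3 * ‖θs‖) ^ 2) ≤
      2 * betaTilde a c₀ (L1 C β) (beta2 M.rmax θs) T := by
    rw [betaTilde, beta2]
    have := mul_le_mul_of_nonneg_left h1 h3
    have := mul_nonneg h3 h2.le
    linarith
  have h5 := mul_le_mul_of_nonneg_right h4
    (by positivity : 0 ≤ a / (M.eta μ * ((T : ℝ) + c₀) ^ ξ))
  have h6 : 2 * a * betaTilde a c₀ (L1 C β) (beta2 M.rmax θs) T /
      (M.eta μ * ((T : ℝ) + c₀) ^ ξ) = 2 * betaTilde a c₀ (L1 C β) (beta2 M.rmax θs) T *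
      (a / (M.eta μ * ((T : ℝ) + c₀) ^ ξ)) := by ring
  rw [h6]
  linarith

lemma meanSquareLE_error_bound_of_eq_one (hd : 0 < d) (hη : 0 < M.eta μ)
    (hμ : IsStationaryDist M.P μ) (hmix : IsMixing M.P μ C β) (hθs : M.IsFixedPoint μ θs)
    (h : IsDoubleChain M.P Pr s sHat θ₀) (ha : 0 < a)
    (hc : minOffset a 1 (M.eta μ) C β ≤ c₀) (T τ : ℕ) :
    MeanSquareLE Pr (fun ω => M.iterate (stepsize a c₀ 1) s sHat θ₀ T ω - θs)
      (beta1 Pr θ₀ M.rmax θs * (((τ : ℝ) + c₀) / ((T : ℝ) + c₀)) ^ (a * M.eta μ) +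
        Gam a c₀ (M.eta μ) (L1 C β) (beta2 M.rmax θs) T /
          ((T : ℝ) + c₀) ^ (min 1 (a * M.eta μ))) := by
  have hc0 : 0 < c₀ := (minOffset_pos _ _ _ _ _).trans_le hc
  have hη2 : M.eta μ ≤ 2 := eta_le_two hd hμ
  have hm0 : 0 < a * M.eta μ := by positivity
  have hx : 0 < (T : ℝ) + c₀ := by positivity
  have hL := one_le_L1 C β
  set ℓ := Real.log ((T : ℝ) + c₀) - Real.log a + 1 with hℓ
  have hℓ' : a ^ 2 + a ≤ a ^ 2 * ℓ := by
    have h1 := mul_le_mul_of_nonneg_left (one_add_inv_le_log ha hc T) (sq_nonneg a)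
    have h2 : a ^ 2 * (1 + 1 / a) = a ^ 2 + a := by field_simp
    linarith
  have hN : 0 ≤ L1 C β * (M.rmax + 3 * ‖θs‖) ^ 2 := by positivity
  have hbt : betaTilde a c₀ (L1 C β) (beta2 M.rmax θs) T =
      1892 * (L1 C β * (M.rmax + 3 * ‖θs‖) ^ 2) * ℓ := by
    rw [betaTilde, beta2]; ring
  have hfirst : (2 * (∫ ω, ‖θ₀ ω - θs‖ ^ 2 ∂Pr) + (M.rmax + 3 * ‖θs‖) ^ 2 / 4) *
      (c₀ / ((T : ℝ) + c₀)) ^ (a * M.eta μ) ≤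
      beta1 Pr θ₀ M.rmax θs * (((τ : ℝ) + c₀) / ((T : ℝ) + c₀)) ^ (a * M.eta μ) := by
    have h0 : 0 ≤ ∫ ω, ‖θ₀ ω - θs‖ ^ 2 ∂Pr := integral_nonneg fun _ => sq_nonneg _
    have h1 := M.beta1_ge (θs := θs) h.memLp_init
    refine mul_le_mul h1 ?_ (by positivity) (le_trans (by positivity) h1)
    refine Real.rpow_le_rpow (by positivity) ?_ hm0.le
    refine div_le_div_of_nonneg_right ?_ hx.le
    linarith [Nat.cast_nonneg (α := ℝ) τ]
  have hmul : ∀ p q y : ℝ, p ≤ q → 0 ≤ y → L1 C β * (M.rmax + 3 * ‖θs‖) ^ 2 * p * y ≤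
      L1 C β * (M.rmax + 3 * ‖θs‖) ^ 2 * q * y := fun p q y hpq hy =>
    mul_le_mul_of_nonneg_right (mul_le_mul_of_nonneg_left hpq hN) hy
  have ha2 := sq_nonneg a
  rcases lt_trichotomy (a * M.eta μ) 1 with hm | hm | hm
  · refine (M.meanSquareLE_of_mul_lt_one hd hη hμ hmix hθs h ha hc hm T).mono
      (add_le_add hfirst ?_)
    rw [Gam, if_pos hm, hbt, min_eq_right hm.le]
    have h1 := hmul (16 * (120 * a ^ 2 + 18 * a)) (7568 * (a ^ 2 * ℓ))
      (1 / (1 - a * M.eta μ) / ((T : ℝ) + c₀) ^ (a * M.eta μ)) (by linarith) (by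
        have : 0 < 1 - a * M.eta μ := by linarith
        positivity)
    refine (le_of_eq ?_).trans (h1.trans (le_of_eq ?_)) <;> ring
  · refine (M.meanSquareLE_of_one_le_mul hd hη hμ hmix hθs h ha hc hm.ge T).mono
      (add_le_add hfirst ?_)
    rw [Gam, if_neg hm.not_lt, if_pos hm, hbt, min_eq_left hm.ge, Real.rpow_one]
    have h1 := hmul (16 * (60 * a ^ 2 + 10 * a)) (7568 * (a ^ 2 * ℓ))
      (Real.log ((T : ℝ) + c₀) / ((T : ℝ) + c₀)) (by linarith) (by
        have := Real.log_nonneg (x := (T : ℝ) + c₀)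
          (by linarith [eight_le_of_minOffset_le hc, Nat.cast_nonneg (α := ℝ) T])
        positivity)
    refine (le_of_eq ?_).trans (h1.trans (le_of_eq ?_)) <;> ring
  · refine (M.meanSquareLE_of_one_lt_mul hd hη hμ hmix hθs h ha hc hm T).mono
      (add_le_add hfirst ?_)
    rw [Gam, if_neg hm.not_gt, if_neg hm.ne', hbt, min_eq_left hm.le, Real.rpow_one]
    have hm1 : 0 < a * M.eta μ - 1 := by linarith
    -- As aη - 1 ≤ 2a, the stepsize term is absorbed into the supersolution, and 60a² becomes 64a².
    have h0 : 2 * a / ((T : ℝ) + c₀) ≤ 4 * a ^ 2 / ((a * M.eta μ - 1) * (T + c₀)) := by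
      rw [div_le_div_iff₀ hx (by positivity)]
      have h2 : 2 * a * (a * M.eta μ - 1) ≤ 4 * a ^ 2 := by
        have := mul_le_mul_of_nonneg_left hη2 ha2
        linarith
      have := mul_le_mul_of_nonneg_right h2 hx.le
      linarith
    have h1 := hmul (16 * (64 * a ^ 2 + 8 * a)) (7568 * Real.exp 1 * (a ^ 2 * ℓ))
      (1 / ((a * M.eta μ - 1) * (T + c₀))) (by
        have h2 : 7568 * 1 * (a ^ 2 * ℓ) ≤ 7568 * Real.exp 1 * (a ^ 2 * ℓ) :=
          mul_le_mul_of_nonneg_right (by linarith [Real.one_le_exp zero_le_one]) (by linarith)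
        linarith) (by positivity)
    have h3 := mul_le_mul_of_nonneg_left h0 (mul_nonneg (by norm_num : (0 : ℝ) ≤ 16) hN)
    refine le_trans ?_ (h1.trans (le_of_eq ?_))
    · rw [mul_add]
      refine (add_le_add_right h3 _).trans (le_of_eq ?_)
      ring
    · field_simp
      ring

end PolicyEvaluation

/-! ### Sample complexity for a = Θ(1/η). -/

section SampleComplexity

variable {ξ κ₁ κ₂ : ℝ}

lemma one_le_mul_rpow_neg {η : ℝ} (hξ0 : 0 < ξ) (hη : 0 < η) (hη2 : η ≤ 2) :
    1 ≤ 2 ^ (2 / ξ) * η ^ (-2 / ξ) := by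
  have h : (2 : ℝ) ^ (2 / ξ) * η ^ (-2 / ξ) = (2 / η) ^ (2 / ξ) := by
    rw [Real.div_rpow zero_le_two hη.le, neg_div, Real.rpow_neg hη.le]
    exact (div_eq_mul_inv _ _).symm
  rw [h]
  exact Real.one_le_rpow (by rw [le_div_iff₀ hη]; linarith) (by positivity)

lemma inv_le_mul_rpow_neg {η : ℝ} (hξ0 : 0 < ξ) (hξ : ξ ≤ 1) (hη : 0 < η) (hη2 : η ≤ 2) :
    1 / η ≤ 2 ^ (2 / ξ) * η ^ (-2 / ξ) := by
  have h : (2 : ℝ) ^ (2 / ξ) * η ^ (-2 / ξ) = (2 / η) ^ (2 / ξ) := by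
    rw [Real.div_rpow zero_le_two hη.le, neg_div, Real.rpow_neg hη.le]
    exact (div_eq_mul_inv _ _).symm
  have h1 : 1 ≤ 2 / η := by rw [le_div_iff₀ hη]; linarith
  have h2 : (1 : ℝ) ≤ 2 / ξ := by rw [le_div_iff₀ hξ0]; linarith
  rw [h]
  calc 1 / η ≤ 2 / η := by gcongr; norm_num
    _ = (2 / η) ^ (1 : ℝ) := (Real.rpow_one _).symm
    _ ≤ (2 / η) ^ (2 / ξ) := Real.rpow_le_rpow_of_exponent_le h1 h2

/-- For `a = Θ(1/η)` the required offset is `O(L₁^{1/ξ} η^{-2/ξ})`. -/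
lemma exists_minOffset_le (hξ0 : 0 < ξ) (hξ : ξ ≤ 1) (hκ₁ : 0 < κ₁) (hκ : κ₁ ≤ κ₂)
    (hκ' : ξ = 1 → 1 ≤ κ₁) :
    ∃ K : ℝ, 0 < K ∧ ∀ a η C β : ℝ, 0 < η → η ≤ 2 → κ₁ / η ≤ a → a ≤ κ₂ / η →
      minOffset a ξ η C β ≤ K * (L1 C β ^ (1 / ξ) * η ^ (-2 / ξ)) := by
  have hκ₂ : 0 < κ₂ := hκ₁.trans_le hκ
  set h : ℝ := 2 ^ (2 / ξ) with hh
  have hh0 : 0 < h := by positivity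
  set k₁ := (2048 * κ₂) ^ (1 / ξ)
  set k₂ := (2 / κ₁) ^ (1 / (1 - ξ))
  have hk₁ : 0 < k₁ := by positivity
  have hk₂ : 0 < k₂ := by positivity
  -- One summand for each entry of the maximum that can be positive; `h` pays for η ≤ 2 when an
  -- entry of lower order in 1/η is compared with η^(-2/ξ).
  refine ⟨8 * h + k₁ + 2048 * h + k₂ * h + κ₂ * Real.exp (2 / κ₁) * h, by positivity,
    fun a η C β hη hη2 ha₁ ha₂ => ?_⟩
  have ha : 0 < a := (div_pos hκ₁ hη).trans_le ha₁
  rw [div_le_iff₀ hη] at ha₁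
  have ha₂' : a * η ≤ κ₂ := (le_div_iff₀ hη).1 ha₂
  have hL := one_le_L1 C β
  rw [minOffset]
  generalize L1 C β = L at *
  set D := L ^ (1 / ξ) * η ^ (-2 / ξ) with hD
  have hξ1 : 1 ≤ 1 / ξ := by rw [le_div_iff₀ hξ0]; linarith
  have hLξ : L ≤ L ^ (1 / ξ) := by
    conv_lhs => rw [← Real.rpow_one L]
    exact Real.rpow_le_rpow_of_exponent_le hL hξ1
  have hηp : 0 < η ^ (-2 / ξ) := Real.rpow_pos_of_pos hη _
  have hLD : L * (h * η ^ (-2 / ξ)) ≤ h * D := by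
    have := mul_le_mul_of_nonneg_right hLξ (mul_pos hh0 hηp).le
    calc _ ≤ _ := this
      _ = h * D := by rw [hD]; ring
  have h1D : 1 ≤ h * D := by
    have h1 := one_le_mul_rpow_neg hξ0 hη hη2
    have h2 := mul_le_mul hL h1 zero_le_one (zero_le_one.trans hL)
    linarith
  have h2D : L / η ≤ h * D := by
    have h1 := mul_le_mul_of_nonneg_left (inv_le_mul_rpow_neg hξ0 hξ hη hη2) (zero_le_one.trans hL)
    rw [mul_one_div] at h1
    exact h1.trans hLD
  have h3D : 1 / η ≤ h * D := le_trans (by gcongr) h2D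
  have hD0 : 0 < D := by positivity
  have b1 : (2048 * a * L / η) ^ (1 / ξ) ≤ k₁ * D := by
    have h1 : 2048 * a * L / η ≤ (2048 * κ₂) * L * η ^ (-2 : ℝ) := by
      have h2 : η ^ (-2 : ℝ) = 1 / η ^ 2 := by
        rw [Real.rpow_neg hη.le, Real.rpow_two, one_div]
      rw [h2, mul_one_div, div_le_div_iff₀ hη (by positivity)]
      have h3 := mul_le_mul_of_nonneg_left ha₂' (by positivity : 0 ≤ 2048 * L * η)
      linarith
    refine (Real.rpow_le_rpow (by positivity) h1 (by positivity)).trans_eq ?_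
    rw [Real.mul_rpow (by positivity) (by positivity), Real.mul_rpow (by positivity) (by positivity),
      ← Real.rpow_mul hη.le, hD, mul_one_div, mul_assoc]
  have b2 : (2 / (a * η)) ^ (1 / (1 - ξ)) ≤ k₂ := by
    refine Real.rpow_le_rpow (by positivity) (by gcongr) ?_
    exact one_div_nonneg.2 (by linarith)
  have b3 : a * Real.exp (1 / a) ≤ κ₂ * Real.exp (2 / κ₁) * (1 / η) := by
    have h1 : 1 / a ≤ 2 / κ₁ := by
      rw [div_le_div_iff₀ ha hκ₁]
      have := mul_le_mul_of_nonneg_left hη2 ha.le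
      linarith
    calc a * Real.exp (1 / a) ≤ κ₂ / η * Real.exp (2 / κ₁) := by gcongr
      _ = _ := by ring
  have b3' := mul_le_mul_of_nonneg_left h3D (by positivity : 0 ≤ κ₂ * Real.exp (2 / κ₁))
  have b2' := mul_le_mul_of_nonneg_left h1D hk₂.le
  have p1 : 0 < h * D := by positivity
  have p2 : 0 < k₁ * D := by positivity
  have p3 : 0 < k₂ * (h * D) := by positivity
  have p4 : 0 < κ₂ * Real.exp (2 / κ₁) * (h * D) := by positivity
  -- For ξ = 1 one has aη ≥ κ₁ ≥ 1, so the entry that would blow up as aη approaches 1 from below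
  -- does not occur.
  have b4 : (if ξ = 1 then 2 / (1 - a * η) else 0) ≤ 0 := by
    split_ifs with h1
    · exact div_nonpos_of_nonneg_of_nonpos zero_le_two (by linarith [hκ' h1])
    · exact le_rfl
  have b5 : 2048 * L / η = 2048 * (L / η) := by ring
  have e : (8 * h + k₁ + 2048 * h + k₂ * h + κ₂ * Real.exp (2 / κ₁) * h) * D =
    8 * (h * D) + k₁ * D + 2048 * (h * D) + k₂ * (h * D) + κ₂ * Real.exp (2 / κ₁) * (h * D) := by
    ring
  rw [e]
  refine max_le (max_le (max_le ?_ (b1.trans ?_)) (max_le ?_ (b2.trans ?_)))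
    (max_le (b3.trans ?_) (b4.trans ?_)) <;> linarith

/-- Put y = √(kT). Then T ≥ y L₁ and y ≥ 1, so T log(1/β) ≥ y (log C + 1) ≥ log C + y. Hence C β^T ≤
e^(-y) ≤ 2/y² = 2/(kT) ≤ κ/(4T). -/
lemma mul_pow_le_div {C β k κ : ℝ} {T : ℕ} (hC : 1 < C) (hβ0 : 0 ≤ β) (hβ1 : β < 1)
    (hκ : 0 < κ) (hk : 1 ≤ k) (hkκ : 8 / κ ≤ k) (hT0 : 1 ≤ (T : ℝ)) (hT : k * L1 C β ^ 2 ≤ T) :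
    C * β ^ T ≤ κ / (4 * T) := by
  rcases hβ0.eq_or_lt with rfl | hβ0
  · have : T ≠ 0 := by rintro rfl; norm_num at hT0
    rw [zero_pow this, mul_zero]
    positivity
  have hL := one_le_L1 C β
  have hlog := log_add_one_le_L1_mul (C := C) hβ0 hβ1
  have hlogC := Real.log_pos hC
  have hℓ : 0 < Real.log (1 / β) := Real.log_pos (by rw [lt_div_iff₀ hβ0]; linarith)
  set y := √(k * T) with hy
  have hy2 : y ^ 2 = k * T := Real.sq_sqrt (by positivity)
  have hy1 : 1 ≤ y := by
    rw [hy, Real.one_le_sqrt]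
    calc (1 : ℝ) = 1 * 1 := by ring
      _ ≤ k * T := mul_le_mul hk hT0 zero_le_one (by linarith)
  have hyT : y * L1 C β ≤ T := by
    refine (pow_le_pow_iff_left₀ (by positivity) (by positivity) two_ne_zero).1 ?_
    rw [mul_pow, hy2]
    have := mul_le_mul_of_nonneg_right hT (by positivity : (0 : ℝ) ≤ T)
    linarith
  have h1 : Real.log C + y ≤ T * Real.log (1 / β) := by
    have h2 := mul_le_mul_of_nonneg_right hyT hℓ.le
    have h3 := mul_le_mul_of_nonneg_left hlog (by linarith : 0 ≤ y)
    have h4 := mul_le_mul_of_nonneg_right hy1 hlogC.le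
    linarith
  have h2 : C * β ^ T ≤ Real.exp (-y) := by
    have hC0 : 0 < C := by linarith
    rw [← Real.log_le_iff_le_exp (by positivity), Real.log_mul hC0.ne' (by positivity),
      Real.log_pow]
    rw [one_div, Real.log_inv] at h1
    linarith
  have h3 : y ^ 2 / 2 ≤ Real.exp y := by
    have := Real.quadratic_le_exp_of_nonneg (x := y) (by linarith)
    linarith
  refine h2.trans ?_
  rw [Real.exp_neg, inv_le_comm₀ (Real.exp_pos _) (by positivity), inv_div]
  refine le_trans ?_ h3
  rw [hy2, div_le_div_iff₀ hκ zero_lt_two]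
  rw [div_le_iff₀ hκ] at hkκ
  have := mul_le_mul_of_nonneg_right hkκ (by positivity : (0 : ℝ) ≤ T)
  linarith

/-- With c₀ ≤ T and η ≤ 2 the last stepsize is at least (κ₁/2)/(2T), which C β^T has already
reached. -/
lemma tauMix_le {a η C β c₀ k : ℝ} {T : ℕ} (hξ : ξ ≤ 1) (hκ₁ : 0 < κ₁) (hη : 0 < η)
    (hη2 : η ≤ 2) (ha : κ₁ / η ≤ a) (hC : 1 < C) (hβ0 : 0 ≤ β) (hβ1 : β < 1) (hk : 1 ≤ k)
    (hkκ : 8 / κ₁ ≤ k) (hT0 : 1 ≤ (T : ℝ)) (hT : k * L1 C β ^ 2 ≤ T) (hc0 : 0 < c₀) (hc : c₀ ≤ T) :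
    tauMix C β (stepsize a c₀ ξ T) ≤ T := by
  refine Nat.sInf_le ((mul_pow_le_div hC hβ0 hβ1 hκ₁ hk hkκ hT0 hT).trans ?_)
  rw [stepsize]
  have h1 : κ₁ / 2 ≤ a := le_trans (by gcongr) ha
  have h2 : ((T : ℝ) + c₀) ^ ξ ≤ 2 * T := by
    calc ((T : ℝ) + c₀) ^ ξ ≤ ((T : ℝ) + c₀) ^ (1 : ℝ) :=
          Real.rpow_le_rpow_of_exponent_le (by linarith) hξ
      _ ≤ 2 * T := by rw [Real.rpow_one]; linarith
  have hp : 0 < ((T : ℝ) + c₀) ^ ξ := Real.rpow_pos_of_pos (by linarith) _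
  calc κ₁ / (4 * T) = κ₁ / 2 / (2 * T) := by rw [div_div]; ring_nf
    _ ≤ a / ((T : ℝ) + c₀) ^ ξ := div_le_div₀ (by linarith [div_pos hκ₁ two_pos]) h1 hp h2

/-- For r = ξ/(1 - ξ) one has e^u ≥ (u/r)^r, and this r turns x^(1-ξ) into x^ξ. The initial error
then decays at least as fast as the noise term. -/
lemma exp_neg_mul_rpow_le {γ x : ℝ} (hξ0 : 0 < ξ) (hξ : ξ < 1) (hγ : 0 < γ) (hx : 0 < x) :
    Real.exp (-(γ * x ^ (1 - ξ))) ≤ (ξ / (1 - ξ) / γ) ^ (ξ / (1 - ξ)) * x ^ (-ξ) := by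
  have hξ' : 0 < 1 - ξ := by linarith
  set r := ξ / (1 - ξ) with hr
  have hr0 : 0 < r := by positivity
  have hxp : 0 < x ^ (1 - ξ) := Real.rpow_pos_of_pos hx _
  have h1 : (γ * x ^ (1 - ξ) / r) ^ r ≤ Real.exp (γ * x ^ (1 - ξ)) := by
    have h2 : γ * x ^ (1 - ξ) / r ≤ Real.exp (γ * x ^ (1 - ξ) / r) := by
      linarith [Real.add_one_le_exp (γ * x ^ (1 - ξ) / r)]
    have h3 := Real.rpow_le_rpow (by positivity) h2 hr0.le
    rwa [← Real.exp_mul, div_mul_cancel₀ _ hr0.ne'] at h3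
  have h4 : (γ * x ^ (1 - ξ) / r) ^ r = ((r / γ) ^ r * x ^ (-ξ))⁻¹ := by
    have h5 : γ * x ^ (1 - ξ) / r = (r / γ)⁻¹ * x ^ (1 - ξ) := by rw [inv_div]; ring
    rw [h5, Real.mul_rpow (by positivity) hxp.le, Real.inv_rpow (by positivity),
      ← Real.rpow_mul hx.le, mul_inv, Real.rpow_neg hx.le, inv_inv]
    congr 2
    rw [hr]; field_simp
  rw [Real.exp_neg]
  rw [h4] at h1
  exact inv_le_of_inv_le₀ (by positivity) h1

/-- The size of the problem that enters the number of iterations. -/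
lemma sampleSize_bounds {L ρ ε η : ℝ} (hL : 1 ≤ L) (hρ : 0 ≤ ρ) (hε : 0 < ε) (hε1 : ε < 1)
    (hη : 0 < η) :
    1 ≤ L * (1 + ρ) * (1 + Real.log (1 / ε) + Real.log (1 + 1 / η)) ∧
    L ≤ L * (1 + ρ) * (1 + Real.log (1 / ε) + Real.log (1 + 1 / η)) ∧
    L * ρ ^ 2 ≤ (L * (1 + ρ) * (1 + Real.log (1 / ε) + Real.log (1 + 1 / η))) ^ 2 ∧
    Real.log (1 / ε) ≤ L * (1 + ρ) * (1 + Real.log (1 / ε) + Real.log (1 + 1 / η)) ∧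
    Real.log (1 / η) ≤ L * (1 + ρ) * (1 + Real.log (1 / ε) + Real.log (1 + 1 / η)) := by
  have h1 : 0 ≤ Real.log (1 / ε) := Real.log_nonneg (by rw [le_div_iff₀ hε]; linarith)
  have h2 : 0 ≤ Real.log (1 + 1 / η) := Real.log_nonneg (by have : 0 < 1 / η := by positivity
                                                            linarith)
  have h3 : Real.log (1 / η) ≤ Real.log (1 + 1 / η) :=
    Real.log_le_log (by positivity) (by linarith)
  set w := 1 + Real.log (1 / ε) + Real.log (1 + 1 / η) with hw
  have hw1 : 1 ≤ w := by linarith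
  have hL1 : L ≤ L * (1 + ρ) := le_mul_of_one_le_right (by linarith) (by linarith)
  have hZ : L * (1 + ρ) ≤ L * (1 + ρ) * w := le_mul_of_one_le_right (by linarith) hw1
  have hwZ : w ≤ L * (1 + ρ) * w := le_mul_of_one_le_left (by linarith) (by linarith)
  refine ⟨by linarith, by linarith, ?_, by linarith, by linarith⟩
  calc L * ρ ^ 2 ≤ L ^ 2 * (1 + ρ) ^ 2 := by
        refine mul_le_mul ?_ (pow_le_pow_left₀ hρ (by linarith) 2) (by positivity) (by positivity)
        rw [sq]
        exact le_mul_of_one_le_left (by linarith) hL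
    _ = (L * (1 + ρ)) ^ 2 := by ring
    _ ≤ _ := pow_le_pow_left₀ (by positivity) hZ 2

/-- The iteration count exceeds both the bound for the offset, giving c₀ ≤ T, and the multiple of
L₁² needed for T ≥ τ_mix. The exponent 3/ξ of `Z` dominates the powers 1/ξ and 2 of L₁. -/
lemma le_of_sampleBound_le {K Kc k h Z L ε η T : ℝ} (hξ0 : 0 < ξ) (hξ : ξ ≤ 1) (hKc : 0 < Kc)
    (hk : 0 < k) (hh : h = 2 ^ (2 / ξ)) (hK : Kc ≤ K) (hK' : k * h ≤ K) (hL : 1 ≤ L) (hLZ : L ≤ Z)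
    (hε : 0 < ε) (hε1 : ε < 1) (hη : 0 < η) (hη2 : η ≤ 2)
    (hT : K * Z ^ (3 / ξ) * ε ^ (-1 / ξ) * η ^ (-2 / ξ) ≤ T) :
    Kc * (L ^ (1 / ξ) * η ^ (-2 / ξ)) ≤ T ∧ k * L ^ 2 ≤ T := by
  have hηp : 0 < η ^ (-2 / ξ) := Real.rpow_pos_of_pos hη _
  have hεp : 1 ≤ ε ^ (-1 / ξ) :=
    Real.one_le_rpow_of_pos_of_le_one_of_nonpos hε hε1.le (by
      rw [neg_div]; exact neg_nonpos.2 (by positivity))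
  have hZ1 : 1 ≤ Z := hL.trans hLZ
  have hbase : ∀ q y : ℝ, 0 ≤ q → q ≤ 3 / ξ → 0 ≤ y → y ≤ K →
      y * L ^ q * η ^ (-2 / ξ) ≤ T := fun q y hq0 hq hy hyK => by
    refine le_trans ?_ hT
    refine mul_le_mul_of_nonneg_right ?_ hηp.le
    have h1 : L ^ q ≤ Z ^ (3 / ξ) := (Real.rpow_le_rpow (by linarith) hLZ hq0).trans
      (Real.rpow_le_rpow_of_exponent_le hZ1 hq)
    have h2 : y * L ^ q ≤ K * Z ^ (3 / ξ) := mul_le_mul hyK h1 (by positivity) (hy.trans hyK)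
    have h3 : 0 ≤ K * Z ^ (3 / ξ) := mul_nonneg (hy.trans hyK) (by positivity)
    exact h2.trans (le_mul_of_one_le_right h3 hεp)
  constructor
  · rw [← mul_assoc]
    exact hbase (1 / ξ) Kc (by positivity) (by gcongr; norm_num) hKc.le hK
  · have h1 := hbase 2 (k * h) zero_le_two (by rw [le_div_iff₀ hξ0]; linarith)
      (by rw [hh]; positivity) hK'
    refine le_trans ?_ h1
    rw [Real.rpow_two, mul_right_comm k h, mul_assoc _ h]
    refine le_mul_of_one_le_right (by positivity) ?_
    rw [hh]
    exact one_le_mul_rpow_neg hξ0 hη hη2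

/-- The number of iterations suffices for the error bound with `ξ < 1`. -/
lemma exists_sampleBound_lt_one (hξ0 : 0 < ξ) (hξ : ξ < 1) (hκ₁ : 0 < κ₁) (hκ : κ₁ ≤ κ₂) :
    ∃ K : ℝ, 0 < K ∧ ∀ (a η C β ε ρ b g : ℝ) (T : ℕ), 0 < η → η ≤ 2 → κ₁ / η ≤ a → a ≤ κ₂ / η →
      1 < C → 0 ≤ β → β < 1 → 0 < ε → ε < 1 → 0 ≤ ρ → b ≤ 5 * ρ ^ 2 → 0 ≤ b →
      g ≤ 9 * ρ ^ 2 → 0 ≤ g →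
      sampleBound K (3 / ξ) ξ η (L1 C β) ρ ε ≤ T →
      tauMix C β (stepsize a (minOffset a ξ η C β) ξ T) ≤ T ∧
      b * Real.exp (-(η * a / (1 - ξ)) * (((T : ℝ) + minOffset a ξ η C β) ^ (1 - ξ) -
          minOffset a ξ η C β ^ (1 - ξ))) +
        2240 * L1 C β * g * (a / (η * ((T : ℝ) + minOffset a ξ η C β) ^ ξ)) ≤ ε := by
  obtain ⟨Kc, hKc, hoff⟩ := exists_minOffset_le hξ0 hξ.le hκ₁ hκ (fun h => absurd h hξ.ne)
  have hκ₂ : 0 < κ₂ := hκ₁.trans_le hκ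
  have hξ' : 0 < 1 - ξ := by linarith
  set h : ℝ := 2 ^ (2 / ξ) with hh
  have hh0 : 0 < h := by positivity
  set k : ℝ := 1 + 8 / κ₁
  have hk : 0 < k := by positivity
  have hhalf : 0 < 1 - (1 / 2 : ℝ) ^ (1 - ξ) :=
    sub_pos.2 (Real.rpow_lt_one (by norm_num) (by norm_num) hξ')
  -- Since c₀ ≤ T, c₀ is at most half of T + c₀, so a fixed fraction of (T + c₀)^(1-ξ) survives the
  -- subtraction of c₀^(1-ξ).
  set γ := κ₁ / (1 - ξ) * (1 - (1 / 2 : ℝ) ^ (1 - ξ)) with hγ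
  have hγ0 : 0 < γ := by positivity
  set q := (ξ / (1 - ξ) / γ) ^ (ξ / (1 - ξ)) with hq
  have hq0 : 0 < q := by positivity
  -- Here 20 = 5 · 4, from the initial error 5ρ² and 1 ≤ 4/η², and 20160 = 2240 · 9, from the noise
  -- with g ≤ 9ρ². The power 1/ξ of `B` in the final constant undoes the power ξ of T.
  set B := 20 * q + 20160 * κ₂ with hB
  have hB0 : 0 < B := by positivity
  refine ⟨Kc + k * h + B ^ (1 / ξ), by positivity, ?_⟩
  intro a η C β ε ρ b g T hη hη2 ha₁ ha₂ hC hβ0 hβ1 hε hε1 hρ hb hb0 hg hg0 hT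
  have ha : 0 < a := (div_pos hκ₁ hη).trans_le ha₁
  have hc0 := minOffset_pos a ξ η C β
  have hoff' := hoff a η C β hη hη2 ha₁ ha₂
  have hL := one_le_L1 C β
  obtain ⟨hZ1, hLZ, hρZ, -, -⟩ := sampleSize_bounds hL hρ hε hε1 hη
  rw [sampleBound] at hT
  have hBp : 0 < B ^ (1 / ξ) := by positivity
  obtain ⟨hT1, hT2⟩ := le_of_sampleBound_le hξ0 hξ.le hKc hk hh
    (by have := mul_pos hk hh0; linarith) (by linarith) hL hLZ hε hε1 hη hη2 hT
  generalize L1 C β * (1 + ρ) * (1 + Real.log (1 / ε) + Real.log (1 + 1 / η)) = Z at *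
  have hcT : minOffset a ξ η C β ≤ T := hoff'.trans hT1
  have h8 := eight_le_of_minOffset_le (le_refl (minOffset a ξ η C β))
  have hT0 : 1 ≤ (T : ℝ) := by linarith
  refine ⟨tauMix_le hξ.le hκ₁ hη hη2 ha₁ hC hβ0 hβ1 (k := k)
    (by have : 0 < 8 / κ₁ := by positivity
        linarith) (by linarith) hT0 hT2 hc0 hcT, ?_⟩
  generalize minOffset a ξ η C β = c at *
  have hTpos : 0 < (T : ℝ) := by linarith
  -- the iteration count in the form of a bound for `T ^ (-ξ)`
  have hTξ : Z ^ 2 * (1 / η ^ 2) * B * (T : ℝ) ^ (-ξ) ≤ ε := by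
    have h1 : B ^ (1 / ξ) * Z ^ (3 / ξ) * ε ^ (-1 / ξ) * η ^ (-2 / ξ) ≤ T := by
      refine le_trans ?_ hT
      gcongr
      have := mul_pos hk hh0
      linarith
    have h2 := Real.rpow_le_rpow (by positivity) h1 hξ0.le
    have hZ0 : 0 < Z := by linarith
    rw [Real.mul_rpow (by positivity) (by positivity), Real.mul_rpow (by positivity) (by positivity),
      Real.mul_rpow (by positivity) (by positivity), ← Real.rpow_mul hB0.le, ← Real.rpow_mul hZ0.le,
      ← Real.rpow_mul hε.le, ← Real.rpow_mul hη.le, div_mul_cancel₀ _ hξ0.ne',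
      div_mul_cancel₀ _ hξ0.ne', div_mul_cancel₀ _ hξ0.ne', div_mul_cancel₀ _ hξ0.ne',
      Real.rpow_one, Real.rpow_neg_one, Real.rpow_neg hη.le, Real.rpow_two] at h2
    have h3 : Z ^ (3 : ℝ) = Z ^ 3 := by exact_mod_cast Real.rpow_natCast Z 3
    rw [h3] at h2
    have hTp : 0 < (T : ℝ) ^ ξ := Real.rpow_pos_of_pos hTpos _
    rw [Real.rpow_neg hTpos.le, ← div_eq_mul_inv, div_le_iff₀ hTp]
    have h4 := mul_le_mul_of_nonneg_left h2 hε.le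
    refine le_trans ?_ h4
    have h5 : ε * (B * Z ^ 3 * ε⁻¹ * (η ^ 2)⁻¹) = Z * (Z ^ 2 * (1 / η ^ 2) * B) := by
      field_simp
    rw [h5]
    exact le_mul_of_one_le_left (by positivity) hZ1
  have hx : 0 < (T : ℝ) + c := by linarith
  have hxT : ((T : ℝ) + c) ^ (-ξ) ≤ (T : ℝ) ^ (-ξ) :=
    Real.rpow_le_rpow_of_nonpos hTpos (by linarith) (by linarith)
  have hTn : 0 < (T : ℝ) ^ (-ξ) := Real.rpow_pos_of_pos hTpos _
  have haη₁ : κ₁ ≤ η * a := by rw [div_le_iff₀ hη] at ha₁; linarith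
  have haη₂ : a * η ≤ κ₂ := (le_div_iff₀ hη).1 ha₂
  have hexp : Real.exp (-(η * a / (1 - ξ)) * (((T : ℝ) + c) ^ (1 - ξ) - c ^ (1 - ξ))) ≤
      q * (T : ℝ) ^ (-ξ) := by
    refine le_trans ?_ ((exp_neg_mul_rpow_le hξ0 hξ hγ0 hx).trans
      (mul_le_mul_of_nonneg_left hxT hq0.le))
    rw [Real.exp_le_exp]
    have h1 : c ^ (1 - ξ) ≤ (1 / 2 : ℝ) ^ (1 - ξ) * ((T : ℝ) + c) ^ (1 - ξ) := by
      rw [← Real.mul_rpow (by norm_num) hx.le]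
      exact Real.rpow_le_rpow (by linarith) (by linarith) hξ'.le
    have hxp : 0 < ((T : ℝ) + c) ^ (1 - ξ) := Real.rpow_pos_of_pos hx _
    have h2 : (1 - (1 / 2 : ℝ) ^ (1 - ξ)) * ((T : ℝ) + c) ^ (1 - ξ) ≤
      ((T : ℝ) + c) ^ (1 - ξ) - c ^ (1 - ξ) := by linarith
    have h3 : κ₁ / (1 - ξ) ≤ η * a / (1 - ξ) := by gcongr
    have h4 := mul_le_mul h3 h2 (by positivity) (by positivity)
    have h5 : γ * ((T : ℝ) + c) ^ (1 - ξ) =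
      κ₁ / (1 - ξ) * ((1 - (1 / 2 : ℝ) ^ (1 - ξ)) * ((T : ℝ) + c) ^ (1 - ξ)) := by rw [hγ]; ring
    rw [h5]
    linarith
  have hη4 : 1 ≤ 4 * (1 / η ^ 2) := by
    rw [mul_one_div, le_div_iff₀ (by positivity)]
    nlinarith
  have hZ2 : ρ ^ 2 ≤ Z ^ 2 := (le_mul_of_one_le_left (sq_nonneg ρ) hL).trans hρZ
  have t1 : b * Real.exp (-(η * a / (1 - ξ)) * (((T : ℝ) + c) ^ (1 - ξ) - c ^ (1 - ξ))) ≤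
      Z ^ 2 * (1 / η ^ 2) * (20 * q) * (T : ℝ) ^ (-ξ) := by
    calc _ ≤ 5 * Z ^ 2 * (q * (T : ℝ) ^ (-ξ)) :=
          mul_le_mul (by linarith) hexp (Real.exp_pos _).le (by positivity)
      _ = 1 * (5 * Z ^ 2 * (q * (T : ℝ) ^ (-ξ))) := by ring
      _ ≤ 4 * (1 / η ^ 2) * (5 * Z ^ 2 * (q * (T : ℝ) ^ (-ξ))) :=
          mul_le_mul_of_nonneg_right hη4 (by positivity)
      _ = _ := by ring
  have t2 : 2240 * L1 C β * g * (a / (η * ((T : ℝ) + c) ^ ξ)) ≤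
      Z ^ 2 * (1 / η ^ 2) * (20160 * κ₂) * (T : ℝ) ^ (-ξ) := by
    have h1 : a / (η * ((T : ℝ) + c) ^ ξ) ≤ κ₂ * (1 / η ^ 2) * (T : ℝ) ^ (-ξ) := by
      calc a / (η * ((T : ℝ) + c) ^ ξ) = a / η * ((T : ℝ) + c) ^ (-ξ) := by
            rw [Real.rpow_neg hx.le, div_mul_eq_div_div]
            exact div_eq_mul_inv _ _
        _ ≤ κ₂ * (1 / η ^ 2) * (T : ℝ) ^ (-ξ) := by
            refine mul_le_mul ?_ hxT (Real.rpow_pos_of_pos hx _).le (by positivity)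
            rw [mul_one_div, div_le_div_iff₀ hη (by positivity)]
            have := mul_le_mul_of_nonneg_right haη₂ hη.le
            linarith
    have h2 : L1 C β * g ≤ 9 * Z ^ 2 := by
      have := mul_le_mul_of_nonneg_left hg (zero_le_one.trans hL)
      linarith
    calc _ = 2240 * (L1 C β * g) * (a / (η * ((T : ℝ) + c) ^ ξ)) := by ring
      _ ≤ 2240 * (9 * Z ^ 2) * (κ₂ * (1 / η ^ 2) * (T : ℝ) ^ (-ξ)) :=
          mul_le_mul (by linarith) h1 (by positivity) (by positivity)
      _ = _ := by ring
  calc _ ≤ _ := add_le_add t1 t2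
    _ = Z ^ 2 * (1 / η ^ 2) * B * (T : ℝ) ^ (-ξ) := by rw [hB]; ring
    _ ≤ ε := hTξ

/-- As aη ≥ 1, the power is at most its base c/(T + c) ≤ c/N. The offset is O(Z/η²), so the factor
1/η² of N cancels and n² makes the rest small. -/
lemma initial_term_le {a η ε Z n c N Kc b : ℝ} {T : ℕ} (hε : 0 < ε) (hη : 0 < η) (hZ0 : 0 < Z)
    (hn0 : 0 < n) (hKc : 0 < Kc) (hc0 : 0 < c) (hN : N = n ^ 2 * Z ^ 3 * (1 / ε) * (1 / η ^ 2))
    (hT : N ≤ T) (haη₁ : 1 ≤ a * η) (hoff : c ≤ Kc * (Z * (1 / η ^ 2)))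
    (hb : b ≤ 5 * Z ^ 2) (hnK : 10 * Kc ≤ n ^ 2) :
    b * (c / ((T : ℝ) + c)) ^ (a * η) ≤ ε / 2 := by
  have hN0 : 0 < N := by rw [hN]; positivity
  have hx : 0 < (T : ℝ) + c := by positivity
  have hT0 : 0 ≤ (T : ℝ) := by positivity
  have h1 : (c / ((T : ℝ) + c)) ^ (a * η) ≤ c / N := by
    calc (c / ((T : ℝ) + c)) ^ (a * η) ≤ (c / ((T : ℝ) + c)) ^ (1 : ℝ) :=
          Real.rpow_le_rpow_of_exponent_ge (by positivity)
            (by rw [div_le_one hx]; linarith) haη₁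
      _ ≤ c / N := by
          rw [Real.rpow_one]
          exact div_le_div_of_nonneg_left hc0.le hN0 (by linarith)
  have h2 : c / N ≤ Kc * (Z * (1 / η ^ 2)) / N := div_le_div_of_nonneg_right hoff hN0.le
  calc b * (c / ((T : ℝ) + c)) ^ (a * η) ≤ 5 * Z ^ 2 * (Kc * (Z * (1 / η ^ 2)) / N) :=
        mul_le_mul hb (h1.trans h2) (by positivity) (by positivity)
    _ = 5 * Kc * ε / n ^ 2 := by rw [hN]; field_simp
    _ ≤ ε / 2 := by
        rw [div_le_div_iff₀ (by positivity) zero_lt_two]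
        have := mul_le_mul_of_nonneg_left hnK hε.le
        linarith

/-- log x / x decreases beyond e, so T + c may be replaced by N. The logarithm costs one factor n
and one factor Z, log N ≤ 8nZ. This is why N carries n² and Z³, leaving one n for smallness and Z²
for the scale of the noise. -/
lemma noise_term_le {a η ε Z n c N k₂ g' : ℝ} {T : ℕ} (hε : 0 < ε) (hε1 : ε < 1) (hη : 0 < η)
    (hη2 : η ≤ 2) (hZ1 : 1 ≤ Z) (hn1 : 16 ≤ n) (ha : 0 < a) (hκ₂ : 0 < κ₂) (hc0 : 0 < c)
    (hN : N = n ^ 2 * Z ^ 3 * (1 / ε) * (1 / η ^ 2)) (hT : N ≤ T) (hεZ : Real.log (1 / ε) ≤ Z)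
    (hηZ : Real.log (1 / η) ≤ Z) (haη₂ : a * η ≤ κ₂) (hk₂ : k₂ = 60 * κ₂ ^ 2 + 20 * κ₂)
    (hg : g' ≤ 9 * Z ^ 2) (hkn : 2304 * k₂ ≤ n) :
    16 * g' * ((60 * a ^ 2 + 10 * a) * Real.log (T + c) / (T + c)) ≤ ε / 2 := by
  have hZ0 : 0 < Z := by linarith
  have hn0 : 0 < n := by linarith
  have hN0 : 0 < N := by rw [hN]; positivity
  have hx : 0 < (T : ℝ) + c := by positivity
  have hk₂0 : 0 < k₂ := by rw [hk₂]; positivity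
  have hη4 : 1 ≤ 4 * (1 / η ^ 2) := by
    rw [mul_one_div, le_div_iff₀ (by positivity)]
    nlinarith
  have hNe : Real.exp 1 ≤ N := by
    have h1 : (1 : ℝ) ≤ 1 / ε := by rw [le_div_iff₀ hε]; linarith
    have h2 : (1 : ℝ) ≤ Z ^ 3 := one_le_pow₀ hZ1
    have h3 : (1 : ℝ) / 4 ≤ 1 / η ^ 2 := by linarith
    calc Real.exp 1 ≤ 16 ^ 2 * 1 * 1 * (1 / 4) := by linarith [Real.exp_one_lt_d9]
      _ ≤ N := by rw [hN]; gcongr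
  have h1 : Real.log ((T : ℝ) + c) / (T + c) ≤ Real.log N / N :=
    Real.log_div_self_antitoneOn hNe (hNe.trans (by linarith : N ≤ (T : ℝ) + c))
      (by linarith)
  have h2 : Real.log N ≤ 8 * n * Z := by
    have e1 : Real.log N = 2 * Real.log n + 3 * Real.log Z + Real.log (1 / ε) +
        2 * Real.log (1 / η) := by
      have : (1 : ℝ) / η ^ 2 = (1 / η) ^ 2 := by rw [one_div_pow]
      rw [hN, this, Real.log_mul (by positivity) (by positivity),
        Real.log_mul (by positivity) (by positivity),
        Real.log_mul (by positivity) (by positivity), Real.log_pow, Real.log_pow, Real.log_pow]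
      push_cast
      ring
    have e2 := Real.log_le_sub_one_of_pos (show 0 < n by linarith)
    have e3 := Real.log_le_sub_one_of_pos hZ0
    have e4 : n ≤ n * Z := le_mul_of_one_le_right (by linarith) hZ1
    have e5 : Z * 16 ≤ Z * n := mul_le_mul_of_nonneg_left hn1 hZ0.le
    rw [e1]
    linarith
  have h3 : 60 * a ^ 2 + 10 * a ≤ k₂ * (1 / η ^ 2) := by
    rw [mul_one_div, le_div_iff₀ (by positivity), hk₂]
    have e1 : (a * η) ^ 2 ≤ κ₂ ^ 2 := pow_le_pow_left₀ (by positivity) haη₂ 2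
    have e2 : a * η * η ≤ κ₂ * 2 := mul_le_mul haη₂ hη2 hη.le hκ₂.le
    linarith
  have h5 : 0 ≤ Real.log ((T : ℝ) + c) / (T + c) :=
    div_nonneg (Real.log_nonneg (by linarith [Real.add_one_le_exp 1])) hx.le
  calc _ = 16 * g' * ((60 * a ^ 2 + 10 * a) * (Real.log (T + c) / (T + c))) := by ring
    _ ≤ 16 * (9 * Z ^ 2) * (k₂ * (1 / η ^ 2) * (8 * n * Z / N)) := by
        refine mul_le_mul (by linarith) (mul_le_mul h3 (h1.trans ?_) h5 (by positivity))
          (by positivity) (by positivity)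
        gcongr
    _ = 1152 * k₂ * ε / n := by rw [hN]; field_simp; norm_num
    _ ≤ ε / 2 := by
        rw [div_le_div_iff₀ (by positivity) zero_lt_two]
        have := mul_le_mul_of_nonneg_left hkn hε.le
        linarith

/-- The number of iterations suffices for the error bound with `ξ = 1`. -/
lemma exists_sampleBound_one (hκ₁ : 1 ≤ κ₁) (hκ : κ₁ ≤ κ₂) :
    ∃ K : ℝ, 0 < K ∧ ∀ (a η C β ε ρ b g : ℝ) (T : ℕ), 0 < η → η ≤ 2 → κ₁ / η ≤ a → a ≤ κ₂ / η →
      1 < C → 0 ≤ β → β < 1 → 0 < ε → ε < 1 → 0 ≤ ρ → b ≤ 5 * ρ ^ 2 → 0 ≤ b →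
      g ≤ 9 * ρ ^ 2 → 0 ≤ g →
      sampleBound K (3 / 1) 1 η (L1 C β) ρ ε ≤ T →
      tauMix C β (stepsize a (minOffset a 1 η C β) 1 T) ≤ T ∧
      b * (minOffset a 1 η C β / ((T : ℝ) + minOffset a 1 η C β)) ^ (a * η) +
        16 * (L1 C β * g) * ((60 * a ^ 2 + 10 * a) *
          Real.log (T + minOffset a 1 η C β) / (T + minOffset a 1 η C β)) ≤ ε := by
  obtain ⟨Kc, hKc, hoff⟩ := exists_minOffset_le one_pos le_rfl (by linarith) hκ (fun _ => hκ₁)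
  have hκ₁0 : 0 < κ₁ := by linarith
  have hκ₂ : 0 < κ₂ := hκ₁0.trans_le hκ
  set h : ℝ := 2 ^ (2 / (1 : ℝ)) with hh
  have hh0 : 0 < h := by positivity
  set k : ℝ := 1 + 8 / κ₁
  have hk : 0 < k := by positivity
  set k₂ := 60 * κ₂ ^ 2 + 20 * κ₂ with hk₂
  have hk₂0 : 0 < k₂ := by positivity
  -- The summands serve, in order: log N ≤ 8nZ and N ≥ e; the initial error and the offset; the
  -- mixing time; the noise term.
  set n : ℝ := 16 + 10 * Kc + k * h + 2304 * k₂ with hn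
  have hkh : 0 < k * h := by positivity
  have hn1 : 16 ≤ n := by linarith
  have hnK : n ≤ n ^ 2 := by nlinarith
  refine ⟨n ^ 2, by positivity, ?_⟩
  intro a η C β ε ρ b g T hη hη2 ha₁ ha₂ hC hβ0 hβ1 hε hε1 hρ hb hb0 hg hg0 hT
  have ha : 0 < a := (div_pos hκ₁0 hη).trans_le ha₁
  have hc0 := minOffset_pos a 1 η C β
  have hoff' := hoff a η C β hη hη2 ha₁ ha₂
  have hL := one_le_L1 C β
  obtain ⟨hZ1, hLZ, hρZ, hεZ, hηZ⟩ := sampleSize_bounds hL hρ hε hε1 hη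
  rw [sampleBound] at hT
  obtain ⟨hT1, hT2⟩ := le_of_sampleBound_le one_pos le_rfl hKc hk hh
    (by linarith) (by linarith) hL hLZ hε hε1 hη hη2 hT
  generalize L1 C β * (1 + ρ) * (1 + Real.log (1 / ε) + Real.log (1 + 1 / η)) = Z at *
  have hcT : minOffset a 1 η C β ≤ T := hoff'.trans hT1
  have h8 := eight_le_of_minOffset_le (le_refl (minOffset a 1 η C β))
  have hT0 : 1 ≤ (T : ℝ) := by linarith
  refine ⟨tauMix_le le_rfl hκ₁0 hη hη2 ha₁ hC hβ0 hβ1 (k := k)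
    (by have : 0 < 8 / κ₁ := by positivity
        linarith) (by linarith) hT0 hT2 hc0 hcT, ?_⟩
  generalize minOffset a 1 η C β = c at *
  have hZ0 : 0 < Z := by linarith
  have hZ3 : Z ^ (3 / 1 : ℝ) = Z ^ 3 := by rw [div_one]; exact_mod_cast Real.rpow_natCast Z 3
  have hη2' : η ^ (-2 / 1 : ℝ) = 1 / η ^ 2 := by
    rw [div_one, Real.rpow_neg hη.le, Real.rpow_two, one_div]
  have hε' : ε ^ (-1 / 1 : ℝ) = 1 / ε := by rw [div_one, Real.rpow_neg_one, one_div]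
  rw [hZ3, hη2', hε'] at hT
  rw [hη2', div_one, Real.rpow_one] at hoff'
  have haη₁ : 1 ≤ a * η := by rw [div_le_iff₀ hη] at ha₁; linarith only [ha₁, hκ₁]
  have haη₂ : a * η ≤ κ₂ := (le_div_iff₀ hη).1 ha₂
  have hZ2 : ρ ^ 2 ≤ Z ^ 2 := (le_mul_of_one_le_left (sq_nonneg ρ) hL).trans hρZ
  have hL0 := zero_le_one.trans hL
  have hoff'' : c ≤ Kc * (Z * (1 / η ^ 2)) := hoff'.trans (by gcongr)
  have hLg : L1 C β * g ≤ 9 * Z ^ 2 := by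
    have := mul_le_mul_of_nonneg_left hg hL0
    linarith only [this, hρZ]
  have t1 := initial_term_le (b := b) hε hη hZ0 (by linarith only [hn1]) hKc hc0 rfl hT haη₁ hoff''
    (by linarith only [hb, hZ2]) (by linarith only [hnK, hn, hkh, hk₂0])
  have t2 := noise_term_le hε hε1 hη hη2 hZ1 hn1 ha hκ₂ hc0 rfl hT hεZ hηZ haη₂ hk₂
    hLg (by linarith only [hn, hkh, hKc])
  linarith only [t1, t2]

end SampleComplexity

namespace PolicyEvaluation

variable {S : Type*} {A : Type*} [Fintype S] [Fintype A] {d : ℕ} (M : PolicyEvaluation S A d)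
  {Ω : Type*} [MeasurableSpace Ω]

lemma sq_scale_le (Pr : Measure Ω) (θ₀ : Ω → EuclideanSpace ℝ (Fin d))
    (θs : EuclideanSpace ℝ (Fin d)) :
    (M.rmax + 3 * ‖θs‖) ^ 2 ≤ 9 * (√(∫ ω, ‖θ₀ ω - θs‖ ^ 2 ∂Pr) + M.rmax + ‖θs‖) ^ 2 := by
  have h1 := Real.sqrt_nonneg (∫ ω, ‖θ₀ ω - θs‖ ^ 2 ∂Pr)
  have h2 := M.rmax_nonneg
  have h3 := norm_nonneg θs
  calc (M.rmax + 3 * ‖θs‖) ^ 2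
      ≤ (3 * (√(∫ ω, ‖θ₀ ω - θs‖ ^ 2 ∂Pr) + M.rmax + ‖θs‖)) ^ 2 :=
        pow_le_pow_left₀ (by positivity) (by linarith) 2
    _ = _ := by ring

/-- The constant 5 rounds up 2 + 9/4: each of the squared initial error and a ninth of (r_max +
3‖θ*‖)² is at most ρ². -/
lemma initialError_bounds (Pr : Measure Ω) (θ₀ : Ω → EuclideanSpace ℝ (Fin d))
    (θs : EuclideanSpace ℝ (Fin d)) :
    0 ≤ √(∫ ω, ‖θ₀ ω - θs‖ ^ 2 ∂Pr) + M.rmax + ‖θs‖ ∧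
    0 ≤ 2 * (∫ ω, ‖θ₀ ω - θs‖ ^ 2 ∂Pr) + (M.rmax + 3 * ‖θs‖) ^ 2 / 4 ∧
    2 * (∫ ω, ‖θ₀ ω - θs‖ ^ 2 ∂Pr) + (M.rmax + 3 * ‖θs‖) ^ 2 / 4 ≤
      5 * (√(∫ ω, ‖θ₀ ω - θs‖ ^ 2 ∂Pr) + M.rmax + ‖θs‖) ^ 2 := by
  have h0 : 0 ≤ ∫ ω, ‖θ₀ ω - θs‖ ^ 2 ∂Pr := integral_nonneg fun _ => sq_nonneg _
  have h1 := Real.sqrt_nonneg (∫ ω, ‖θ₀ ω - θs‖ ^ 2 ∂Pr)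
  have h2 := M.rmax_nonneg
  have h3 := norm_nonneg θs
  have h4 := M.sq_scale_le Pr θ₀ θs
  have h5 := Real.sq_sqrt h0
  generalize ∫ ω, ‖θ₀ ω - θs‖ ^ 2 ∂Pr = E at *
  generalize ‖θs‖ = x at *
  generalize M.rmax = r at *
  refine ⟨by positivity, by positivity, ?_⟩
  have h6 : E ≤ (√E + r + x) ^ 2 := by
    calc E = √E ^ 2 := h5.symm
      _ ≤ _ := pow_le_pow_left₀ h1 (by linarith) 2
  linarith [sq_nonneg (√E + r + x)]

end PolicyEvaluation

end AvgRewardTD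

theorem theorem3 :
    -- the stationary distribution, the mixing constants, `η > 0` and `θ*` exist
    (∀ (S : Type u) (A : Type v) [Fintype S] [DecidableEq S] [Nonempty S] [Fintype A] (d : ℕ)
        (M : PolicyEvaluation S A d), 0 < d → M.P.IsIrreducible → IsAperiodic M.P →
      (∃! μ : S → ℝ, IsStationaryDist M.P μ) ∧
      ∀ μ : S → ℝ, IsStationaryDist M.P μ →
        (∀ s, 0 < μ s) ∧ 0 < M.eta μ ∧ (∃ C β : ℝ, IsMixing M.P μ C β) ∧
        ∃! θs : EuclideanSpace ℝ (Fin d), M.IsFixedPoint μ θs) ∧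
    -- `K₀` is an absolute constant, and `c₀ ≥ cMin a ξ η C β` is what large `c₀` means
    ∃ K₀ : ℝ, 0 < K₀ ∧ ∃ cMin : ℝ → ℝ → ℝ → ℝ → ℝ → ℝ,
      (∀ a ξ η C β : ℝ, 0 < cMin a ξ η C β) ∧
      -- the error bounds
      (∀ (S : Type u) (A : Type v) [Fintype S] [DecidableEq S] [Nonempty S] [Fintype A]
          [MeasurableSpace S] [DiscreteMeasurableSpace S] (d : ℕ) (M : PolicyEvaluation S A d)
          (μ : S → ℝ) (C β : ℝ) (θs : EuclideanSpace ℝ (Fin d))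
          (Ω : Type w) [MeasurableSpace Ω] (Pr : Measure Ω) [IsProbabilityMeasure Pr]
          (s sHat : ℕ → Ω → S) (θ₀ : Ω → EuclideanSpace ℝ (Fin d)) (a ξ c₀ : ℝ) (T : ℕ),
        0 < d → M.P.IsIrreducible → IsAperiodic M.P → IsStationaryDist M.P μ →
        IsMixing M.P μ C β → M.IsFixedPoint μ θs → IsDoubleChain M.P Pr s sHat θ₀ →
        0 < a → 0 < ξ → ξ ≤ 1 → cMin a ξ (M.eta μ) C β ≤ c₀ →
        tauMix C β (stepsize a c₀ ξ T) ≤ T →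
        (ξ = 1 →
          MeanSquareLE Pr (fun ω => M.iterate (stepsize a c₀ ξ) s sHat θ₀ T ω - θs)
            (beta1 Pr θ₀ M.rmax θs *
                (((tauMix C β (stepsize a c₀ ξ T) : ℝ) + c₀) / ((T : ℝ) + c₀)) ^ (a * M.eta μ) +
              Gam a c₀ (M.eta μ) (L1 C β) (beta2 M.rmax θs) T /
                ((T : ℝ) + c₀) ^ (min 1 (a * M.eta μ)))) ∧
        (ξ < 1 →
          MeanSquareLE Pr (fun ω => M.iterate (stepsize a c₀ ξ) s sHat θ₀ T ω - θs)
            (beta1 Pr θ₀ M.rmax θs *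
                Real.exp (-(M.eta μ * a / (1 - ξ)) * (((T : ℝ) + c₀) ^ (1 - ξ) -
                  ((tauMix C β (stepsize a c₀ ξ T) : ℝ) + c₀) ^ (1 - ξ))) +
              2 * a * betaTilde a c₀ (L1 C β) (beta2 M.rmax θs) T /
                (M.eta μ * ((T : ℝ) + c₀) ^ ξ)) ∧
          MeanSquareLE Pr (fun ω => M.iterate (stepsize a c₀ ξ) s sHat θ₀ T ω - θs)
            (beta1 Pr θ₀ M.rmax θs *
                Real.exp (-(M.eta μ * a / (1 - ξ)) * (((T : ℝ) + c₀) ^ (1 - ξ) -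
                  ((tauMix C β (stepsize a c₀ ξ T) : ℝ) + c₀) ^ (1 - ξ))) +
              K₀ * L1 C β * (M.rmax + 3 * ‖θs‖) ^ 2 * (a / (M.eta μ * ((T : ℝ) + c₀) ^ ξ))))) ∧
      -- the sample complexity for `a = Θ(1/η)`
      (∀ ξ κ₁ κ₂ : ℝ, 0 < ξ → ξ ≤ 1 → 0 < κ₁ → κ₁ ≤ κ₂ → (ξ = 1 → 1 ≤ κ₁) →
        ∃ K p : ℝ, 0 < K ∧ 0 < p ∧
        ∀ a η C β : ℝ, 0 < η → κ₁ / η ≤ a → a ≤ κ₂ / η → 1 < C → 0 ≤ β → β < 1 →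
        ∃ c₀ : ℝ, cMin a ξ η C β ≤ c₀ ∧
        ∀ (S : Type u) (A : Type v) [Fintype S] [DecidableEq S] [Nonempty S] [Fintype A]
          [MeasurableSpace S] [DiscreteMeasurableSpace S] (d : ℕ) (M : PolicyEvaluation S A d)
          (μ : S → ℝ) (θs : EuclideanSpace ℝ (Fin d))
          (Ω : Type w) [MeasurableSpace Ω] (Pr : Measure Ω) [IsProbabilityMeasure Pr]
          (s sHat : ℕ → Ω → S) (θ₀ : Ω → EuclideanSpace ℝ (Fin d)) (ε : ℝ) (T : ℕ),
        0 < d → M.P.IsIrreducible → IsAperiodic M.P → IsStationaryDist M.P μ →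
        IsMixing M.P μ C β → M.IsFixedPoint μ θs → IsDoubleChain M.P Pr s sHat θ₀ →
        M.eta μ = η → 0 < ε → ε < 1 →
        sampleBound K p ξ η (L1 C β)
          (√(∫ ω, ‖θ₀ ω - θs‖ ^ 2 ∂Pr) + M.rmax + ‖θs‖) ε ≤ T →
        tauMix C β (stepsize a c₀ ξ T) ≤ T ∧
        MeanSquareLE Pr (fun ω => M.iterate (stepsize a c₀ ξ) s sHat θ₀ T ω - θs) ε) := by
  -- The absolute constant is that of the supersolution 136 α_t/η. In the last part c₀ is the
  -- threshold itself, which makes it depend only on a, ξ, η, C and β.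
  refine ⟨?_, 2240, by norm_num, minOffset, minOffset_pos, ?_, ?_⟩
  · intro S A _ _ _ _ d M hd hirr hap
    obtain ⟨N, hN0, hN⟩ := exists_pow_pos hirr hap
    obtain ⟨μ₀, hμ₀⟩ := exists_isStationaryDist M.P_mem_rowStochastic
    refine ⟨⟨μ₀, hμ₀, fun ν hν => hν.eq M.P_mem_rowStochastic hμ₀ hN⟩, fun μ hμ => ?_⟩
    obtain ⟨C, β, hmix⟩ := exists_isMixing M.P_mem_rowStochastic hμ hN0 hN
    exact ⟨hμ.pos hN, PolicyEvaluation.eta_pos hd (hμ.pos hN) hmix, ⟨C, β, hmix⟩,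
      PolicyEvaluation.existsUnique_isFixedPoint hμ (hμ.pos hN) hmix⟩
  · intro S A _ _ _ _ _ _ d M μ C β θs Ω _ Pr _ s sHat θ₀ a ξ c₀ T hd hirr hap hμ hmix hθs h
      ha hξ0 _ hc _
    obtain ⟨N, -, hN⟩ := exists_pow_pos hirr hap
    have hη : 0 < M.eta μ := PolicyEvaluation.eta_pos hd (hμ.pos hN) hmix
    refine ⟨?_, fun hξ => ⟨?_, ?_⟩⟩
    · rintro rfl
      exact M.meanSquareLE_error_bound_of_eq_one hd hη hμ hmix hθs h ha hc T _
    · exact M.meanSquareLE_log_error_bound_of_lt_one hd hη hμ hmix hθs h ha hξ0 hξ hc T _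
    · exact M.meanSquareLE_error_bound_of_lt_one hd hη hμ hmix hθs h ha hξ0 hξ hc T _
  · intro ξ κ₁ κ₂ hξ0 hξ1 hκ₁ hκ hκ'
    rcases hξ1.lt_or_eq with hξ | rfl
    · obtain ⟨K, hK, hbound⟩ := exists_sampleBound_lt_one hξ0 hξ hκ₁ hκ
      refine ⟨K, 3 / ξ, hK, by positivity, fun a η C β hη ha₁ ha₂ hC hβ0 hβ1 =>
        ⟨minOffset a ξ η C β, le_rfl, ?_⟩⟩
      intro S A _ _ _ _ _ _ d M μ θs Ω _ Pr _ s sHat θ₀ ε T hd _ _ hμ hmix hθs h hM hε hε1 hT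
      subst hM
      obtain ⟨hρ, hb0, hb⟩ := M.initialError_bounds Pr θ₀ θs
      obtain ⟨hτ, hle⟩ := hbound a _ C β ε _ _ _ T hη (PolicyEvaluation.eta_le_two hd hμ) ha₁ ha₂
        hC hβ0 hβ1 hε hε1 hρ hb hb0 (M.sq_scale_le Pr θ₀ θs) (sq_nonneg _) hT
      exact ⟨hτ, (M.meanSquareLE_of_lt_one hd hη hμ hmix hθs h ((div_pos hκ₁ hη).trans_le ha₁)
        hξ0 hξ le_rfl T).mono hle⟩
    · obtain ⟨K, hK, hbound⟩ := exists_sampleBound_one (hκ' rfl) hκ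
      refine ⟨K, 3 / 1, hK, by norm_num, fun a η C β hη ha₁ ha₂ hC hβ0 hβ1 =>
        ⟨minOffset a 1 η C β, le_rfl, ?_⟩⟩
      intro S A _ _ _ _ _ _ d M μ θs Ω _ Pr _ s sHat θ₀ ε T hd _ _ hμ hmix hθs h hM hε hε1 hT
      subst hM
      obtain ⟨hρ, hb0, hb⟩ := M.initialError_bounds Pr θ₀ θs
      obtain ⟨hτ, hle⟩ := hbound a _ C β ε _ _ _ T hη (PolicyEvaluation.eta_le_two hd hμ) ha₁ ha₂
        hC hβ0 hβ1 hε hε1 hρ hb hb0 (M.sq_scale_le Pr θ₀ θs) (sq_nonneg _) hT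
      exact ⟨hτ, (M.meanSquareLE_of_one_le_mul hd hη hμ hmix hθs h ((div_pos hκ₁ hη).trans_le ha₁)
        le_rfl ((hκ' rfl).trans ((div_le_iff₀ hη).1 ha₁)) T).mono hle⟩
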